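/- Let $k$ be a field of characteristic different from $2$, let $G=C_1\times\cdots\times C_n$ be a finite abelian group, where $C_j$ is cyclic of order $m_j\ge 1$ with generator $g_j$, put $N=\mathrm{lcm}\{m_j^2,\ m_sm_t\mid 1\le j\le n,\ 1\le s<t\le n\}$ and assume that $k$ contains a primitive $N$-th root of unity $\zeta$; write $\xi_d=\zeta^{N/d}$ for $d\mid N$. Write $(\cdot,\cdot)$, $(\cdot,\cdot,\cdot)$ for greatest common divisors. Let $\underline a$ be a family of integers $c_l$ $(1\le l\le n)$, $c_{st}$ $(s<t)$, $c_{rst}$ $(r<s<t)$, and let $\omega_{\underline a}$ be the normalized $3$-cocycle on $G$ $$\omega_{\underline a}(g_1^{i_1}\cdots g_n^{i_n},\,g_1^{j_1}\cdots g_n^{j_n},\,g_1^{k_1}\cdots g_n^{k_n})=\prod_{l}\xi_{m_l}^{c_li_l\lfloor\frac{j_l+k_l}{m_l}\rfloor}\prod_{s<t}\xi_{m_t}^{c_{st}i_t\lfloor\frac{j_s+k_s}{m_s}\rfloor}\prod_{r<s<t}\xi_{(m_r,m_s,m_t)}^{-c_{rst}k_rj_si_t}$$ (all exponents $i_l,j_l,k_l$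 in $\{0,\dots,m_l-1\}$). Let $H=k^G_{\omega_{\underline a}}$ be the algebra of functions on $G$ with its usual coproduct, counit and antipode, viewed as a quasi-Hopf algebra with reassociator $\sum\omega_{\underline a}(x,y,z)P_x\otimes P_y\otimes P_z$, where $P_x$ is the characteristic function of $x$. A braided Hopf algebra in ${}^H_H\mathcal{YD}$ means a Hopf algebra in the category of left Yetter–Drinfeld modules over $H$; a $2$-dimensional one is called non-trivial if it is not isomorphic to the group Hopf algebra $k[C_2]$ with trivial $H$-action and $H$-coaction. Let $M=\mathrm{lcm}\{(m_r,m_s,m_t)\mid r<s<t\}$ (with $M=1$ if $n\le 2$) and $M^c_{rst}=\frac{M}{(m_r,m_s,m_t)}c_{rst}$. Let $A'$ be the $n\times\binom n2$ integer matrix whose columns are indexed by the pairs $r<s$ in some order, the column of $(r,s)$ having the entry $M^c_{urs}$ in each row $u<r$, $-M^c_{rus}$ in each row $u$ with $r<u<s$, $M^c_{rsu}$ in each row $u>s$, and $0$ in the rows $r$ and $s$. Let $U'A'V'=\mathrm{diag}(d'_1,\dots,d'_{r'},0,\dots,0)$ be a Smith normal form of $A'$, with $U',V'$ unimodular, all $d'_i\ne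 0$ and $d'_1\mid\cdots\mid d'_{r'}$. For $\underline y\in\mathbb Z^n$ put $$Y_{\underline y}=\Bigl(\tfrac{-y_1M}{(d'_1,M)},\dots,\tfrac{-y_{r'}M}{(d'_{r'},M)},y_{r'+1},\dots,y_n\Bigr),\qquad f(\underline y)=Y_{\underline y}U'\in\mathbb Z^n .$$ Let $C$ be the symmetric rational matrix with diagonal entries $\frac{c_j}{m_j^2}$ and with $(s,t)$-entry $\frac{c_{st}}{2m_sm_t}$ for $s<t$, and let $C'=U'C\,{}^tU'$. Call $(\underline y,\lambda)\in\mathbb Z^n\times\mathbb Z^n$ admissible if $$\Lambda'\,{}^tY_{\underline y}+Y_{\underline y}\,C'\,{}^tY_{\underline y}-\tfrac12\in\mathbb Z,\qquad \Lambda':=\Bigl(\tfrac{\lambda_1}{m_1},\dots,\tfrac{\lambda_n}{m_n}\Bigr)\,{}^tU' .$$ (i) If there is a non-trivial $2$-dimensional braided Hopf algebra in ${}^H_H\mathcal{YD}$, then $N$ is even; consequently at least one $m_j$ is even. (ii) Assume that $N$ is even. (a) For every $\underline y\in\mathbb Z^n$ there is a $\lambda\in\mathbb Z^n$ with $(\underline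 y,\lambda)$ admissible if and only if there is a non-trivial $2$-dimensional braided Hopf algebra $B$ in ${}^H_H\mathcal{YD}$ on which $H$ acts by $\varphi\cdot b=\varphi\bigl(g_1^{f_1(\underline y)}\cdots g_n^{f_n(\underline y)}\bigr)b$ for all $\varphi\in H$ and all $b$ in the kernel of the counit of $B$. (b) The isomorphism classes of non-trivial $2$-dimensional braided Hopf algebras in ${}^H_H\mathcal{YD}$ are in one to one correspondence with the admissible pairs $(\underline y,\lambda)$ such that $0\le f_j(\underline y)<m_j$ and $0\le\lambda_j<m_j$ for all $j$. Under this correspondence $(\underline y,\lambda)$ goes to the class of the braided Hopf algebra with basis $\{1,x\}$, unit $1$, $x^2=0$, $\underline\Delta(x)=x\otimes1+1\otimes x$, $\underline\varepsilon(x)=0$, $\underline S(x)=-x$, action $\varphi\cdot x=\varphi(g_1^{f_1}\cdots g_n^{f_n})x$ and coaction $x\mapsto\rho\otimes x$, where $f=f(\underline y)$ and $\rho\in k^G$ is given for $0\le i_j<m_j$ by $$\rho(g_1^{i_1}\cdots g_n^{i_n})=\prod_j\xi_{m_j}^{\lambda_ji_j}\prod_j\xi_{m_j^2}^{c_jf_ji_j}\prod_{s<t}\xi_{m_sm_t}^{c_{st}f_ti_s}.$$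 -/

import Mathlib

open scoped TensorProduct

namespace QuasiHopf

universe u v w

/-! ### Quasi-bialgebras and quasi-Hopf algebras -/

/-- A quasi-bialgebra `(H, Δ, ε, Φ)` over `k`; triple tensor products are bracketed as
`H ⊗ (H ⊗ H)`. -/
structure QuasiBialgebra (k : Type u) (H : Type v) [Field k] [Ring H] [Algebra k H] where
  /-- the comultiplication `Δ` -/
  comul : H →ₐ[k] H ⊗[k] H
  /-- the counit `ε` -/
  counit : H →ₐ[k] k
  /-- the reassociator `Φ`, an invertible element of `H ⊗ H ⊗ H` -/
  reassoc : (H ⊗[k] (H ⊗[k] H))ˣ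
  /-- `(id ⊗ Δ)(Δ h) Φ = Φ (Δ ⊗ id)(Δ h)` -/
  quasi_coassoc : ∀ h : H,
    LinearMap.lTensor H comul.toLinearMap (comul h) * (reassoc : H ⊗[k] (H ⊗[k] H)) =
      (reassoc : H ⊗[k] (H ⊗[k] H)) * TensorProduct.assoc k H H H
        (LinearMap.rTensor H comul.toLinearMap (comul h))
  /-- `(id ⊗ ε)(Δ h) = h` -/
  comul_counit : ∀ h : H,
    TensorProduct.rid k H (LinearMap.lTensor H counit.toLinearMap (comul h)) = h
  /-- `(ε ⊗ id)(Δ h) = h` -/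
  counit_comul : ∀ h : H,
    TensorProduct.lid k H (LinearMap.rTensor H counit.toLinearMap (comul h)) = h
  /-- `(id ⊗ ε ⊗ id)(Φ) = 1 ⊗ 1` -/
  reassoc_normalized :
    LinearMap.lTensor H
      ((TensorProduct.lid k H).toLinearMap ∘ₗ LinearMap.rTensor H counit.toLinearMap)
      (reassoc : H ⊗[k] (H ⊗[k] H)) = 1 ⊗ₜ[k] 1
  /-- `(1 ⊗ Φ) (id ⊗ Δ ⊗ id)(Φ) (Φ ⊗ 1) = (id ⊗ id ⊗ Δ)(Φ) (Δ ⊗ id ⊗ id)(Φ)`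
  in `H ⊗ (H ⊗ (H ⊗ H))` -/
  pentagon :
    ((1 : H) ⊗ₜ[k] (reassoc : H ⊗[k] (H ⊗[k] H))) *
        LinearMap.lTensor H ((TensorProduct.assoc k H H H).toLinearMap ∘ₗ
          LinearMap.rTensor H comul.toLinearMap) (reassoc : H ⊗[k] (H ⊗[k] H)) *
        LinearMap.lTensor H (TensorProduct.assoc k H H H).toLinearMap
          (TensorProduct.assoc k H (H ⊗[k] H) H
            ((reassoc : H ⊗[k] (H ⊗[k] H)) ⊗ₜ[k] (1 : H))) =
      LinearMap.lTensor H (LinearMap.lTensor H comul.toLinearMap)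
          (reassoc : H ⊗[k] (H ⊗[k] H)) *
        TensorProduct.assoc k H H (H ⊗[k] H)
          (LinearMap.rTensor (H ⊗[k] H) comul.toLinearMap (reassoc : H ⊗[k] (H ⊗[k] H)))

/-- A quasi-Hopf algebra: a quasi-bialgebra with an anti-morphism `S` of algebras and two
elements `α`, `β`. -/
structure QuasiHopfAlgebra (k : Type u) (H : Type v) [Field k] [Ring H] [Algebra k H]
    extends QuasiBialgebra k H where
  /-- the antipode `S` -/
  antipode : H →ₗ[k] H
  /-- the element `α` -/
  alpha : H
  /-- the element `β` -/
  beta : H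
  antipode_one : antipode 1 = 1
  antipode_mul : ∀ a b : H, antipode (a * b) = antipode b * antipode a
  /-- `S(h₁) α h₂ = ε(h) α` -/
  antipode_alpha : ∀ h : H,
    LinearMap.mul' k H
      (LinearMap.rTensor H (LinearMap.mulRight k alpha ∘ₗ antipode) (comul h)) =
      counit h • alpha
  /-- `h₁ β S(h₂) = ε(h) β` -/
  antipode_beta : ∀ h : H,
    LinearMap.mul' k H (TensorProduct.map (LinearMap.mulRight k beta) antipode (comul h)) =
      counit h • beta
  /-- `X¹ β S(X²) α X³ = 1`, where `Φ = X¹ ⊗ X² ⊗ X³` -/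
  reassoc_antipode :
    LinearMap.mul' k H (TensorProduct.map (LinearMap.mulRight k beta)
      (LinearMap.mul' k H ∘ₗ LinearMap.rTensor H (LinearMap.mulRight k alpha ∘ₗ antipode))
      (reassoc : H ⊗[k] (H ⊗[k] H))) = 1
  /-- `S(x¹) α x² β S(x³) = 1`, where `Φ⁻¹ = x¹ ⊗ x² ⊗ x³` -/
  reassoc_inv_antipode :
    LinearMap.mul' k H (TensorProduct.map (LinearMap.mulRight k alpha ∘ₗ antipode)
      (LinearMap.mul' k H ∘ₗ TensorProduct.map (LinearMap.mulRight k beta) antipode)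
      (reassoc⁻¹ : (H ⊗[k] (H ⊗[k] H))ˣ).val) = 1

/-! ### Modules over a quasi-bialgebra and their tensor products

A left `H`-module structure on a `k`-vector space `M` is given as an algebra morphism
`H → End_k(M)`. -/

section Modules

variable {k : Type u} {H : Type v} [Field k] [Ring H] [Algebra k H]

/-- The componentwise action of `H ⊗ H` on `M ⊗ N`. -/
noncomputable def act₂ {M N : Type*} [AddCommGroup M] [Module k M] [AddCommGroup N] [Module k N]
    (ρ : H →ₐ[k] Module.End k M) (τ : H →ₐ[k] Module.End k N) :
    H ⊗[k] H →ₐ[k] Module.End k (M ⊗[k] N) :=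
  (Module.endTensorEndAlgHom (R := k) (S := k) (A := k) (M := M) (N := N)).comp
    (Algebra.TensorProduct.map ρ τ)

/-- The componentwise action of `H ⊗ (H ⊗ H)` on `M ⊗ (N ⊗ P)`. -/
noncomputable def act₃ {M N P : Type*} [AddCommGroup M] [Module k M] [AddCommGroup N] [Module k N]
    [AddCommGroup P] [Module k P] (ρ : H →ₐ[k] Module.End k M) (τ : H →ₐ[k] Module.End k N)
    (π : H →ₐ[k] Module.End k P) :
    H ⊗[k] (H ⊗[k] H) →ₐ[k] Module.End k (M ⊗[k] (N ⊗[k] P)) :=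
  (Module.endTensorEndAlgHom (R := k) (S := k) (A := k) (M := M) (N := N ⊗[k] P)).comp
    (Algebra.TensorProduct.map ρ (act₂ τ π))

/-- The tensor product of two left `H`-modules: `h · (m ⊗ n) = h₁ · m ⊗ h₂ · n`. -/
noncomputable def QuasiBialgebra.tensorAct (Q : QuasiBialgebra k H) {M N : Type*}
    [AddCommGroup M] [Module k M] [AddCommGroup N] [Module k N]
    (ρ : H →ₐ[k] Module.End k M) (τ : H →ₐ[k] Module.End k N) :
    H →ₐ[k] Module.End k (M ⊗[k] N) :=
  (act₂ ρ τ).comp Q.comul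

/-- The associativity constraint `(m ⊗ n) ⊗ p ↦ X¹ · m ⊗ (X² · n ⊗ X³ · p)` of `H`-modules. -/
noncomputable def QuasiBialgebra.assoc (Q : QuasiBialgebra k H) {M N P : Type*}
    [AddCommGroup M] [Module k M] [AddCommGroup N] [Module k N] [AddCommGroup P] [Module k P]
    (ρ : H →ₐ[k] Module.End k M) (τ : H →ₐ[k] Module.End k N) (π : H →ₐ[k] Module.End k P) :
    (M ⊗[k] N) ⊗[k] P →ₗ[k] M ⊗[k] (N ⊗[k] P) :=
  act₃ ρ τ π (Q.reassoc : H ⊗[k] (H ⊗[k] H)) ∘ₗ (TensorProduct.assoc k M N P).toLinearMap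

/-- The inverse associativity constraint `m ⊗ (n ⊗ p) ↦ (x¹ · m ⊗ x² · n) ⊗ x³ · p`. -/
noncomputable def QuasiBialgebra.assocInv (Q : QuasiBialgebra k H) {M N P : Type*}
    [AddCommGroup M] [Module k M] [AddCommGroup N] [Module k N] [AddCommGroup P] [Module k P]
    (ρ : H →ₐ[k] Module.End k M) (τ : H →ₐ[k] Module.End k N) (π : H →ₐ[k] Module.End k P) :
    M ⊗[k] (N ⊗[k] P) →ₗ[k] (M ⊗[k] N) ⊗[k] P :=
  (TensorProduct.assoc k M N P).symm.toLinearMap ∘ₗ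
    act₃ ρ τ π (Q.reassoc⁻¹ : (H ⊗[k] (H ⊗[k] H))ˣ).val

/-- For a linear map `M → H ⊗ M`, `m ↦ m₍₋₁₎ ⊗ m₍₀₎`, and a left `H`-module `V`, the map
`M ⊗ V → V ⊗ M`, `m ⊗ v ↦ m₍₋₁₎ · v ⊗ m₍₀₎`. -/
noncomputable def halfBraiding {M V : Type*} [AddCommGroup M] [Module k M] [AddCommGroup V]
    [Module k V] (coact : M →ₗ[k] H ⊗[k] M) (τ : H →ₐ[k] Module.End k V) :
    M ⊗[k] V →ₗ[k] V ⊗[k] M :=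
  LinearMap.rTensor M (TensorProduct.lift τ.toLinearMap) ∘ₗ
    (TensorProduct.rightComm k H M V).toLinearMap ∘ₗ LinearMap.rTensor V coact

/-! ### Yetter-Drinfeld modules and Hopf algebras in their category -/

/-- A left Yetter-Drinfeld module structure over the quasi-bialgebra `Q` on `M`.  Below, `H` is
regarded as a left `H`-module through left multiplication. -/
structure YetterDrinfeld (Q : QuasiBialgebra k H) (M : Type w) [AddCommGroup M] [Module k M] where
  /-- the left `H`-action -/
  act : H →ₐ[k] Module.End k M
  /-- the left `H`-coaction `m ↦ m₍₋₁₎ ⊗ m₍₀₎` -/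
  coact : M →ₗ[k] H ⊗[k] M
  /-- `ε(m₍₋₁₎) m₍₀₎ = m` -/
  counit_coact : ∀ m : M,
    TensorProduct.lid k M (LinearMap.rTensor M Q.counit.toLinearMap (coact m)) = m
  /-- `X¹ m₍₋₁₎ ⊗ (X² · m₍₀₎)₍₋₁₎ X³ ⊗ (X² · m₍₀₎)₍₀₎ =
  X¹ (Y¹ · m)₍₋₁₎₁ Y² ⊗ X² (Y¹ · m)₍₋₁₎₂ Y³ ⊗ X³ · (Y¹ · m)₍₀₎` -/
  coact_coact : ∀ m : M,
    LinearMap.lTensor H (halfBraiding coact (Algebra.lmul k H))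
        (Q.assoc (Algebra.lmul k H) act (Algebra.lmul k H) (coact m ⊗ₜ[k] (1 : H))) =
      Q.assoc (Algebra.lmul k H) (Algebra.lmul k H) act
        (halfBraiding coact (Q.tensorAct (Algebra.lmul k H) (Algebra.lmul k H))
          (Q.assoc act (Algebra.lmul k H) (Algebra.lmul k H) ((m ⊗ₜ[k] (1 : H)) ⊗ₜ[k] (1 : H))))
  /-- `h₁ m₍₋₁₎ ⊗ h₂ · m₍₀₎ = (h₁ · m)₍₋₁₎ h₂ ⊗ (h₁ · m)₍₀₎` -/
  act_coact : ∀ (h : H) (m : M),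
    Q.tensorAct (Algebra.lmul k H) act h (coact m) =
      halfBraiding coact (Algebra.lmul k H)
        (Q.tensorAct act (Algebra.lmul k H) h (m ⊗ₜ[k] (1 : H)))

/-- The coaction on the tensor product of two Yetter-Drinfeld modules:
`m ⊗ n ↦ X¹ (x¹ Y¹ · m)₍₋₁₎ x² (Y² · n)₍₋₁₎ Y³ ⊗ X² · (x¹ Y¹ · m)₍₀₎ ⊗ X³ x³ · (Y² · n)₍₀₎`. -/
noncomputable def YetterDrinfeld.tensorCoact {Q : QuasiBialgebra k H} {M N : Type*}
    [AddCommGroup M] [Module k M] [AddCommGroup N] [Module k N]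
    (X : YetterDrinfeld Q M) (Y : YetterDrinfeld Q N) : M ⊗[k] N →ₗ[k] H ⊗[k] (M ⊗[k] N) :=
  Q.assoc (Algebra.lmul k H) X.act Y.act ∘ₗ
    LinearMap.rTensor N (halfBraiding X.coact (Algebra.lmul k H)) ∘ₗ
    Q.assocInv X.act (Algebra.lmul k H) Y.act ∘ₗ
    LinearMap.lTensor M (halfBraiding Y.coact (Algebra.lmul k H)) ∘ₗ
    Q.assoc X.act Y.act (Algebra.lmul k H) ∘ₗ
    (TensorProduct.mk k (M ⊗[k] N) H).flip 1

/-- The multiplication of the tensor product algebra `B ⊗ B` of an algebra `B` in the braided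
category of Yetter-Drinfeld modules, the braiding being `m ⊗ n ↦ m₍₋₁₎ · n ⊗ m₍₀₎`; it maps
`(b ⊗ c) ⊗ (b' ⊗ c')` to `(y¹X¹ · b) (y²Y¹ (x¹X² · c)₍₋₁₎ x² X³₁ · b') ⊗
(y³₁ Y² · (x¹X² · c)₍₀₎) (y³₂ Y³ x³ X³₂ · c')`. -/
noncomputable def YetterDrinfeld.tensorMul {Q : QuasiBialgebra k H} {B : Type*}
    [AddCommGroup B] [Module k B] (X : YetterDrinfeld Q B) (mul : B ⊗[k] B →ₗ[k] B) :
    (B ⊗[k] B) ⊗[k] (B ⊗[k] B) →ₗ[k] B ⊗[k] B :=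
  TensorProduct.map mul mul ∘ₗ
    Q.assocInv X.act X.act (Q.tensorAct X.act X.act) ∘ₗ
    LinearMap.lTensor B (Q.assoc X.act X.act X.act) ∘ₗ
    LinearMap.lTensor B (LinearMap.rTensor B (halfBraiding X.coact X.act)) ∘ₗ
    LinearMap.lTensor B (Q.assocInv X.act X.act X.act) ∘ₗ
    Q.assoc X.act X.act (Q.tensorAct X.act X.act)

/-- A Hopf algebra structure on `B` in the category of left Yetter-Drinfeld modules over `Q`. -/
structure BraidedHopf (Q : QuasiBialgebra k H) (B : Type w) [AddCommGroup B] [Module k B]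
    extends YetterDrinfeld Q B where
  /-- the multiplication of `B` -/
  mul : B ⊗[k] B →ₗ[k] B
  /-- the unit of `B` -/
  one : B
  /-- the comultiplication of `B` -/
  comul : B →ₗ[k] B ⊗[k] B
  /-- the counit of `B` -/
  counit : B →ₗ[k] k
  /-- the antipode of `B` -/
  antipode : B →ₗ[k] B
  -- `B` is an algebra in the category
  one_mul : ∀ b : B, mul (one ⊗ₜ[k] b) = b
  mul_one : ∀ b : B, mul (b ⊗ₜ[k] one) = b
  mul_assoc : ∀ x : (B ⊗[k] B) ⊗[k] B,
    mul (LinearMap.rTensor B mul x) = mul (LinearMap.lTensor B mul (Q.assoc act act act x))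
  act_mul : ∀ (h : H) (x : B ⊗[k] B), act h (mul x) = mul (Q.tensorAct act act h x)
  act_one : ∀ h : H, act h one = Q.counit h • one
  coact_mul : ∀ x : B ⊗[k] B,
    coact (mul x) = LinearMap.lTensor H mul
      (toYetterDrinfeld.tensorCoact toYetterDrinfeld x)
  coact_one : coact one = 1 ⊗ₜ[k] one
  -- `B` is a coalgebra in the category
  counit_comul : ∀ b : B, TensorProduct.lid k B (LinearMap.rTensor B counit (comul b)) = b
  comul_counit : ∀ b : B, TensorProduct.rid k B (LinearMap.lTensor B counit (comul b)) = b
  comul_assoc : ∀ b : B,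
    Q.assoc act act act (LinearMap.rTensor B comul (comul b)) = LinearMap.lTensor B comul (comul b)
  comul_act : ∀ (h : H) (b : B), comul (act h b) = Q.tensorAct act act h (comul b)
  counit_act : ∀ (h : H) (b : B), counit (act h b) = Q.counit h * counit b
  coact_comul : ∀ b : B,
    toYetterDrinfeld.tensorCoact toYetterDrinfeld (comul b) =
      LinearMap.lTensor H comul (coact b)
  coact_counit : ∀ b : B,
    TensorProduct.rid k H (LinearMap.lTensor H counit (coact b)) = counit b • (1 : H)
  -- comultiplication and counit are algebra morphisms in the category
  comul_one : comul one = one ⊗ₜ[k] one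
  counit_one : counit one = 1
  comul_mul : ∀ x : B ⊗[k] B,
    comul (mul x) = toYetterDrinfeld.tensorMul mul (TensorProduct.map comul comul x)
  counit_mul : ∀ b b' : B, counit (mul (b ⊗ₜ[k] b')) = counit b * counit b'
  -- the antipode is a morphism in the category and a convolution inverse of the identity
  antipode_act : ∀ (h : H) (b : B), antipode (act h b) = act h (antipode b)
  coact_antipode : ∀ b : B, coact (antipode b) = LinearMap.lTensor H antipode (coact b)
  antipode_left : ∀ b : B, mul (LinearMap.rTensor B antipode (comul b)) = counit b • one
  antipode_right : ∀ b : B, mul (LinearMap.lTensor B antipode (comul b)) = counit b • one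

/-- An isomorphism of braided Hopf algebras. -/
structure BraidedHopf.IsIso {Q : QuasiBialgebra k H} {B B' : Type*} [AddCommGroup B] [Module k B]
    [AddCommGroup B'] [Module k B'] (X : BraidedHopf Q B) (X' : BraidedHopf Q B')
    (e : B ≃ₗ[k] B') : Prop where
  act : ∀ (h : H) (b : B), e (X.act h b) = X'.act h (e b)
  coact : ∀ b : B, X'.coact (e b) = LinearMap.lTensor H e.toLinearMap (X.coact b)
  mul : ∀ b c : B, e (X.mul (b ⊗ₜ[k] c)) = X'.mul (e b ⊗ₜ[k] e c)
  one : e X.one = X'.one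
  comul : ∀ b : B, X'.comul (e b) = TensorProduct.map e.toLinearMap e.toLinearMap (X.comul b)
  counit : ∀ b : B, X'.counit (e b) = X.counit b
  antipode : ∀ b : B, e (X.antipode b) = X'.antipode (e b)

/-- `X` is isomorphic to the group Hopf algebra `k[C₂]` with trivial `H`-action (through the counit
of `H`) and trivial `H`-coaction (through the unit of `H`). -/
def BraidedHopf.IsTrivial {Q : QuasiBialgebra k H} {B : Type*} [AddCommGroup B] [Module k B]
    (X : BraidedHopf Q B) : Prop :=
  (∀ (h : H) (b : B), X.act h b = Q.counit h • b) ∧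
  (∀ b : B, X.coact b = 1 ⊗ₜ[k] b) ∧
  ∃ e : B ≃ₗ[k] MonoidAlgebra k (Multiplicative (ZMod 2)),
    (∀ b c : B, e (X.mul (b ⊗ₜ[k] c)) = e b * e c) ∧
    e X.one = 1 ∧
    (∀ b : B, CoalgebraStruct.comul (R := k) (e b) =
      TensorProduct.map e.toLinearMap e.toLinearMap (X.comul b)) ∧
    (∀ b : B, CoalgebraStruct.counit (R := k) (e b) = X.counit b) ∧
    (∀ b : B, e (X.antipode b) = HopfAlgebraStruct.antipode k (e b))

/-- `X` is (isomorphic to) the braided Hopf algebra `B_{σ,v}`: it has a basis `{1, x}` with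
`h · x = σ(h) x`, coaction `x ↦ v ⊗ x`, `x² = 0`, `Δ(x) = x ⊗ 1 + 1 ⊗ x`, `ε(x) = 0`
and `S(x) = -x`. -/
def BraidedHopf.IsB {Q : QuasiBialgebra k H} {B : Type*} [AddCommGroup B] [Module k B]
    (X : BraidedHopf Q B) (σ : H →ₐ[k] k) (v : H) : Prop :=
  ∃ x : B, LinearIndependent k ![X.one, x] ∧ Submodule.span k {X.one, x} = ⊤ ∧
    (∀ h : H, X.act h x = σ h • x) ∧
    X.coact x = v ⊗ₜ[k] x ∧
    X.mul (x ⊗ₜ[k] x) = 0 ∧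
    X.comul x = x ⊗ₜ[k] X.one + X.one ⊗ₜ[k] x ∧
    X.counit x = 0 ∧
    X.antipode x = -x

/-- A non-trivial `2`-dimensional Hopf algebra in the category of Yetter-Drinfeld modules
over `Q`. -/
structure NontrivialBraidedHopf₂ (Q : QuasiBialgebra k H) where
  /-- the underlying vector space -/
  carrier : Type u
  [addCommGroup : AddCommGroup carrier]
  [module : Module k carrier]
  /-- the braided Hopf algebra structure -/
  str : BraidedHopf Q carrier
  finrank_eq : Module.finrank k carrier = 2
  not_trivial : ¬ str.IsTrivial

attribute [instance] NontrivialBraidedHopf₂.addCommGroup NontrivialBraidedHopf₂.module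

/-- Isomorphism of non-trivial `2`-dimensional braided Hopf algebras. -/
instance NontrivialBraidedHopf₂.setoid (Q : QuasiBialgebra k H) :
    Setoid (NontrivialBraidedHopf₂ Q) where
  r B B' := ∃ e : B.carrier ≃ₗ[k] B'.carrier, B.str.IsIso B'.str e
  iseqv :=
    { refl := fun B => ⟨LinearEquiv.refl k _, by
        constructor <;> intros <;> simp⟩
      symm := by
        rintro B B' ⟨e, he⟩
        have h1 : e.toLinearMap ∘ₗ e.symm.toLinearMap = LinearMap.id := by ext; simp
        have h2 : e.symm.toLinearMap ∘ₗ e.toLinearMap = LinearMap.id := by ext; simp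
        refine ⟨e.symm, ⟨fun h b => ?_, fun b => ?_, fun b c => ?_, ?_, fun b => ?_, fun b => ?_,
          fun b => ?_⟩⟩
        · rw [LinearEquiv.symm_apply_eq, he.act, e.apply_symm_apply]
        · have h := he.coact (e.symm b)
          rw [e.apply_symm_apply] at h
          rw [h, ← LinearMap.comp_apply, ← LinearMap.lTensor_comp, h2, LinearMap.lTensor_id,
            LinearMap.id_apply]
        · rw [LinearEquiv.symm_apply_eq, he.mul, e.apply_symm_apply, e.apply_symm_apply]
        · rw [LinearEquiv.symm_apply_eq, he.one]
        · have h := he.comul (e.symm b)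
          rw [e.apply_symm_apply] at h
          rw [h, ← LinearMap.comp_apply, ← TensorProduct.map_comp, h2, TensorProduct.map_id,
            LinearMap.id_apply]
        · rw [← he.counit, e.apply_symm_apply]
        · rw [LinearEquiv.symm_apply_eq, he.antipode, e.apply_symm_apply]
      trans := by
        rintro B B' B'' ⟨e, he⟩ ⟨f, hf⟩
        have h3 : (e.trans f).toLinearMap = f.toLinearMap ∘ₗ e.toLinearMap := rfl
        refine ⟨e.trans f, ⟨fun h b => ?_, fun b => ?_, fun b c => ?_, ?_, fun b => ?_, fun b => ?_,
          fun b => ?_⟩⟩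
        · rw [e.trans_apply, e.trans_apply, he.act, hf.act]
        · rw [e.trans_apply, hf.coact, he.coact, h3, LinearMap.lTensor_comp, LinearMap.comp_apply]
        · rw [e.trans_apply, e.trans_apply, e.trans_apply, he.mul, hf.mul]
        · rw [e.trans_apply, he.one, hf.one]
        · rw [e.trans_apply, hf.comul, he.comul, h3, TensorProduct.map_comp, LinearMap.comp_apply]
        · rw [e.trans_apply, hf.counit, he.counit]
        · rw [e.trans_apply, e.trans_apply, he.antipode, hf.antipode] }

end Modules

/-! ### The quasi-Hopf algebra of functions on a finite group -/

/-- A normalized `3`-cocycle on the group `G` with values in `kˣ`. -/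
structure NormalizedCocycle₃ (G : Type w) (k : Type u) [Group G] [Field k] where
  /-- the underlying map -/
  toFun : G → G → G → kˣ
  cocycle : ∀ x y z t : G,
    toFun y z t * toFun x (y * z) t * toFun x y z = toFun x y (z * t) * toFun (x * y) z t
  one_left : ∀ y z : G, toFun 1 y z = 1
  one_mid : ∀ x z : G, toFun x 1 z = 1
  one_right : ∀ x y : G, toFun x y 1 = 1

section Functions

/-- The evaluation `k^G ⊗ A → A` at a point of `G`, as an algebra morphism. -/
noncomputable def evalHom (k : Type u) {G : Type w} [Field k] (A : Type*) [Ring A] [Algebra k A]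
    (x : G) : (G → k) ⊗[k] A →ₐ[k] A :=
  (Algebra.TensorProduct.lid k A).toAlgHom.comp
    (Algebra.TensorProduct.map (Pi.evalAlgHom k (fun _ : G => k) x) (AlgHom.id k A))

/-- The evaluation of an element of `k^G ⊗ A` at a point of `G`. -/
noncomputable def evalL {k : Type u} {G : Type w} [Field k] {A : Type*} [Ring A] [Algebra k A]
    (x : G) (t : (G → k) ⊗[k] A) : A :=
  evalHom k A x t

section EvalL

variable {k : Type u} {G : Type w} [Field k] {A : Type*} [Ring A] [Algebra k A] (x : G)

lemma evalL_tmul (f : G → k) (a : A) : evalL x (f ⊗ₜ[k] a) = f x • a := by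
  simp [evalL, evalHom]

@[simp] lemma evalL_zero : evalL x (0 : (G → k) ⊗[k] A) = 0 := map_zero (evalHom k A x)

@[simp] lemma evalL_one : evalL x (1 : (G → k) ⊗[k] A) = 1 := map_one (evalHom k A x)

@[simp] lemma evalL_add (s t : (G → k) ⊗[k] A) : evalL x (s + t) = evalL x s + evalL x t :=
  map_add (evalHom k A x) s t

@[simp] lemma evalL_mul (s t : (G → k) ⊗[k] A) : evalL x (s * t) = evalL x s * evalL x t :=
  map_mul (evalHom k A x) s t

@[simp] lemma evalL_smul (c : k) (t : (G → k) ⊗[k] A) : evalL x (c • t) = c • evalL x t :=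
  map_smul (evalHom k A x) c t

@[simp] lemma evalL_sum {ι : Type*} (s : Finset ι) (t : ι → (G → k) ⊗[k] A) :
    evalL x (∑ i ∈ s, t i) = ∑ i ∈ s, evalL x (t i) :=
  map_sum (evalHom k A x) t s

end EvalL

lemma eq_sum_evalL {k : Type u} {G : Type w} [Field k] [Fintype G] [DecidableEq G] {A : Type*}
    [Ring A] [Algebra k A] (t : (G → k) ⊗[k] A) :
    t = ∑ x : G, (Pi.single x (1 : k) : G → k) ⊗ₜ[k] evalL x t := by
  induction t with
  | zero => simp
  | add a b ha hb =>
    conv_lhs => rw [ha, hb]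
    simp [TensorProduct.tmul_add, Finset.sum_add_distrib]
  | tmul f a =>
    simp only [evalL_tmul, ← TensorProduct.smul_tmul]
    rw [← TensorProduct.sum_tmul]
    congr 1
    ext y
    simp [Finset.sum_apply, Pi.single_apply]

lemma evalL_ext {k : Type u} {G : Type w} [Field k] [Fintype G] {A : Type*}
    [Ring A] [Algebra k A] {s t : (G → k) ⊗[k] A} (h : ∀ x : G, evalL x s = evalL x t) :
    s = t := by
  classical
  rw [eq_sum_evalL s, eq_sum_evalL t]
  simp [h]

lemma evalL_lTensor {k : Type u} {G : Type w} [Field k] {A A' : Type*} [Ring A] [Algebra k A]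
    [Ring A'] [Algebra k A'] (x : G) (f : A →ₗ[k] A') (t : (G → k) ⊗[k] A) :
    evalL x (LinearMap.lTensor (G → k) f t) = f (evalL x t) := by
  induction t with
  | zero => simp
  | add a b ha hb => simp [ha, hb]
  | tmul g a => simp [evalL_tmul]

lemma evalL_assoc {k : Type u} {G : Type w} [Field k] {A A' : Type*} [Ring A] [Algebra k A]
    [Ring A'] [Algebra k A'] (x : G) (t : (G → k) ⊗[k] A) (a : A') :
    evalL x (TensorProduct.assoc k (G → k) A A' (t ⊗ₜ[k] a)) = evalL x t ⊗ₜ[k] a := by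
  induction t with
  | zero =>
    rw [TensorProduct.zero_tmul, LinearEquiv.map_zero, evalL_zero, evalL_zero,
      TensorProduct.zero_tmul]
  | add s t hs ht =>
    rw [TensorProduct.add_tmul, LinearEquiv.map_add, evalL_add, hs, ht, evalL_add,
      TensorProduct.add_tmul]
  | tmul g b => simp [evalL_tmul, TensorProduct.smul_tmul']

lemma mul'_map_apply {k : Type u} {G : Type w} [Field k] {A : Type*} [Ring A] [Algebra k A]
    (f : (G → k) →ₗ[k] (G → k)) (g : A →ₗ[k] (G → k)) (x y : G) (c : k)
    (hf : ∀ φ : G → k, f φ x = c * φ y) (t : (G → k) ⊗[k] A) :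
    LinearMap.mul' k (G → k) (TensorProduct.map f g t) x = c * g (evalL y t) x := by
  induction t with
  | zero => simp
  | add s t hs ht => simp [hs, ht, mul_add]
  | tmul φ a => simp [evalL_tmul, hf, mul_assoc]

/-- The comultiplication of `k^G`, `φ ↦ ∑ φ(xy) P_x ⊗ P_y`, where `P_x` is the characteristic
function of `x`. -/
noncomputable def funComulₗ (k : Type u) (G : Type w) [Field k] [Group G] [Fintype G]
    [DecidableEq G] : (G → k) →ₗ[k] (G → k) ⊗[k] (G → k) where
  toFun φ := ∑ x : G, ∑ y : G,
    φ (x * y) • ((Pi.single x (1 : k) : G → k) ⊗ₜ[k] (Pi.single y (1 : k) : G → k))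
  map_add' φ ψ := by simp [add_smul, Finset.sum_add_distrib]
  map_smul' a φ := by simp [Finset.smul_sum, mul_smul]

lemma evalL_funComulₗ {k : Type u} {G : Type w} [Field k] [Group G] [Fintype G]
    [DecidableEq G] (x y : G) (φ : G → k) : evalL x (funComulₗ k G φ) y = φ (x * y) := by
  simp [funComulₗ, evalL_tmul, Pi.single_apply, Finset.sum_apply, ite_apply]

/-- The comultiplication of `k^G` as an algebra morphism. -/
noncomputable def funComul (k : Type u) (G : Type w) [Field k] [Group G] [Fintype G]
    [DecidableEq G] : (G → k) →ₐ[k] (G → k) ⊗[k] (G → k) :=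
  AlgHom.ofLinearMap (funComulₗ k G)
    (evalL_ext fun x => by ext y; simp [evalL_funComulₗ])
    (fun φ ψ => evalL_ext fun x => by ext y; simp [evalL_funComulₗ])

lemma evalL_funComul {k : Type u} {G : Type w} [Field k] [Group G] [Fintype G]
    [DecidableEq G] (x y : G) (φ : G → k) : evalL x (funComul k G φ) y = φ (x * y) :=
  evalL_funComulₗ x y φ

lemma evalL_evalL_assoc {k : Type u} {G : Type w} [Field k] [Group G] [Fintype G]
    [DecidableEq G] {A : Type*} [Ring A] [Algebra k A] (x y : G) (t : (G → k) ⊗[k] A) :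
    evalL y (evalL x (TensorProduct.assoc k (G → k) (G → k) A
      (LinearMap.rTensor A (funComul k G).toLinearMap t))) = evalL (x * y) t := by
  induction t with
  | zero => rw [LinearMap.map_zero, LinearEquiv.map_zero, evalL_zero, evalL_zero, evalL_zero]
  | add s t hs ht =>
    rw [LinearMap.map_add, LinearEquiv.map_add, evalL_add, evalL_add, hs, ht, evalL_add]
  | tmul φ a => simp [evalL_assoc, evalL_tmul, evalL_funComul]

/-- The element `∑ f(x, y, z) P_x ⊗ P_y ⊗ P_z` of `k^G ⊗ k^G ⊗ k^G`. -/
noncomputable def funTriple {k : Type u} {G : Type w} [Field k] [Fintype G] [DecidableEq G]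
    (f : G → G → G → k) : (G → k) ⊗[k] ((G → k) ⊗[k] (G → k)) :=
  ∑ x : G, ∑ y : G, ∑ z : G, f x y z • ((Pi.single x (1 : k) : G → k) ⊗ₜ[k]
    ((Pi.single y (1 : k) : G → k) ⊗ₜ[k] (Pi.single z (1 : k) : G → k)))

lemma evalL_funTriple {k : Type u} {G : Type w} [Field k] [Fintype G] [DecidableEq G]
    (f : G → G → G → k) (x y z : G) : evalL y (evalL x (funTriple f)) z = f x y z := by
  simp [funTriple, evalL_tmul, Pi.single_apply, Finset.sum_apply, ite_apply]

/-- The reassociator `∑ ω(x, y, z) P_x ⊗ P_y ⊗ P_z`. -/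
noncomputable def funReassoc {k : Type u} {G : Type w} [Field k] [Fintype G] [DecidableEq G]
    (ω : G → G → G → kˣ) : ((G → k) ⊗[k] ((G → k) ⊗[k] (G → k)))ˣ where
  val := funTriple fun x y z => (ω x y z : k)
  inv := funTriple fun x y z => ((ω x y z)⁻¹ : kˣ)
  val_inv := evalL_ext fun x => evalL_ext fun y => by ext z; simp [evalL_funTriple]
  inv_val := evalL_ext fun x => evalL_ext fun y => by ext z; simp [evalL_funTriple]

/-- The quasi-Hopf algebra `k^G_ω`: the algebra of functions on the finite group `G`, with
comultiplication `φ ↦ ∑ φ(xy) P_x ⊗ P_y`, counit `φ ↦ φ(e)`, reassociator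
`∑ ω(x, y, z) P_x ⊗ P_y ⊗ P_z`, antipode `P_x ↦ P_{x⁻¹}`, `α = 1` and
`β(x) = ω(x, x⁻¹, x)⁻¹`. -/
noncomputable def functionAlgebra {k : Type u} {G : Type w} [Field k] [Group G] [Fintype G]
    [DecidableEq G] (ω : NormalizedCocycle₃ G k) : QuasiHopfAlgebra k (G → k) where
  comul := funComul k G
  counit := Pi.evalAlgHom k (fun _ : G => k) 1
  reassoc := funReassoc ω.toFun
  quasi_coassoc h := by
    refine evalL_ext fun x => evalL_ext fun y => ?_
    ext z
    simp only [evalL_mul, evalL_lTensor, evalL_evalL_assoc, AlgHom.toLinearMap_apply, Pi.mul_apply,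
      evalL_funComul]
    rw [mul_assoc x y z, mul_comm]
  comul_counit h := by
    ext x
    have key : ∀ t : (G → k) ⊗[k] (G → k), TensorProduct.rid k (G → k)
        (LinearMap.lTensor (G → k) (Pi.evalAlgHom k (fun _ : G => k) 1).toLinearMap t) x =
          evalL x t 1 := by
      intro t
      induction t with
      | zero => simp
      | add s t hs ht => simp [hs, ht]
      | tmul φ a => simp [evalL_tmul, mul_comm]
    rw [key, evalL_funComul, mul_one]
  counit_comul h := by
    have key : ∀ t : (G → k) ⊗[k] (G → k), TensorProduct.lid k (G → k)
        (LinearMap.rTensor (G → k) (Pi.evalAlgHom k (fun _ : G => k) 1).toLinearMap t) =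
          evalL 1 t := by
      intro t
      induction t with
      | zero => simp
      | add s t hs ht => simp [hs, ht]
      | tmul φ a => simp [evalL_tmul]
    rw [key]
    ext x
    rw [evalL_funComul, one_mul]
  reassoc_normalized := by
    have key : ∀ t : (G → k) ⊗[k] (G → k), (TensorProduct.lid k (G → k)).toLinearMap
        (LinearMap.rTensor (G → k) (Pi.evalAlgHom k (fun _ : G => k) 1).toLinearMap t) =
          evalL 1 t := by
      intro t
      induction t with
      | zero => simp
      | add s t hs ht => rw [map_add, map_add, hs, ht, evalL_add]
      | tmul φ a => simp [evalL_tmul]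
    refine evalL_ext fun x => ?_
    rw [evalL_lTensor, LinearMap.comp_apply, key]
    ext z
    simp [funReassoc, evalL_funTriple, evalL_tmul, ω.one_mid]
  pentagon := by
    refine evalL_ext fun x => evalL_ext fun y => evalL_ext fun z => ?_
    ext t
    simp only [evalL_mul, evalL_lTensor, evalL_evalL_assoc, AlgHom.toLinearMap_apply, Pi.mul_apply,
      evalL_funComul, evalL_tmul, LinearMap.comp_apply, LinearEquiv.coe_coe, evalL_assoc,
      Pi.one_apply, one_smul, Pi.smul_apply, smul_eq_mul, mul_one]
    simp only [funReassoc, evalL_funTriple]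
    exact_mod_cast ω.cocycle x y z t
  antipode := LinearMap.funLeft k k (fun x : G => x⁻¹)
  alpha := 1
  beta := fun x => (((ω.toFun x x⁻¹ x)⁻¹ : kˣ) : k)
  antipode_one := by ext; simp [LinearMap.funLeft_apply]
  antipode_mul a b := by ext; simp [LinearMap.funLeft_apply, mul_comm]
  antipode_alpha h := by
    ext x
    rw [LinearMap.rTensor, mul'_map_apply _ _ x x⁻¹ 1 (by simp [LinearMap.funLeft_apply])]
    simp [evalL_funComul]
  antipode_beta h := by
    ext x
    rw [mul'_map_apply _ _ x x (((ω.toFun x x⁻¹ x)⁻¹ : kˣ) : k) (by simp [mul_comm])]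
    simp [evalL_funComul, LinearMap.funLeft_apply, mul_comm]
  reassoc_antipode := by
    ext x
    rw [mul'_map_apply _ _ x x (((ω.toFun x x⁻¹ x)⁻¹ : kˣ) : k) (by simp [mul_comm]),
      LinearMap.comp_apply, LinearMap.rTensor,
      mul'_map_apply _ _ x x⁻¹ 1 (by simp [LinearMap.funLeft_apply])]
    simp [funReassoc, evalL_funTriple]
  reassoc_inv_antipode := by
    ext x
    rw [mul'_map_apply _ _ x x⁻¹ 1 (by simp [LinearMap.funLeft_apply]), LinearMap.comp_apply,
      mul'_map_apply _ _ x x (((ω.toFun x x⁻¹ x)⁻¹ : kˣ) : k) (by simp [mul_comm])]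
    have h := ω.cocycle x x⁻¹ x x⁻¹
    simp only [mul_inv_cancel, inv_mul_cancel, ω.one_left, ω.one_mid, ω.one_right, mul_one] at h
    have h' : (ω.toFun x x⁻¹ x)⁻¹ = ω.toFun x⁻¹ x x⁻¹ := by
      rw [inv_eq_iff_mul_eq_one, mul_comm]; exact h
    rw [h']
    simp only [funReassoc, Units.inv_mk, LinearMap.funLeft_apply, evalL_funTriple, Pi.one_apply,
      one_mul]
    simp

end Functions

/-! ### Finite abelian groups and their `3`-cocycles -/

/-- The finite abelian group `C_{m₁} × ⋯ × C_{mₙ}`. -/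
abbrev FinAb {n : ℕ} (m : Fin n → ℕ) : Type := ∀ j : Fin n, Multiplicative (ZMod (m j))

/-- The exponent `0 ≤ i_j ≤ m_j - 1` of the `j`-th generator in `x = g₁^{i₁} ⋯ gₙ^{iₙ}`. -/
def expo {n : ℕ} {m : Fin n → ℕ} (x : FinAb m) (j : Fin n) : ℕ := (Multiplicative.toAdd (x j)).val

/-- The element `g₁^{f₁} ⋯ gₙ^{fₙ}`. -/
def monomialElt {n : ℕ} (m : Fin n → ℕ) (f : Fin n → ℤ) : FinAb m :=
  fun j => Multiplicative.ofAdd ((f j : ℤ) : ZMod (m j))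

/-- The integers `c_l`, `c_{st}` (`s < t`) and `c_{rst}` (`r < s < t`); the values of `c₂` and `c₃`
at other indices are never used. -/
structure CocycleDatum (n : ℕ) where
  /-- `c_l` -/
  c₁ : Fin n → ℤ
  /-- `c_{st}` -/
  c₂ : Fin n → Fin n → ℤ
  /-- `c_{rst}` -/
  c₃ : Fin n → Fin n → Fin n → ℤ

/-- The pairs `s < t`. -/
def pairs (n : ℕ) : Finset (Fin n × Fin n) := Finset.univ.filter fun p => p.1 < p.2

/-- The triples `r < s < t`. -/
def triples (n : ℕ) : Finset (Fin n × Fin n × Fin n) :=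
  Finset.univ.filter fun p => p.1 < p.2.1 ∧ p.2.1 < p.2.2

/-- `(m_r, m_s, m_t)` -/
def gcd₃ {n : ℕ} (m : Fin n → ℕ) (p : Fin n × Fin n × Fin n) : ℕ :=
  Nat.gcd (m p.1) (Nat.gcd (m p.2.1) (m p.2.2))

/-- `N`, the least common multiple of all `m_j²` and all `m_s m_t`, `s < t`. -/
def lcmN {n : ℕ} (m : Fin n → ℕ) : ℕ :=
  Nat.lcm (Finset.univ.lcm fun j => m j ^ 2) ((pairs n).lcm fun p => m p.1 * m p.2)

/-- `M`, the least common multiple of all `(m_r, m_s, m_t)`, `r < s < t`. -/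
def lcmM {n : ℕ} (m : Fin n → ℕ) : ℕ := (triples n).lcm (gcd₃ m)

/-- The values of the `3`-cocycle `ω_a`, where `ξ_d = ζ^{N/d}` for a primitive `N`-th root of
unity `ζ`: at `(g^i, g^j, g^k)` it is the product of all `ξ_{m_l}^{c_l i_l ⌊(j_l + k_l)/m_l⌋}`, all
`ξ_{m_t}^{c_{st} i_t ⌊(j_s + k_s)/m_s⌋}` and all `ξ_{(m_r, m_s, m_t)}^{- c_{rst} k_r j_s i_t}`. -/
def omegaFun {k : Type u} [Field k] {n : ℕ} (m : Fin n → ℕ) (c : CocycleDatum n) (ζ : kˣ)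
    (x y z : FinAb m) : kˣ :=
  (∏ l : Fin n, (ζ ^ (lcmN m / m l)) ^
      (c.c₁ l * (expo x l : ℤ) * (((expo y l + expo z l) / m l : ℕ) : ℤ))) *
    (∏ p ∈ pairs n, (ζ ^ (lcmN m / m p.2)) ^
      (c.c₂ p.1 p.2 * (expo x p.2 : ℤ) * (((expo y p.1 + expo z p.1) / m p.1 : ℕ) : ℤ))) *
    ∏ p ∈ triples n, (ζ ^ (lcmN m / gcd₃ m p)) ^
      (-(c.c₃ p.1 p.2.1 p.2.2 * (expo z p.1 : ℤ) * (expo y p.2.1 : ℤ) * (expo x p.2.2 : ℤ)))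

lemma expo_mul {n : ℕ} {m : Fin n → ℕ} [∀ j, NeZero (m j)] (x y : FinAb m) (j : Fin n) :
    expo x j + expo y j = expo (x * y) j + m j * ((expo x j + expo y j) / m j) := by
  have h : expo (x * y) j = (expo x j + expo y j) % m j := ZMod.val_add _ _
  rw [h, Nat.mod_add_div]

lemma expo_one {n : ℕ} {m : Fin n → ℕ} [∀ j, NeZero (m j)] (j : Fin n) :
    expo (1 : FinAb m) j = 0 := ZMod.val_zero

lemma expo_lt {n : ℕ} {m : Fin n → ℕ} [∀ j, NeZero (m j)] (x : FinAb m) (j : Fin n) :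
    expo x j < m j := ZMod.val_lt _

lemma zpow_congr_of_dvd {A : Type*} [Group A] {η : A} {d : ℕ} (h : η ^ d = 1) {a b : ℤ}
    (hab : (d : ℤ) ∣ a - b) : η ^ a = η ^ b := by
  obtain ⟨q, hq⟩ := hab
  rw [show a = b + d * q by omega, zpow_add, zpow_mul, zpow_natCast, h, one_zpow, mul_one]

lemma dvd_lcmN {n : ℕ} (m : Fin n → ℕ) (j : Fin n) : m j ∣ lcmN m :=
  ((dvd_pow_self (m j) two_ne_zero).trans
    (Finset.dvd_lcm (f := fun j => m j ^ 2) (Finset.mem_univ j))).trans (Nat.dvd_lcm_left _ _)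

lemma root_pow {k : Type u} [Field k] {ζ : kˣ} {N d : ℕ} (hζ : ζ ^ N = 1) (hd : d ∣ N) :
    (ζ ^ (N / d)) ^ d = 1 := by
  rw [← pow_mul, Nat.div_mul_cancel hd, hζ]

lemma cocycle_cup {A : Type*} [CommGroup A] {n : ℕ} {m : Fin n → ℕ} [∀ j, NeZero (m j)] {η : A}
    (s t : Fin n) (h : η ^ m t = 1) (c : ℤ) (x y z w : FinAb m) :
    η ^ (c * (expo y t : ℤ) * (((expo z s + expo w s) / m s : ℕ) : ℤ)) *
        η ^ (c * (expo x t : ℤ) * (((expo (y * z) s + expo w s) / m s : ℕ) : ℤ)) *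
        η ^ (c * (expo x t : ℤ) * (((expo y s + expo z s) / m s : ℕ) : ℤ)) =
      η ^ (c * (expo x t : ℤ) * (((expo y s + expo (z * w) s) / m s : ℕ) : ℤ)) *
        η ^ (c * (expo (x * y) t : ℤ) * (((expo z s + expo w s) / m s : ℕ) : ℤ)) := by
  rw [← zpow_add, ← zpow_add, ← zpow_add]
  refine zpow_congr_of_dvd h ?_
  have h1 := expo_mul x y t
  have h2 := expo_mul z w s
  have h3 := expo_mul (y * z) w s
  have h4 := expo_mul y z s
  have h5 := expo_mul y (z * w) s
  rw [← mul_assoc] at h5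
  have hm : (m s : ℤ) ≠ 0 := by exact_mod_cast NeZero.ne (m s)
  set q1 := (expo x t + expo y t) / m t
  set q2 := (expo z s + expo w s) / m s
  set q3 := (expo (y * z) s + expo w s) / m s
  set q4 := (expo y s + expo z s) / m s
  set q5 := (expo y s + expo (z * w) s) / m s
  zify at h1 h2 h3 h4 h5
  have key : (q3 : ℤ) + q4 = q5 + q2 := by
    apply mul_left_cancel₀ hm
    linear_combination h5 + h2 - h3 - h4
  refine ⟨c * q1 * q2, ?_⟩
  linear_combination (c * (q2 : ℤ)) * h1 + (c * (expo x t : ℤ)) * key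

lemma cocycle_trilinear {A : Type*} [CommGroup A] {n : ℕ} {m : Fin n → ℕ} [∀ j, NeZero (m j)]
    {η : A} {d : ℕ} (h : η ^ d = 1) (r s t : Fin n) (hr : d ∣ m r) (hs : d ∣ m s) (ht : d ∣ m t)
    (c : ℤ) (x y z w : FinAb m) :
    η ^ (-(c * (expo w r : ℤ) * (expo z s : ℤ) * (expo y t : ℤ))) *
        η ^ (-(c * (expo w r : ℤ) * (expo (y * z) s : ℤ) * (expo x t : ℤ))) *
        η ^ (-(c * (expo z r : ℤ) * (expo y s : ℤ) * (expo x t : ℤ))) =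
      η ^ (-(c * (expo (z * w) r : ℤ) * (expo y s : ℤ) * (expo x t : ℤ))) *
        η ^ (-(c * (expo w r : ℤ) * (expo z s : ℤ) * (expo (x * y) t : ℤ))) := by
  rw [← zpow_add, ← zpow_add, ← zpow_add]
  refine zpow_congr_of_dvd h ?_
  have h1 := expo_mul x y t
  have h2 := expo_mul z w r
  have h3 := expo_mul y z s
  obtain ⟨a, ha⟩ := hr
  obtain ⟨b, hb⟩ := hs
  obtain ⟨e, he⟩ := ht
  set q1 := (expo x t + expo y t) / m t
  set q2 := (expo z r + expo w r) / m r
  set q3 := (expo y s + expo z s) / m s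
  rw [he] at h1
  rw [ha] at h2
  rw [hb] at h3
  zify at h1 h2 h3
  refine ⟨c * (expo w r : ℤ) * (b * q3) * (expo x t : ℤ) -
    c * (a * q2) * (expo y s : ℤ) * (expo x t : ℤ) -
    c * (expo w r : ℤ) * (expo z s : ℤ) * (e * q1), ?_⟩
  linear_combination (c * (expo w r : ℤ) * (expo x t : ℤ)) * h3 -
    (c * (expo y s : ℤ) * (expo x t : ℤ)) * h2 - (c * (expo w r : ℤ) * (expo z s : ℤ)) * h1

/-- The normalized `3`-cocycle `ω_a` on `C_{m₁} × ⋯ × C_{mₙ}`. -/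
def omega {k : Type u} [Field k] {n : ℕ} (m : Fin n → ℕ) [∀ j, NeZero (m j)]
    (c : CocycleDatum n) (ζ : kˣ) (hζ : IsPrimitiveRoot ζ (lcmN m)) :
    NormalizedCocycle₃ (FinAb m) k where
  toFun := omegaFun m c ζ
  cocycle x y z w := by
    have e1 : ∀ a b d a' b' d' a'' b'' d'' p q r p' q' r' : kˣ,
        a * a' * a'' = p * p' → b * b' * b'' = q * q' → d * d' * d'' = r * r' →
        (a * b * d) * (a' * b' * d') * (a'' * b'' * d'') = (p * q * r) * (p' * q' * r') := by
      intro a b d a' b' d' a'' b'' d'' p q r p' q' r' h1 h2 h3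
      calc _ = (a * a' * a'') * (b * b' * b'') * (d * d' * d'') := by
            simp only [mul_comm, mul_left_comm]
        _ = (p * p') * (q * q') * (r * r') := by rw [h1, h2, h3]
        _ = _ := by simp only [mul_comm, mul_left_comm]
    unfold omegaFun
    apply e1
    · simp only [← Finset.prod_mul_distrib]
      exact Finset.prod_congr rfl fun l _ =>
        cocycle_cup l l (root_pow hζ.pow_eq_one (dvd_lcmN m l)) _ x y z w
    · simp only [← Finset.prod_mul_distrib]
      exact Finset.prod_congr rfl fun p _ =>
        cocycle_cup p.1 p.2 (root_pow hζ.pow_eq_one (dvd_lcmN m p.2)) _ x y z w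
    · simp only [← Finset.prod_mul_distrib]
      refine Finset.prod_congr rfl fun p _ => ?_
      have hr : gcd₃ m p ∣ m p.1 := Nat.gcd_dvd_left _ _
      have hs : gcd₃ m p ∣ m p.2.1 := (Nat.gcd_dvd_right _ _).trans (Nat.gcd_dvd_left _ _)
      have ht : gcd₃ m p ∣ m p.2.2 := (Nat.gcd_dvd_right _ _).trans (Nat.gcd_dvd_right _ _)
      exact cocycle_trilinear (root_pow hζ.pow_eq_one (hr.trans (dvd_lcmN m p.1)))
        p.1 p.2.1 p.2.2 hr hs ht _ x y z w
  one_left y z := by simp [omegaFun, expo_one]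
  one_mid x z := by simp [omegaFun, expo_one, Nat.div_eq_of_lt (expo_lt z _)]
  one_right x y := by simp [omegaFun, expo_one, Nat.div_eq_of_lt (expo_lt y _)]

/-! ### Smith normal forms and the numerical condition -/

/-- A Smith normal form `U A V = diag(d₁, …, d_r, 0, …, 0)` of an integer matrix `A`, with
unimodular `U`, `V`. -/
structure SmithForm {a b : ℕ} (A : Matrix (Fin a) (Fin b) ℤ) where
  /-- the left unimodular matrix -/
  U : Matrix (Fin a) (Fin a) ℤ
  /-- the right unimodular matrix -/
  V : Matrix (Fin b) (Fin b) ℤ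
  isUnit_det_U : IsUnit U.det
  isUnit_det_V : IsUnit V.det
  /-- the rank -/
  r : ℕ
  r_le_left : r ≤ a
  r_le_right : r ≤ b
  /-- the invariant factors -/
  d : Fin r → ℤ
  d_ne_zero : ∀ i, d i ≠ 0
  d_dvd : ∀ i j, i ≤ j → d i ∣ d j
  eq_diag : U * A * V = Matrix.of fun (i : Fin a) (j : Fin b) =>
    if h : (i : ℕ) < r then (if (i : ℕ) = (j : ℕ) then d ⟨i, h⟩ else 0) else 0

/-- `M^c_{rst} = M / (m_r, m_s, m_t) · c_{rst}` -/
def Mc {n : ℕ} (m : Fin n → ℕ) (c : CocycleDatum n) (r s t : Fin n) : ℤ :=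
  ((lcmM m / gcd₃ m (r, s, t) : ℕ) : ℤ) * c.c₃ r s t

/-- The matrix `A'`: its columns are indexed by the pairs `r < s` (enumerated by `e`), and the
column of `(r, s)` has the entries `M^c_{urs}` in the rows `u < r`, `-M^c_{rus}` in the rows
`r < u < s`, `M^c_{rsu}` in the rows `u > s`, and `0` in the rows `r` and `s`. -/
def matA {n : ℕ} (m : Fin n → ℕ) (c : CocycleDatum n) (e : Fin (n.choose 2) ≃ pairs n) :
    Matrix (Fin n) (Fin (n.choose 2)) ℤ :=
  Matrix.of fun u j =>
    if u < (e j).1.1 then Mc m c u (e j).1.1 (e j).1.2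
    else if u = (e j).1.1 then 0
    else if u < (e j).1.2 then -Mc m c (e j).1.1 u (e j).1.2
    else if u = (e j).1.2 then 0
    else Mc m c (e j).1.1 (e j).1.2 u

/-- `Y_y = (-y₁ M/(d'₁, M), …, -y_{r'} M/(d'_{r'}, M), y_{r'+1}, …, yₙ)` -/
def vecY {n b : ℕ} {A : Matrix (Fin n) (Fin b) ℤ} (S : SmithForm A) (M : ℕ) (y : Fin n → ℤ) :
    Fin n → ℤ :=
  fun j => if h : (j : ℕ) < S.r then
    -(y j * ((M / Int.gcd (S.d ⟨j, h⟩) (M : ℤ) : ℕ) : ℤ)) else y j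

/-- The row vector `f = Y_y U'`. -/
def vecF {n b : ℕ} {A : Matrix (Fin n) (Fin b) ℤ} (S : SmithForm A) (M : ℕ) (y : Fin n → ℤ) :
    Fin n → ℤ :=
  Matrix.vecMul (vecY S M y) S.U

/-- The symmetric matrix `C` with diagonal entries `c_j / m_j²` and entries `c_{st} / (2 m_s m_t)` at
the positions `(s, t)` and `(t, s)`, `s < t`. -/
def matC {n : ℕ} (m : Fin n → ℕ) (c : CocycleDatum n) : Matrix (Fin n) (Fin n) ℚ :=
  Matrix.of fun s t =>
    if s = t then (c.c₁ s : ℚ) / (m s : ℚ) ^ 2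
    else if s < t then (c.c₂ s t : ℚ) / (2 * (m s : ℚ) * (m t : ℚ))
    else (c.c₂ t s : ℚ) / (2 * (m t : ℚ) * (m s : ℚ))

/-- The condition that `Λ' ᵗY_y + Y_y C' ᵗY_y - 1/2` is an integer, where
`Λ' = (λ₁/m₁, …, λₙ/mₙ) ᵗU'` and `C' = U' C ᵗU'`. -/
def Admissible {n b : ℕ} (m : Fin n → ℕ) (c : CocycleDatum n) {A : Matrix (Fin n) (Fin b) ℤ}
    (S : SmithForm A) (y l : Fin n → ℤ) : Prop :=
  let U' : Matrix (Fin n) (Fin n) ℚ := S.U.map (fun a : ℤ => (a : ℚ))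
  let C' : Matrix (Fin n) (Fin n) ℚ := U' * matC m c * U'.transpose
  let Y : Fin n → ℚ := fun j => (vecY S (lcmM m) y j : ℚ)
  let L' : Fin n → ℚ := Matrix.vecMul (fun j => (l j : ℚ) / (m j : ℚ)) U'.transpose
  ∃ z : ℤ, L' ⬝ᵥ Y + Y ⬝ᵥ Matrix.mulVec C' Y - 1 / 2 = (z : ℚ)

/-- The function `ρ_{f,λ}` on `G`: at `g₁^{i₁} ⋯ gₙ^{iₙ}`, `0 ≤ i_j ≤ m_j - 1`, its value is the
product of all `ξ_{m_j}^{λ_j i_j}`, all `ξ_{m_j²}^{c_j f_j i_j}` and all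
`ξ_{m_s m_t}^{c_{st} f_t i_s}`, `s < t`, where `ξ_d = ζ^{N/d}`. -/
def rho {k : Type u} [Field k] {n : ℕ} (m : Fin n → ℕ) (c : CocycleDatum n) (ζ : kˣ)
    (f l : Fin n → ℤ) (x : FinAb m) : k :=
  (((∏ j : Fin n, (ζ ^ (lcmN m / m j)) ^ (l j * (expo x j : ℤ))) *
    (∏ j : Fin n, (ζ ^ (lcmN m / m j ^ 2)) ^ (c.c₁ j * f j * (expo x j : ℤ))) *
    ∏ p ∈ pairs n, (ζ ^ (lcmN m / (m p.1 * m p.2))) ^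
      (c.c₂ p.1 p.2 * f p.2 * (expo x p.1 : ℤ)) : kˣ) : k)

/-- The quasi-Hopf algebra `k^G_ω` for `G = C_{m₁} × ⋯ × C_{mₙ}` and `ω = ω_a`, as a
quasi-bialgebra. -/
noncomputable abbrev kGomega {k : Type u} [Field k] {n : ℕ} (m : Fin n → ℕ) [∀ j, NeZero (m j)]
    (c : CocycleDatum n) (ζ : kˣ) (hζ : IsPrimitiveRoot ζ (lcmN m)) :
    QuasiBialgebra k (FinAb m → k) :=
  (functionAlgebra (omega m c ζ hζ)).toQuasiBialgebra

end QuasiHopf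

open QuasiHopf

namespace QuasiHopf

universe u w

/-! ### Homogeneous elements of modules over `k^G` -/

section Homogeneous

variable {k : Type u} {G : Type w} [Field k] {M N P : Type*} [AddCommGroup M] [Module k M]
  [AddCommGroup N] [Module k N] [AddCommGroup P] [Module k P]

/-! `k^G` is spanned by orthogonal idempotents, so on homogeneous vectors every structure map of the
Yetter-Drinfeld category is multiplication by values of `ω` and of the coactions. A two-dimensional
braided Hopf algebra splits as `k·1 ⊕ k·x`, with `x` spanning the kernel of the counit. This line is
stable under action and coaction, so `x` has a degree `g` and a coaction `x ↦ v ⊗ x`, with `(g, v)`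
subject to `IsYetterDrinfeldPair`. The remaining structure is given by three scalars: `x² = a x`,
`Δ(x) = x ⊗ 1 + 1 ⊗ x + b x ⊗ x`, `S(x) = q x`.

If `a` or `b` is nonzero, comparing degrees and coactions forces `g = 1` and `v = 1`, and the
bialgebra and antipode axioms force `ab = -2`. Then `1 + b x` is group-like of square `1`, and the
algebra is `k[C₂]` (`IsPresentation.isTrivial`). Otherwise `a = b = 0`, and multiplicativity of `Δ`
on `x²` says `v(g) = -1` (`IsPresentation.weight_degree_eq`); conversely `pairHopf` realises every
such pair. As `x` is unique up to a scalar, `(g, v)` is a complete isomorphism invariant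
(`exists_equiv_of_parametrization`).

For `ω_a` the condition on `v` reads `v(y) v(z) = θ(y, z) v(yz)` with a `2`-cochain `θ` depending on
`g` (`isYetterDrinfeldPair_omega_iff`). Since `G` is abelian, `θ` must be symmetric. In terms of the
exponent vector `f` of `g` this is `f A' ≡ 0` modulo `M`. Then `ρ_{f,0}` is one solution, and the
others differ from it by characters of `G`, that is, by the choice of `λ`
(`isYetterDrinfeldPair_iff`). The Smith normal form solves the congruence: `f = Y U'` with `d'_i Y_i
≡ 0` modulo `M` (`dvd_vecMul_iff_exists_vecF`).

Finally `ρ(g) = ζ^{N q}` with `q` the value of `quadForm`. So `v(g) = -1` makes `-1` an `N`-th root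
of unity and `N` even, and for even `N` it says that `q - 1/2` is an integer, which is admissibility
(`rho_eq_neg_one_iff`, `admissible_iff`). When `f(y)` is not reduced modulo the `m_j`, a change of
`λ` compensates for the reduction (`exists_quadForm_sub_eq`). -/

/-- An element of a `k^G`-module on which `k^G` acts through the evaluation at `g`. -/
def IsHomogeneous (ρ : (G → k) →ₐ[k] Module.End k M) (g : G) (x : M) : Prop :=
  ∀ φ : G → k, ρ φ x = φ g • x

/-- The evaluation `k^G ⊗ M → M` at a point of `G`, as a linear map. -/
noncomputable def evalₗ (k : Type u) {G : Type w} [Field k] (M : Type*) [AddCommGroup M]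
    [Module k M] (y : G) : (G → k) ⊗[k] M →ₗ[k] M :=
  (TensorProduct.lid k M).toLinearMap ∘ₗ LinearMap.rTensor M (LinearMap.proj y)

@[simp] lemma evalₗ_tmul (y : G) (φ : G → k) (x : M) : evalₗ k M y (φ ⊗ₜ[k] x) = φ y • x := by
  simp [evalₗ]

lemma tmul_left_cancel {φ ψ : G → k} {x : M} (hx : x ≠ 0) (h : φ ⊗ₜ[k] x = ψ ⊗ₜ[k] x) :
    φ = ψ := by
  ext y
  have := congrArg (evalₗ k M y) h
  simp only [evalₗ_tmul] at this
  exact smul_left_injective k hx this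

/-- Pure tensors in `k^G ⊗ k^G` act by the product of their values at the two degrees. This and its
threefold analogue turn associators into values of `ω`. -/
lemma act₂_apply_of_homogeneous {ρ : (G → k) →ₐ[k] Module.End k M}
    {τ : (G → k) →ₐ[k] Module.End k N} {a b : G} {x : M} {y : N}
    (hx : IsHomogeneous ρ a x) (hy : IsHomogeneous τ b y) (t : (G → k) ⊗[k] (G → k)) :
    act₂ ρ τ t (x ⊗ₜ[k] y) = evalL a t b • (x ⊗ₜ[k] y) := by
  induction t with
  | zero => simp
  | add s t hs ht => simp [add_smul, hs, ht]
  | tmul φ ψ =>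
    simp only [act₂, AlgHom.comp_apply, Algebra.TensorProduct.map_tmul,
      Module.endTensorEndAlgHom_apply, TensorProduct.AlgebraTensorModule.map_tmul, hx φ, hy ψ,
      TensorProduct.smul_tmul_smul, evalL_tmul, Pi.smul_apply, smul_eq_mul]

lemma act₃_apply_of_homogeneous {ρ : (G → k) →ₐ[k] Module.End k M}
    {τ : (G → k) →ₐ[k] Module.End k N} {π : (G → k) →ₐ[k] Module.End k P} {a b c : G}
    {x : M} {y : N} {z : P} (hx : IsHomogeneous ρ a x) (hy : IsHomogeneous τ b y)
    (hz : IsHomogeneous π c z) (t : (G → k) ⊗[k] ((G → k) ⊗[k] (G → k))) :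
    act₃ ρ τ π t (x ⊗ₜ[k] (y ⊗ₜ[k] z)) =
      evalL b (evalL a t) c • (x ⊗ₜ[k] (y ⊗ₜ[k] z)) := by
  induction t with
  | zero => simp
  | add s t hs ht => simp [add_smul, hs, ht]
  | tmul φ ψ =>
    have := act₂_apply_of_homogeneous hy hz ψ
    simp only [act₃, AlgHom.comp_apply, Algebra.TensorProduct.map_tmul,
      Module.endTensorEndAlgHom_apply, TensorProduct.AlgebraTensorModule.map_tmul, hx φ, this,
      TensorProduct.smul_tmul_smul, evalL_tmul, Pi.smul_apply, evalL_smul, smul_eq_mul]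

lemma halfBraiding_apply_of_homogeneous {coact : M →ₗ[k] (G → k) ⊗[k] M}
    {τ : (G → k) →ₐ[k] Module.End k N} {a : G} {v : G → k} {x : M} {y : N}
    (hx : coact x = v ⊗ₜ[k] x) (hy : IsHomogeneous τ a y) :
    halfBraiding coact τ (x ⊗ₜ[k] y) = v a • (y ⊗ₜ[k] x) := by
  simp [halfBraiding, hx, hy v, TensorProduct.smul_tmul']

/-- The coaction axioms insert the unit of `H` into tensor products. Writing it as the sum of the
`P_y` makes all arguments homogeneous. -/
lemma isHomogeneous_single [DecidableEq G] (y : G) :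
    IsHomogeneous (Algebra.lmul k (G → k)) y (Pi.single y (1 : k) : G → k) := by
  intro φ
  ext z
  by_cases h : z = y
  · subst h; simp
  · simp [h]

lemma IsHomogeneous.smul {ρ : (G → k) →ₐ[k] Module.End k M} {g : G} {x : M}
    (hx : IsHomogeneous ρ g x) (a : k) : IsHomogeneous ρ g (a • x) := fun φ => by
  rw [map_smul, hx φ, smul_comm]

lemma eq_sum_single [Fintype G] [DecidableEq G] (v : G → k) :
    v = ∑ y : G, v y • (Pi.single y (1 : k) : G → k) := by
  ext z
  simp [Finset.sum_apply, Pi.single_apply]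

lemma one_eq_sum_single [Fintype G] [DecidableEq G] :
    (1 : G → k) = ∑ y : G, (Pi.single y (1 : k) : G → k) := by
  simpa using eq_sum_single (1 : G → k)

lemma tmul_eq_sum_single [Fintype G] [DecidableEq G] (v : G → k) (x : M) :
    v ⊗ₜ[k] x = ∑ y : G, v y • ((Pi.single y (1 : k) : G → k) ⊗ₜ[k] x) := by
  conv_lhs => rw [eq_sum_single v]
  simp [TensorProduct.sum_tmul, TensorProduct.smul_tmul']

/-- The values of `σ` on the `P_y` sum to `1`, so some `P_g` is not killed; applying `σ` to `φ P_g =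
φ(g) P_g` and cancelling gives the claim. -/
lemma exists_eq_eval [Fintype G] [DecidableEq G] (σ : (G → k) →ₐ[k] k) :
    ∃ g : G, ∀ φ : G → k, σ φ = φ g := by
  have h1 : ∑ y : G, σ (Pi.single y 1) = 1 := by
    rw [← map_sum, ← one_eq_sum_single, map_one]
  obtain ⟨g, -, hg⟩ : ∃ g ∈ Finset.univ, σ (Pi.single g 1) ≠ 0 := by
    by_contra! h
    rw [Finset.sum_eq_zero h] at h1
    exact zero_ne_one h1
  refine ⟨g, fun φ => mul_right_cancel₀ hg ?_⟩
  rw [← map_mul, ← smul_eq_mul (φ g), ← map_smul]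
  congr 1
  exact isHomogeneous_single g φ

/-- The pairs `(g, v)` that are the degree and the coaction of a one-dimensional Yetter-Drinfeld
module over `k^G_ω`. -/
structure IsYetterDrinfeldPair [Group G] (ω : NormalizedCocycle₃ G k) (g : G) (v : G → k) :
    Prop where
  map_one : v 1 = 1
  mul_mul : ∀ y z : G, ω.toFun y g z * v y * v z = ω.toFun g y z * v (y * z) * ω.toFun y z g

/-- In the multiplicativity relation at `(y, y⁻¹)` the right-hand side is a unit, because `v 1 = 1`.
-/
lemma IsYetterDrinfeldPair.ne_zero [Group G] {ω : NormalizedCocycle₃ G k} {g : G} {v : G → k}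
    (h : IsYetterDrinfeldPair ω g v) (y : G) : v y ≠ 0 := by
  intro hy
  have := h.mul_mul y y⁻¹
  rw [hy, mul_inv_cancel, h.map_one] at this
  simp at this

lemma isYetterDrinfeldPair_one [Group G] (ω : NormalizedCocycle₃ G k) : IsYetterDrinfeldPair ω 1 1 where
  map_one := rfl
  mul_mul y z := by simp [ω.one_left, ω.one_mid, ω.one_right]

variable [Group G] [Fintype G] [DecidableEq G] (ω : NormalizedCocycle₃ G k)

variable {ρ : (G → k) →ₐ[k] Module.End k M} {τ : (G → k) →ₐ[k] Module.End k N}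
  {π : (G → k) →ₐ[k] Module.End k P} {a b c : G} {x : M} {y : N} {z : P}

lemma isHomogeneous_tensorAct (hx : IsHomogeneous ρ a x) (hy : IsHomogeneous τ b y) :
    IsHomogeneous ((functionAlgebra ω).tensorAct ρ τ) (a * b) (x ⊗ₜ[k] y) := fun φ =>
  (act₂_apply_of_homogeneous hx hy _).trans (congrArg (· • _) (evalL_funComul a b φ))

lemma assoc_apply_of_homogeneous (hx : IsHomogeneous ρ a x) (hy : IsHomogeneous τ b y)
    (hz : IsHomogeneous π c z) :
    (functionAlgebra ω).assoc ρ τ π ((x ⊗ₜ[k] y) ⊗ₜ[k] z) =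
      (ω.toFun a b c : k) • (x ⊗ₜ[k] (y ⊗ₜ[k] z)) :=
  (act₃_apply_of_homogeneous hx hy hz _).trans (by
    rw [show ((functionAlgebra ω).reassoc).val = funTriple fun x y z => (ω.toFun x y z : k) from rfl,
      evalL_funTriple])

lemma assocInv_apply_of_homogeneous (hx : IsHomogeneous ρ a x) (hy : IsHomogeneous τ b y)
    (hz : IsHomogeneous π c z) :
    (functionAlgebra ω).assocInv ρ τ π (x ⊗ₜ[k] (y ⊗ₜ[k] z)) =
      ((ω.toFun a b c)⁻¹ : k) • ((x ⊗ₜ[k] y) ⊗ₜ[k] z) := by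
  rw [QuasiBialgebra.assocInv, LinearMap.comp_apply, act₃_apply_of_homogeneous hx hy hz,
    show ((functionAlgebra ω).reassoc⁻¹ : ((G → k) ⊗[k] ((G → k) ⊗[k] (G → k)))ˣ).val =
      funTriple fun x y z => (((ω.toFun x y z)⁻¹ : kˣ) : k) from rfl, evalL_funTriple]
  simp

/-- The element `x` has degree `g` and coaction `x ↦ v ⊗ x`. -/
structure YetterDrinfeld.IsEigen {ω : NormalizedCocycle₃ G k}
    (X : YetterDrinfeld (functionAlgebra ω).toQuasiBialgebra M) (g : G) (v : G → k) (x : M) :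
    Prop where
  act : IsHomogeneous X.act g x
  coact : X.coact x = v ⊗ₜ[k] x

/-- Each of the three associators and two half-braidings contributes one factor. If `a` or `b` is
`1`, normalization of `ω` leaves just the product of the two coactions. -/
lemma YetterDrinfeld.tensorCoact_apply {ω : NormalizedCocycle₃ G k}
    {X : YetterDrinfeld (functionAlgebra ω).toQuasiBialgebra M}
    {Y : YetterDrinfeld (functionAlgebra ω).toQuasiBialgebra N} {v v' : G → k}
    (hx : X.IsEigen a v x) (hy : Y.IsEigen b v' y) :
    X.tensorCoact Y (x ⊗ₜ[k] y) =
      (fun h => ω.toFun a b h * v' h * (ω.toFun a h b : k)⁻¹ * v h * ω.toFun h a b) ⊗ₜ[k]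
        (x ⊗ₜ[k] y) := by
  rw [tmul_eq_sum_single]
  simp only [tensorCoact, LinearMap.comp_apply, LinearMap.flip_apply, TensorProduct.mk_apply]
  rw [one_eq_sum_single, TensorProduct.tmul_sum]
  simp only [map_sum]
  refine Finset.sum_congr rfl fun h _ => ?_
  have hh := isHomogeneous_single (k := k) h
  simp only [assoc_apply_of_homogeneous ω hx.act hy.act hh, map_smul, LinearMap.lTensor_tmul,
    halfBraiding_apply_of_homogeneous hy.coact hh, TensorProduct.tmul_smul,
    assocInv_apply_of_homogeneous ω hx.act hh hy.act, LinearMap.rTensor_tmul,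
    halfBraiding_apply_of_homogeneous hx.coact hh, ← TensorProduct.smul_tmul',
    assoc_apply_of_homogeneous ω hh hx.act hy.act, smul_smul]

/-- The factor `v c` comes from braiding `y` past `z`; it is the only one not coming from `ω`, and
for `c = g` it produces the condition `v g = -1`. -/
lemma YetterDrinfeld.tensorMul_apply {ω : NormalizedCocycle₃ G k}
    {X : YetterDrinfeld (functionAlgebra ω).toQuasiBialgebra M} (mul : M ⊗[k] M →ₗ[k] M)
    {a b c d : G} {v : G → k} {x y z t : M} (hx : IsHomogeneous X.act a x) (hy : X.IsEigen b v y)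
    (hz : IsHomogeneous X.act c z) (ht : IsHomogeneous X.act d t) :
    X.tensorMul mul ((x ⊗ₜ[k] y) ⊗ₜ[k] (z ⊗ₜ[k] t)) =
      (ω.toFun a b (c * d) * (ω.toFun b c d : k)⁻¹ * v c * ω.toFun c b d *
        (ω.toFun a c (b * d) : k)⁻¹) • (mul (x ⊗ₜ[k] z) ⊗ₜ[k] mul (y ⊗ₜ[k] t)) := by
  simp only [tensorMul, LinearMap.comp_apply]
  simp only [assoc_apply_of_homogeneous ω hx hy.act (isHomogeneous_tensorAct ω hz ht), map_smul,
    LinearMap.lTensor_tmul, assocInv_apply_of_homogeneous ω hy.act hz ht, TensorProduct.tmul_smul,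
    LinearMap.rTensor_tmul, halfBraiding_apply_of_homogeneous hy.coact hz,
    ← TensorProduct.smul_tmul', assoc_apply_of_homogeneous ω hz hy.act ht,
    assocInv_apply_of_homogeneous ω hx hz (isHomogeneous_tensorAct ω hy.act ht),
    TensorProduct.map_tmul, smul_smul]

/-! ### The coaction axiom as an identity of coefficients -/

section Coact

variable {act : (G → k) →ₐ[k] Module.End k M} {coact : M →ₗ[k] (G → k) ⊗[k] M} {v : G → k}

/-- Comparing the coefficients of `P_y ⊗ P_z ⊗ x` here and in `coact_coact_right` gives exactly the
relation in `IsYetterDrinfeldPair`. Both lemmas take a bare action and coaction, so that they serve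
to analyse a given module as well as to construct one. -/
lemma coact_coact_left (ha : IsHomogeneous act a x) (hc : coact x = v ⊗ₜ[k] x) :
    LinearMap.lTensor (G → k) (halfBraiding coact (Algebra.lmul k (G → k)))
        ((functionAlgebra ω).assoc (Algebra.lmul k (G → k)) act (Algebra.lmul k (G → k))
          (coact x ⊗ₜ[k] (1 : G → k))) =
      ∑ y : G, ∑ z : G, (ω.toFun y a z * v y * v z : k) • ((Pi.single y (1 : k) : G → k) ⊗ₜ[k]
        ((Pi.single z (1 : k) : G → k) ⊗ₜ[k] x)) := by
  rw [hc, tmul_eq_sum_single, TensorProduct.sum_tmul]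
  simp only [map_sum]
  refine Finset.sum_congr rfl fun y _ => ?_
  rw [one_eq_sum_single, TensorProduct.tmul_sum]
  simp only [map_sum]
  refine Finset.sum_congr rfl fun z _ => ?_
  rw [← TensorProduct.smul_tmul', map_smul,
    assoc_apply_of_homogeneous ω (isHomogeneous_single y) ha (isHomogeneous_single z), map_smul,
    map_smul, LinearMap.lTensor_tmul, halfBraiding_apply_of_homogeneous hc (isHomogeneous_single z),
    TensorProduct.tmul_smul, smul_smul, smul_smul]
  congr 1
  ring

lemma coact_coact_right (ha : IsHomogeneous act a x) (hc : coact x = v ⊗ₜ[k] x) :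
    (functionAlgebra ω).assoc (Algebra.lmul k (G → k)) (Algebra.lmul k (G → k)) act
        (halfBraiding coact ((functionAlgebra ω).tensorAct (Algebra.lmul k (G → k))
            (Algebra.lmul k (G → k)))
          ((functionAlgebra ω).assoc act (Algebra.lmul k (G → k)) (Algebra.lmul k (G → k))
            ((x ⊗ₜ[k] (1 : G → k)) ⊗ₜ[k] (1 : G → k)))) =
      ∑ y : G, ∑ z : G, (ω.toFun a y z * v (y * z) * ω.toFun y z a : k) •
        ((Pi.single y (1 : k) : G → k) ⊗ₜ[k] ((Pi.single z (1 : k) : G → k) ⊗ₜ[k] x)) := by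
  have h1 : (x ⊗ₜ[k] (1 : G → k)) ⊗ₜ[k] (1 : G → k) = ∑ y : G, ∑ z : G,
      (x ⊗ₜ[k] (Pi.single y (1 : k) : G → k)) ⊗ₜ[k] (Pi.single z (1 : k) : G → k) := by
    simp only [← TensorProduct.tmul_sum, ← TensorProduct.sum_tmul, ← one_eq_sum_single]
  rw [h1]
  simp only [map_sum]
  refine Finset.sum_congr rfl fun y _ => Finset.sum_congr rfl fun z _ => ?_
  have hy := isHomogeneous_single (k := k) y
  have hz := isHomogeneous_single (k := k) z
  rw [assoc_apply_of_homogeneous ω ha hy hz, map_smul, map_smul,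
    halfBraiding_apply_of_homogeneous hc (isHomogeneous_tensorAct ω hy hz), map_smul,
    assoc_apply_of_homogeneous ω hy hz ha, smul_smul, smul_smul]

end Coact

lemma YetterDrinfeld.IsEigen.isYetterDrinfeldPair {ω : NormalizedCocycle₃ G k}
    {X : YetterDrinfeld (functionAlgebra ω).toQuasiBialgebra M} {g : G} {v : G → k} {x : M}
    (h : X.IsEigen g v x) (hx : x ≠ 0) : IsYetterDrinfeldPair ω g v where
  map_one := by
    have := X.counit_coact x
    rw [h.coact] at this
    refine smul_left_injective k hx ?_
    simpa [functionAlgebra] using this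
  mul_mul y z := by
    have := X.coact_coact x
    rw [coact_coact_left ω h.act h.coact, coact_coact_right ω h.act h.coact] at this
    replace this := congrArg (fun t => evalₗ k M z (evalₗ k _ y t)) this
    refine smul_left_injective k hx ?_
    simpa [Pi.single_apply] using this

end Homogeneous

/-! ### The braided Hopf algebra `B_{g,v}` -/

/-- Taking plain functions together with proofs of linearity lets the pointwise axioms of the
structures be checked on a basis directly. -/
lemma eq_of_basis {k M M' ι : Type*} [Field k] [AddCommGroup M] [Module k M]
    [AddCommGroup M'] [Module k M'] (b : Module.Basis ι k M) {f g : M → M'}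
    (hf : IsLinearMap k f) (hg : IsLinearMap k g) (h : ∀ i, f (b i) = g (b i)) (x : M) :
    f x = g x :=
  LinearMap.congr_fun (b.ext h : hf.mk' f = hg.mk' g) x

section Construction

variable {k : Type u} {G : Type w} [Field k]

/-- The action of `k^G` on `k^ι` for which the `i`-th basis vector has degree `d i`. -/
noncomputable def diagonalAct (k : Type u) [Field k] {ι : Type*} (d : ι → G) :
    (G → k) →ₐ[k] Module.End k (ι → k) :=
  (Algebra.lmul k (ι → k)).comp (AlgHom.pi fun i => Pi.evalAlgHom k (fun _ : G => k) (d i))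

/-- The linear map `k^ι → k^G ⊗ k^ι` mapping the `i`-th basis vector `e_i` to `v i ⊗ e_i`. -/
noncomputable def diagonalCoact {ι : Type*} [Fintype ι] [DecidableEq ι] (v : ι → G → k) :
    (ι → k) →ₗ[k] (G → k) ⊗[k] (ι → k) :=
  (Pi.basisFun k ι).constr k fun i => v i ⊗ₜ[k] Pi.basisFun k ι i

variable {ι : Type*} [Fintype ι] [DecidableEq ι]

lemma isHomogeneous_diagonalAct (d : ι → G) (i : ι) :
    IsHomogeneous (diagonalAct k d) (d i) (Pi.basisFun k ι i) := by
  intro φ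
  ext j
  by_cases h : j = i
  · subst h; simp [diagonalAct]
  · simp [diagonalAct, h]

lemma diagonalCoact_basisFun (v : ι → G → k) (i : ι) :
    diagonalCoact v (Pi.basisFun k ι i) = v i ⊗ₜ[k] Pi.basisFun k ι i :=
  Module.Basis.constr_basis _ _ _ _

variable [CommGroup G] {ω : NormalizedCocycle₃ G k}

variable {g : G} {v : G → k}

lemma isYetterDrinfeldPair_vecCons (h : IsYetterDrinfeldPair ω g v) :
    ∀ i : Fin 2, IsYetterDrinfeldPair ω ((![1, g] : Fin 2 → G) i) ((![1, v] : Fin 2 → G → k) i) :=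
  Fin.forall_fin_two.2 ⟨isYetterDrinfeldPair_one ω, h⟩

variable [Fintype G] [DecidableEq G]

/-- The Yetter-Drinfeld module that is the direct sum of one-dimensional ones. -/
noncomputable def diagonalYetterDrinfeld {d : ι → G} {v : ι → G → k}
    (h : ∀ i, IsYetterDrinfeldPair ω (d i) (v i)) :
    YetterDrinfeld (functionAlgebra ω).toQuasiBialgebra (ι → k) where
  act := diagonalAct k d
  coact := diagonalCoact v
  counit_coact := eq_of_basis (Pi.basisFun k ι) ⟨by intros; simp, by intros; simp⟩
    ⟨by intros; simp, by intros; simp⟩ fun i => by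
      simp only [diagonalCoact_basisFun, LinearMap.rTensor_tmul, TensorProduct.lid_tmul]
      simp [functionAlgebra, (h i).map_one]
  coact_coact := eq_of_basis (Pi.basisFun k ι)
    ⟨by intros; simp only [map_add, TensorProduct.add_tmul],
      by intros; simp only [map_smul, ← TensorProduct.smul_tmul']⟩
    ⟨by intros; simp only [map_add, TensorProduct.add_tmul],
      by intros; simp only [map_smul, ← TensorProduct.smul_tmul']⟩ fun i => by
      rw [coact_coact_left ω (isHomogeneous_diagonalAct d i) (diagonalCoact_basisFun v i),
        coact_coact_right ω (isHomogeneous_diagonalAct d i) (diagonalCoact_basisFun v i)]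
      simp only [(h i).mul_mul]
  act_coact φ := eq_of_basis (Pi.basisFun k ι)
    ⟨by intros; simp only [map_add], by intros; simp only [map_smul]⟩
    ⟨by intros; simp only [map_add, TensorProduct.add_tmul],
      by intros; simp only [map_smul, ← TensorProduct.smul_tmul']⟩ fun i => by
      rw [diagonalCoact_basisFun, tmul_eq_sum_single, one_eq_sum_single, TensorProduct.tmul_sum]
      simp only [map_sum]
      refine Finset.sum_congr rfl fun y _ => ?_
      have hy := isHomogeneous_single (k := k) y
      have hi := isHomogeneous_diagonalAct (k := k) d i
      -- The two sides carry the scalars `φ (y * d i)` and `φ (d i * y)`: compatibility of action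
      -- and coaction rests on the commutativity of `G`.
      rw [map_smul, isHomogeneous_tensorAct ω hy hi φ, isHomogeneous_tensorAct ω hi hy φ, map_smul,
        halfBraiding_apply_of_homogeneous (diagonalCoact_basisFun v i) hy, smul_comm,
        mul_comm y]

lemma isEigen_diagonalYetterDrinfeld {d : ι → G} {v : ι → G → k}
    (h : ∀ i, IsYetterDrinfeldPair ω (d i) (v i)) (i : ι) :
    (diagonalYetterDrinfeld h).IsEigen (d i) (v i) (Pi.basisFun k ι i) :=
  ⟨isHomogeneous_diagonalAct d i, diagonalCoact_basisFun v i⟩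

variable (k) in
/-- The multiplication of the dual numbers `k[x]/(x²)`, in the basis `{1, x}`. -/
noncomputable def dualMul : (Fin 2 → k) ⊗[k] (Fin 2 → k) →ₗ[k] (Fin 2 → k) :=
  ((Pi.basisFun k (Fin 2)).tensorProduct (Pi.basisFun k (Fin 2))).constr k fun p =>
    (![![Pi.basisFun k (Fin 2) 0, Pi.basisFun k (Fin 2) 1], ![Pi.basisFun k (Fin 2) 1, 0]] :
      Fin 2 → Fin 2 → Fin 2 → k) p.1 p.2

lemma dualMul_basisFun (i j : Fin 2) :
    dualMul k (Pi.basisFun k (Fin 2) i ⊗ₜ[k] Pi.basisFun k (Fin 2) j) =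
      (![![Pi.basisFun k (Fin 2) 0, Pi.basisFun k (Fin 2) 1], ![Pi.basisFun k (Fin 2) 1, 0]] :
        Fin 2 → Fin 2 → Fin 2 → k) i j := by
  rw [← Module.Basis.tensorProduct_apply, dualMul, Module.Basis.constr_basis]

variable (k) in
/-- The comultiplication of `k[x]/(x²)` with `x` primitive. -/
noncomputable def dualComul : (Fin 2 → k) →ₗ[k] (Fin 2 → k) ⊗[k] (Fin 2 → k) :=
  (Pi.basisFun k (Fin 2)).constr k
    ![Pi.basisFun k (Fin 2) 0 ⊗ₜ[k] Pi.basisFun k (Fin 2) 0,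
      Pi.basisFun k (Fin 2) 1 ⊗ₜ[k] Pi.basisFun k (Fin 2) 0 +
        Pi.basisFun k (Fin 2) 0 ⊗ₜ[k] Pi.basisFun k (Fin 2) 1]

variable (k) in
/-- The counit of `k[x]/(x²)` mapping `x` to `0`. -/
noncomputable def dualCounit : (Fin 2 → k) →ₗ[k] k :=
  (Pi.basisFun k (Fin 2)).constr k ![1, 0]

variable (k) in
/-- The antipode of `k[x]/(x²)` mapping `x` to `-x`. -/
noncomputable def dualAntipode : (Fin 2 → k) →ₗ[k] (Fin 2 → k) :=
  (Pi.basisFun k (Fin 2)).constr k ![Pi.basisFun k (Fin 2) 0, -Pi.basisFun k (Fin 2) 1]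

lemma dualComul_zero : dualComul k (Pi.basisFun k (Fin 2) 0) =
    Pi.basisFun k (Fin 2) 0 ⊗ₜ[k] Pi.basisFun k (Fin 2) 0 :=
  Module.Basis.constr_basis _ _ _ _

lemma dualComul_one : dualComul k (Pi.basisFun k (Fin 2) 1) =
    Pi.basisFun k (Fin 2) 1 ⊗ₜ[k] Pi.basisFun k (Fin 2) 0 +
      Pi.basisFun k (Fin 2) 0 ⊗ₜ[k] Pi.basisFun k (Fin 2) 1 :=
  Module.Basis.constr_basis _ _ _ _

lemma dualCounit_zero : dualCounit k (Pi.basisFun k (Fin 2) 0) = 1 :=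
  Module.Basis.constr_basis _ _ _ _

lemma dualCounit_one : dualCounit k (Pi.basisFun k (Fin 2) 1) = 0 :=
  Module.Basis.constr_basis _ _ _ _

lemma dualAntipode_zero :
    dualAntipode k (Pi.basisFun k (Fin 2) 0) = Pi.basisFun k (Fin 2) 0 :=
  Module.Basis.constr_basis _ _ _ _

lemma dualAntipode_one :
    dualAntipode k (Pi.basisFun k (Fin 2) 1) = -Pi.basisFun k (Fin 2) 1 :=
  Module.Basis.constr_basis _ _ _ _

/-- The braided Hopf algebra `B_{g,v}`. -/
noncomputable def pairHopf (h : IsYetterDrinfeldPair ω g v) (hv : v g = -1) :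
    BraidedHopf (functionAlgebra ω).toQuasiBialgebra (Fin 2 → k) where
  toYetterDrinfeld := diagonalYetterDrinfeld (isYetterDrinfeldPair_vecCons h)
  mul := dualMul k
  one := Pi.basisFun k (Fin 2) 0
  comul := dualComul k
  counit := dualCounit k
  antipode := dualAntipode k
  one_mul := eq_of_basis (Pi.basisFun k (Fin 2))
    ⟨by intros; simp only [map_add, TensorProduct.tmul_add],
      by intros; simp only [map_smul, TensorProduct.tmul_smul]⟩
    ⟨by intros; rfl, by intros; rfl⟩ fun i => by
      rw [dualMul_basisFun]; fin_cases i <;> rfl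
  mul_one := eq_of_basis (Pi.basisFun k (Fin 2))
    ⟨by intros; simp only [map_add, TensorProduct.add_tmul],
      by intros; simp only [map_smul, ← TensorProduct.smul_tmul']⟩
    ⟨by intros; rfl, by intros; rfl⟩ fun i => by
      rw [dualMul_basisFun]; fin_cases i <;> rfl
  mul_assoc := eq_of_basis (((Pi.basisFun k (Fin 2)).tensorProduct
      (Pi.basisFun k (Fin 2))).tensorProduct (Pi.basisFun k (Fin 2)))
    ⟨by intros; simp only [map_add], by intros; simp only [map_smul]⟩
    ⟨by intros; simp only [map_add], by intros; simp only [map_smul]⟩ <| by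
      rintro ⟨⟨i, j⟩, l⟩
      have he := fun i => (isEigen_diagonalYetterDrinfeld (isYetterDrinfeldPair_vecCons h) i).act
      rw [Module.Basis.tensorProduct_apply, Module.Basis.tensorProduct_apply,
        assoc_apply_of_homogeneous ω (he i) (he j) (he l), LinearMap.rTensor_tmul,
        dualMul_basisFun, map_smul, map_smul, LinearMap.lTensor_tmul, dualMul_basisFun]
      fin_cases i <;> fin_cases j <;> fin_cases l <;>
        simp [dualMul_basisFun, ω.one_left, ω.one_mid, ω.one_right, -Pi.basisFun_apply]
  act_mul φ := eq_of_basis ((Pi.basisFun k (Fin 2)).tensorProduct (Pi.basisFun k (Fin 2)))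
    ⟨by intros; simp only [map_add], by intros; simp only [map_smul]⟩
    ⟨by intros; simp only [map_add], by intros; simp only [map_smul]⟩ <| by
      rintro ⟨i, j⟩
      have he := fun i => (isEigen_diagonalYetterDrinfeld (isYetterDrinfeldPair_vecCons h) i).act
      have h0 := he 0 φ
      have h1 := he 1 φ
      rw [Module.Basis.tensorProduct_apply, isHomogeneous_tensorAct ω (he i) (he j) φ, map_smul,
        dualMul_basisFun]
      fin_cases i <;> fin_cases j <;> simp [h0, h1, -Pi.basisFun_apply]
  act_one := (isEigen_diagonalYetterDrinfeld (isYetterDrinfeldPair_vecCons h) 0).act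
  coact_mul := eq_of_basis ((Pi.basisFun k (Fin 2)).tensorProduct (Pi.basisFun k (Fin 2)))
    ⟨by intros; simp only [map_add], by intros; simp only [map_smul]⟩
    ⟨by intros; simp only [map_add], by intros; simp only [map_smul]⟩ <| by
      rintro ⟨i, j⟩
      have he := isEigen_diagonalYetterDrinfeld (isYetterDrinfeldPair_vecCons h)
      have h0 := (he 0).coact
      have h1 := (he 1).coact
      rw [Module.Basis.tensorProduct_apply, YetterDrinfeld.tensorCoact_apply (he i) (he j),
        LinearMap.lTensor_tmul, dualMul_basisFun]
      fin_cases i <;> fin_cases j <;>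
        simp [h0, h1, ω.one_left, ω.one_mid, ω.one_right, -Pi.basisFun_apply]
      rfl
  coact_one := (isEigen_diagonalYetterDrinfeld (isYetterDrinfeldPair_vecCons h) 0).coact
  counit_comul := eq_of_basis (Pi.basisFun k (Fin 2))
    ⟨by intros; simp only [map_add], by intros; simp only [map_smul]⟩
    ⟨by intros; rfl, by intros; rfl⟩ <| Fin.forall_fin_two.2 ⟨by
      simp [dualComul_zero, dualCounit_zero, -Pi.basisFun_apply], by
      simp [dualComul_one, dualCounit_zero, dualCounit_one, -Pi.basisFun_apply]⟩
  comul_counit := eq_of_basis (Pi.basisFun k (Fin 2))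
    ⟨by intros; simp only [map_add], by intros; simp only [map_smul]⟩
    ⟨by intros; rfl, by intros; rfl⟩ <| Fin.forall_fin_two.2 ⟨by
      simp [dualComul_zero, dualCounit_zero, -Pi.basisFun_apply], by
      simp [dualComul_one, dualCounit_zero, dualCounit_one, -Pi.basisFun_apply]⟩
  comul_assoc := by
    have he := fun i => (isEigen_diagonalYetterDrinfeld (isYetterDrinfeldPair_vecCons h) i).act
    have ha := fun i j l => assoc_apply_of_homogeneous ω (he i) (he j) (he l)
    refine eq_of_basis (Pi.basisFun k (Fin 2))
      ⟨by intros; simp only [map_add], by intros; simp only [map_smul]⟩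
      ⟨by intros; simp only [map_add], by intros; simp only [map_smul]⟩ <|
        Fin.forall_fin_two.2 ⟨?_, ?_⟩
    · simp [dualComul_zero, ha, ω.one_left, -Pi.basisFun_apply]
    · simp [dualComul_zero, dualComul_one, ha, ω.one_left, ω.one_mid,
        TensorProduct.add_tmul, TensorProduct.tmul_add, add_assoc, -Pi.basisFun_apply]
  comul_act φ := by
    have he := fun i => (isEigen_diagonalYetterDrinfeld (isYetterDrinfeldPair_vecCons h) i).act
    have h0 := he 0 φ
    have h1 := he 1 φ
    have ha := fun i j => isHomogeneous_tensorAct ω (he i) (he j) φ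
    refine eq_of_basis (Pi.basisFun k (Fin 2))
      ⟨by intros; simp only [map_add], by intros; simp only [map_smul]⟩
      ⟨by intros; simp only [map_add], by intros; simp only [map_smul]⟩ <|
        Fin.forall_fin_two.2 ⟨?_, ?_⟩
    · simp [h0, dualComul_zero, ha, -Pi.basisFun_apply]
    · simp [h1, dualComul_one, ha, -Pi.basisFun_apply]
  counit_act φ := by
    have he := fun i => (isEigen_diagonalYetterDrinfeld (isYetterDrinfeldPair_vecCons h) i).act
    have h0 := he 0 φ
    have h1 := he 1 φ
    refine eq_of_basis (Pi.basisFun k (Fin 2))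
      ⟨by intros; simp only [map_add], by intros; simp only [map_smul]⟩
      ⟨by intros; simp only [map_add, mul_add],
        by intros; simp only [map_smul, smul_eq_mul, mul_left_comm]⟩ <|
        Fin.forall_fin_two.2 ⟨?_, ?_⟩
    · simp [h0, dualCounit_zero, functionAlgebra, -Pi.basisFun_apply]
    · simp [h1, dualCounit_one, -Pi.basisFun_apply]
  coact_comul := by
    have he := isEigen_diagonalYetterDrinfeld (isYetterDrinfeldPair_vecCons h)
    have h0 := (he 0).coact
    have h1 := (he 1).coact
    have ha := fun i j => YetterDrinfeld.tensorCoact_apply (he i) (he j)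
    refine eq_of_basis (Pi.basisFun k (Fin 2))
      ⟨by intros; simp only [map_add], by intros; simp only [map_smul]⟩
      ⟨by intros; simp only [map_add], by intros; simp only [map_smul]⟩ <|
        Fin.forall_fin_two.2 ⟨?_, ?_⟩
    · simp [h0, dualComul_zero, ha, ω.one_left, ω.one_right, -Pi.basisFun_apply]
      rfl
    · simp [h1, dualComul_one, ha, ω.one_left, ω.one_mid, ω.one_right, TensorProduct.tmul_add,
        -Pi.basisFun_apply]
  coact_counit := by
    have he := isEigen_diagonalYetterDrinfeld (isYetterDrinfeldPair_vecCons h)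
    have h0 := (he 0).coact
    have h1 := (he 1).coact
    refine eq_of_basis (Pi.basisFun k (Fin 2))
      ⟨by intros; simp only [map_add], by intros; simp only [map_smul]⟩
      ⟨by intros; simp only [map_add, add_smul],
        by intros; simp only [map_smul, smul_assoc]⟩ <|
        Fin.forall_fin_two.2 ⟨?_, ?_⟩
    · simp [h0, dualCounit_zero, -Pi.basisFun_apply]
    · simp [h1, dualCounit_one, -Pi.basisFun_apply]
  comul_one := dualComul_zero
  counit_one := dualCounit_zero
  comul_mul := by
    have he := isEigen_diagonalYetterDrinfeld (isYetterDrinfeldPair_vecCons h)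
    have ha := fun i j l t => YetterDrinfeld.tensorMul_apply (dualMul k) (he i).act (he j)
      (he l).act (he t).act
    refine eq_of_basis ((Pi.basisFun k (Fin 2)).tensorProduct (Pi.basisFun k (Fin 2)))
      ⟨by intros; simp only [map_add], by intros; simp only [map_smul]⟩
      ⟨by intros; simp only [map_add], by intros; simp only [map_smul]⟩ ?_
    rintro ⟨i, j⟩
    rw [Module.Basis.tensorProduct_apply, dualMul_basisFun]
    fin_cases i <;> fin_cases j <;>
      simp [dualComul_zero, dualComul_one, ha, dualMul_basisFun, hv, h.map_one,
        ω.one_left, ω.one_mid, ω.one_right, TensorProduct.add_tmul, TensorProduct.tmul_add,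
        -Pi.basisFun_apply]
    -- This is the product of `x` with itself: `Δ(x)² = (1 + v g) x ⊗ x` must vanish because `x² =
    -- 0`, and it does so because `v g = -1`.
    rw [TensorProduct.smul_tmul', neg_smul, one_smul, ← TensorProduct.add_tmul, neg_add_cancel,
      TensorProduct.zero_tmul]
  counit_mul b := eq_of_basis (Pi.basisFun k (Fin 2))
    ⟨by intros; simp only [map_add, TensorProduct.tmul_add],
      by intros; simp only [map_smul, TensorProduct.tmul_smul]⟩
    ⟨by intros; simp only [map_add, mul_add],
      by intros; simp only [map_smul, smul_eq_mul, mul_left_comm]⟩ fun j => by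
      revert b
      refine eq_of_basis (Pi.basisFun k (Fin 2))
        ⟨by intros; simp only [map_add, TensorProduct.add_tmul],
          by intros; simp only [map_smul, ← TensorProduct.smul_tmul']⟩
        ⟨by intros; simp only [map_add, add_mul],
          by intros; simp only [map_smul, smul_eq_mul, mul_assoc]⟩ fun i => ?_
      rw [dualMul_basisFun]
      fin_cases i <;> fin_cases j <;> simp [dualCounit_zero, dualCounit_one, -Pi.basisFun_apply]
  antipode_act φ := by
    have he := fun i => (isEigen_diagonalYetterDrinfeld (isYetterDrinfeldPair_vecCons h) i).act
    have h0 := he 0 φ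
    have h1 := he 1 φ
    refine eq_of_basis (Pi.basisFun k (Fin 2))
      ⟨by intros; simp only [map_add], by intros; simp only [map_smul]⟩
      ⟨by intros; simp only [map_add], by intros; simp only [map_smul]⟩ <|
        Fin.forall_fin_two.2 ⟨?_, ?_⟩
    · simp [h0, dualAntipode_zero, -Pi.basisFun_apply]
    · simp [h1, dualAntipode_one, -Pi.basisFun_apply]
  coact_antipode := by
    have he := isEigen_diagonalYetterDrinfeld (isYetterDrinfeldPair_vecCons h)
    have h0 := (he 0).coact
    have h1 := (he 1).coact
    refine eq_of_basis (Pi.basisFun k (Fin 2))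
      ⟨by intros; simp only [map_add], by intros; simp only [map_smul]⟩
      ⟨by intros; simp only [map_add], by intros; simp only [map_smul]⟩ <|
        Fin.forall_fin_two.2 ⟨?_, ?_⟩
    · simp [h0, dualAntipode_zero, -Pi.basisFun_apply]
    · simp [h1, dualAntipode_one, TensorProduct.tmul_neg, -Pi.basisFun_apply]
  antipode_left := eq_of_basis (Pi.basisFun k (Fin 2))
    ⟨by intros; simp only [map_add], by intros; simp only [map_smul]⟩
    ⟨by intros; simp only [map_add, add_smul],
      by intros; simp only [map_smul, smul_assoc]⟩ <| Fin.forall_fin_two.2 ⟨by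
      simp [dualComul_zero, dualAntipode_zero, dualCounit_zero, dualMul_basisFun,
        -Pi.basisFun_apply], by
      simp [dualComul_one, dualAntipode_zero, dualAntipode_one, dualCounit_one, dualMul_basisFun,
        TensorProduct.neg_tmul, -Pi.basisFun_apply]⟩
  antipode_right := eq_of_basis (Pi.basisFun k (Fin 2))
    ⟨by intros; simp only [map_add], by intros; simp only [map_smul]⟩
    ⟨by intros; simp only [map_add, add_smul],
      by intros; simp only [map_smul, smul_assoc]⟩ <| Fin.forall_fin_two.2 ⟨by
      simp [dualComul_zero, dualAntipode_zero, dualCounit_zero, dualMul_basisFun,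
        -Pi.basisFun_apply], by
      simp [dualComul_one, dualAntipode_zero, dualAntipode_one, dualCounit_one, dualMul_basisFun,
        TensorProduct.tmul_neg, -Pi.basisFun_apply]⟩

end Construction

/-! ### Classification of the two-dimensional braided Hopf algebras over `k^G_ω` -/

namespace BraidedHopf

section General

variable {k H B : Type*} [Field k] [Ring H] [Algebra k H] {Q : QuasiBialgebra k H}
  [AddCommGroup B] [Module k B] (X : BraidedHopf Q B)

lemma linearIndependent_one {x : B} (hx : x ≠ 0) (hc : X.counit x = 0) :
    LinearIndependent k ![X.one, x] := by
  rw [LinearIndependent.pair_iff]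
  intro s t h
  have hs : s = 0 := by
    have := congrArg X.counit h
    simpa [X.counit_one, hc] using this
  subst hs
  exact ⟨rfl, by simpa [hx] using h⟩

/-- The unit splits the counit, so its kernel is a line. -/
lemma exists_spanning (h2 : Module.finrank k B = 2) :
    ∃ x : B, x ≠ 0 ∧ X.counit x = 0 ∧ ∀ b : B, ∃ d : k, b = X.counit b • X.one + d • x := by
  have : FiniteDimensional k B := Module.finite_of_finrank_pos (by omega)
  have hr : LinearMap.range X.counit = ⊤ := by
    rw [LinearMap.range_eq_top]
    exact fun c => ⟨c • X.one, by simp [X.counit_one]⟩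
  have h1 := LinearMap.finrank_range_add_finrank_ker X.counit
  rw [h2, hr, finrank_top, Module.finrank_self] at h1
  obtain ⟨⟨x, hx⟩, hx0, hs⟩ := finrank_eq_one_iff'.1 (show Module.finrank k X.counit.ker = 1 by omega)
  refine ⟨x, fun h => hx0 (by simpa using h), hx, fun b => ?_⟩
  obtain ⟨d, hd⟩ := hs ⟨b - X.counit b • X.one, by simp [X.counit_one]⟩
  refine ⟨d, ?_⟩
  have := congrArg Subtype.val hd
  simp only [SetLike.mk_smul_mk] at this
  rw [this]
  abel

variable {x : B} (hx : x ≠ 0) (hc : X.counit x = 0)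
  (hs : ∀ b : B, ∃ d : k, b = X.counit b • X.one + d • x)

include hs in
lemma span_eq_top : Submodule.span k {X.one, x} = ⊤ := by
  rw [eq_top_iff]
  intro b _
  obtain ⟨d, hd⟩ := hs b
  exact Submodule.mem_span_pair.2 ⟨_, _, hd.symm⟩

lemma antipode_map_one : X.antipode X.one = X.one := by
  have := X.antipode_left X.one
  rwa [X.comul_one, LinearMap.rTensor_tmul, X.mul_one, X.counit_one, one_smul] at this

/-- The basis `{1, x}` of a two-dimensional braided Hopf algebra. -/
noncomputable def basisOne : Module.Basis (Fin 2) k B :=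
  Module.Basis.mk (X.linearIndependent_one hx hc) (by
    rw [Matrix.range_cons, Matrix.range_cons, Matrix.range_empty, Set.union_empty,
      Set.singleton_union, X.span_eq_top hs])

lemma basisOne_zero : X.basisOne hx hc hs 0 = X.one := by simp [basisOne]

lemma basisOne_one : X.basisOne hx hc hs 1 = x := by simp [basisOne]

include hx hc hs in
-- The functional reading off the coefficient of `x`; applying it to the axioms turns them into
-- equations between scalars.
lemma exists_coord : ∃ δ : B →ₗ[k] k, δ X.one = 0 ∧ δ x = 1 := by
  refine ⟨(X.basisOne hx hc hs).coord 1, ?_, ?_⟩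
  · rw [← X.basisOne_zero hx hc hs, Module.Basis.coord_apply, Module.Basis.repr_self,
      Finsupp.single_eq_of_ne (by decide)]
  · have h := X.basisOne_one hx hc hs
    generalize X.basisOne hx hc hs = β at h ⊢
    rw [← h, Module.Basis.coord_apply, Module.Basis.repr_self, Finsupp.single_eq_same]

include hx hc hs in
-- The counit axioms fix every coefficient of `Δ(x)` except the one of `x ⊗ x`: that of `1 ⊗ 1` is
-- `0` and the mixed ones are `1`.
lemma exists_comul_eq :
    ∃ b : k, X.comul x = x ⊗ₜ[k] X.one + X.one ⊗ₜ[k] x + b • (x ⊗ₜ[k] x) := by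
  obtain ⟨δ, h0, h1⟩ := X.exists_coord hx hc hs
  have h := ((X.basisOne hx hc hs).tensorProduct (X.basisOne hx hc hs)).sum_repr (X.comul x)
  simp only [Fintype.sum_prod_type, Fin.sum_univ_two, Module.Basis.tensorProduct_apply,
    basisOne_zero, basisOne_one] at h
  have hl := X.counit_comul x
  have hr := X.comul_counit x
  rw [← h] at hl hr ⊢
  set c := ((X.basisOne hx hc hs).tensorProduct (X.basisOne hx hc hs)).repr (X.comul x)
  simp only [map_add, map_smul, LinearMap.rTensor_tmul, LinearMap.lTensor_tmul, X.counit_one, hc,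
    TensorProduct.lid_tmul, TensorProduct.rid_tmul, one_smul, zero_smul, smul_zero, add_zero] at hl hr
  have e1 := congrArg X.counit hl
  have e2 := congrArg δ hl
  have e3 := congrArg δ hr
  simp only [map_add, map_smul, X.counit_one, hc, h0, h1, smul_eq_mul, _root_.mul_one, mul_zero, add_zero,
    zero_add] at e1 e2 e3
  refine ⟨c (1, 1), ?_⟩
  rw [e1, e2, e3]
  module

end General

section Group

variable {k : Type u} {G : Type w} [Field k] [CommGroup G] [Fintype G] [DecidableEq G]
  {ω : NormalizedCocycle₃ G k} {B : Type*} [AddCommGroup B] [Module k B]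
  (X : BraidedHopf (functionAlgebra ω).toQuasiBialgebra B)

/-- The structure of a two-dimensional braided Hopf algebra in a basis `{1, x}` with `x` in the
kernel of the counit. -/
structure IsPresentation (x : B) (g : G) (v : G → k) (a b q : k) : Prop where
  ne_zero : x ≠ 0
  counit : X.counit x = 0
  spanning : ∀ y : B, ∃ d : k, y = X.counit y • X.one + d • x
  eigen : X.IsEigen g v x
  mul : X.mul (x ⊗ₜ[k] x) = a • x
  comul : X.comul x = x ⊗ₜ[k] X.one + X.one ⊗ₜ[k] x + b • (x ⊗ₜ[k] x)
  antipode : X.antipode x = q • x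

lemma isEigen_one : X.IsEigen 1 1 X.one := ⟨X.act_one, X.coact_one⟩

/-- The counit is a morphism. Its linearity makes the kernel stable under the action, which is
therefore a character of `k^G`, that is, an evaluation. Its colinearity kills the component of the
coaction of `x` along the unit. -/
lemma exists_isEigen {x : B} (hx : x ≠ 0) (hc : X.counit x = 0)
    (hs : ∀ b : B, ∃ d : k, b = X.counit b • X.one + d • x) :
    ∃ (g : G) (v : G → k), X.IsEigen g v x := by
  have hl : ∀ φ : G → k, ∃ d : k, X.act φ x = d • x := fun φ => by
    obtain ⟨d, hd⟩ := hs (X.act φ x)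
    rw [X.counit_act, hc, mul_zero, zero_smul, zero_add] at hd
    exact ⟨d, hd⟩
  choose σ hσ using hl
  have hi := smul_left_injective k hx
  obtain ⟨g, hg⟩ := exists_eq_eval (AlgHom.ofLinearMap
    ({ toFun := σ
       map_add' := fun φ ψ => hi (by simp only [add_smul, ← hσ, map_add, LinearMap.add_apply])
       map_smul' := fun c φ => hi (by
        simp only [smul_assoc, ← hσ, map_smul, LinearMap.smul_apply, RingHom.id_apply]) } :
      (G → k) →ₗ[k] k)
    (hi (by
      simp only [LinearMap.coe_mk, AddHom.coe_mk, ← hσ, map_one, Module.End.one_apply, one_smul]))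
    (fun φ ψ => hi (by
      simp only [LinearMap.coe_mk, AddHom.coe_mk, ← hσ, map_mul, Module.End.mul_apply]
      rw [hσ ψ, map_smul, hσ φ, smul_smul, mul_comm])))
  obtain ⟨f, hf⟩ := TensorProduct.eq_repr_basis_right (X.basisOne hx hc hs) (X.coact x)
  rw [Finsupp.sum_fintype _ _ (by simp), Fin.sum_univ_two, basisOne_zero, basisOne_one] at hf
  have h0 := X.coact_counit x
  rw [← hf, hc] at h0
  simp only [map_add, LinearMap.lTensor_tmul, X.counit_one, hc, TensorProduct.tmul_zero, add_zero,
    TensorProduct.rid_tmul, one_smul, zero_smul] at h0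
  refine ⟨g, f 1, fun φ => ?_, ?_⟩
  · rw [hσ φ, ← hg φ]
    rfl
  · rw [← hf, h0, TensorProduct.zero_tmul, zero_add]

lemma exists_isPresentation (h2 : Module.finrank k B = 2) :
    ∃ (x : B) (g : G) (v : G → k) (a b q : k), X.IsPresentation x g v a b q := by
  obtain ⟨x, hx, hc, hs⟩ := X.exists_spanning h2
  obtain ⟨g, v, he⟩ := X.exists_isEigen hx hc hs
  obtain ⟨b, hb⟩ := X.exists_comul_eq hx hc hs
  obtain ⟨a, ha⟩ := hs (X.mul (x ⊗ₜ[k] x))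
  rw [X.counit_mul, hc, mul_zero, zero_smul, zero_add] at ha
  -- Apply the counit to `S(x) + x + b S(x) x = 0`.
  have hS : X.counit (X.antipode x) = 0 := by
    have := congrArg X.counit (X.antipode_left x)
    simpa only [hb, hc, map_add, map_smul, LinearMap.rTensor_tmul, X.antipode_map_one, X.mul_one,
      X.one_mul, X.counit_mul, mul_zero, smul_zero, zero_smul, add_zero, map_zero] using this
  obtain ⟨q, hq⟩ := hs (X.antipode x)
  rw [hS, zero_smul, zero_add] at hq
  exact ⟨x, g, v, a, b, q, hx, hc, hs, he, ha, hb, hq⟩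

variable {X} {x : B} {g : G} {v : G → k} {a b q : k}

lemma tensorMul_apply_of_eigen_one {p q r s : B} (hp : X.IsEigen 1 1 p) (hq : X.IsEigen 1 1 q)
    (hr : X.IsEigen 1 1 r) (hs : X.IsEigen 1 1 s) :
    X.tensorMul X.mul ((p ⊗ₜ[k] q) ⊗ₜ[k] (r ⊗ₜ[k] s)) =
      X.mul (p ⊗ₜ[k] r) ⊗ₜ[k] X.mul (q ⊗ₜ[k] s) := by
  rw [YetterDrinfeld.tensorMul_apply X.mul hp.act hq hr.act hs.act]
  simp [ω.one_left]

namespace IsPresentation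

variable (h : X.IsPresentation x g v a b q)

include h

lemma isYetterDrinfeldPair : IsYetterDrinfeldPair ω g v := h.eigen.isYetterDrinfeldPair h.ne_zero

lemma exists_coord : ∃ δ : B →ₗ[k] k, δ X.one = 0 ∧ δ x = 1 :=
  X.exists_coord h.ne_zero h.counit h.spanning

/-- This is the coefficient of `x` in the left antipode axiom. It shows in particular that `1 + ab`
is invertible. -/
lemma antipode_eq : q * (1 + a * b) = -1 := by
  obtain ⟨δ, h0, h1⟩ := h.exists_coord
  have := congrArg δ (X.antipode_left x)
  simp only [h.comul, map_add, map_smul, LinearMap.rTensor_tmul, X.antipode_map_one, X.mul_one,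
    X.one_mul, h.antipode, ← TensorProduct.smul_tmul', h.mul, h1, h.counit, zero_smul, map_zero,
    smul_eq_mul] at this
  linear_combination this

/-- Both `x ⊗ x` and its product have degree `g²`, while `a x` and `Δ(x)` have degree `g`. So a
nonzero `a` or `b` forces `g² = g`, detected on the characteristic function of `g`. -/
lemma degree_eq_one (hab : a ≠ 0 ∨ b ≠ 0) : g = 1 := by
  obtain ⟨δ, h0, h1⟩ := h.exists_coord
  suffices ∀ φ : G → k, φ g = φ (g * g) by
    have := this (Pi.single g 1)
    by_contra hg
    rw [Pi.single_eq_same, Pi.single_eq_of_ne (by simpa using hg)] at this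
    exact one_ne_zero this
  intro φ
  rcases hab with ha | hb
  · have := congrArg δ (X.act_mul φ (x ⊗ₜ[k] x))
    rw [isHomogeneous_tensorAct ω h.eigen.act h.eigen.act φ, map_smul, h.mul, map_smul,
      h.eigen.act φ] at this
    simp only [map_smul, h1, smul_eq_mul, _root_.mul_one] at this
    exact mul_left_cancel₀ ha (by linear_combination this)
  · have := congrArg (LinearMap.mul' k k ∘ₗ TensorProduct.map δ δ) (X.comul_act φ x)
    simp only [h.eigen.act φ, h.comul, isHomogeneous_tensorAct ω h.eigen.act h.eigen.act φ,
      isHomogeneous_tensorAct ω h.eigen.act X.isEigen_one.act φ,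
      isHomogeneous_tensorAct ω X.isEigen_one.act h.eigen.act φ, LinearMap.comp_apply, map_add, map_smul, TensorProduct.map_tmul, h0, h1,
      LinearMap.mul'_apply, smul_eq_mul, _root_.mul_one, mul_zero, zero_add] at this
    exact mul_left_cancel₀ hb (by linear_combination this)

/-- The same comparison for coactions: once `g = 1`, the coaction of `x ⊗ x` is given by `v²`, so `v
= v²`, and `v` has no zeros. -/
lemma weight_eq_one (hab : a ≠ 0 ∨ b ≠ 0) : v = 1 := by
  obtain ⟨δ, h0, h1⟩ := h.exists_coord
  have hg := h.degree_eq_one hab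
  subst hg
  have hxx := YetterDrinfeld.tensorCoact_apply h.eigen h.eigen
  simp only [ω.one_left, ω.one_mid, Units.val_one, _root_.one_mul, _root_.mul_one, inv_one] at hxx
  suffices ∀ y, v y = v y * v y by
    ext y
    exact mul_left_cancel₀ (h.isYetterDrinfeldPair.ne_zero y)
      ((this y).symm.trans (_root_.mul_one _).symm)
  intro y
  rcases hab with ha | hb
  · have := congrArg (fun t => δ (evalₗ k B y t)) (X.coact_mul (x ⊗ₜ[k] x))
    simp only [hxx, h.mul, LinearMap.lTensor_tmul, map_smul, h.eigen.coact, evalₗ_tmul, h1,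
      smul_eq_mul, _root_.mul_one] at this
    exact mul_left_cancel₀ ha (by linear_combination this)
  · have := congrArg (fun t => (LinearMap.mul' k k ∘ₗ TensorProduct.map δ δ) (evalₗ k _ y t))
      (X.coact_comul x)
    simp only [h.comul, h.eigen.coact, hxx, map_add, map_smul,
      YetterDrinfeld.tensorCoact_apply X.isEigen_one h.eigen,
      YetterDrinfeld.tensorCoact_apply h.eigen X.isEigen_one,
      LinearMap.lTensor_tmul, evalₗ_tmul, LinearMap.comp_apply, TensorProduct.map_tmul, h0, h1,
      LinearMap.mul'_apply, smul_eq_mul, _root_.mul_one, mul_zero, zero_add] at this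
    exact mul_left_cancel₀ hb (by linear_combination -this)

/-- Compare the coefficients of `x ⊗ x` in `Δ(x²) = Δ(x)²`: the left side is zero and the right side
is `1 + v g`. -/
lemma weight_degree_eq (ha : a = 0) (hb : b = 0) : v g = -1 := by
  obtain ⟨δ, h0, h1⟩ := h.exists_coord
  have hx := h.eigen
  have ho := X.isEigen_one
  have e1 := YetterDrinfeld.tensorMul_apply X.mul hx.act ho hx.act ho.act
  have e2 := YetterDrinfeld.tensorMul_apply X.mul hx.act ho ho.act hx.act
  have e3 := YetterDrinfeld.tensorMul_apply X.mul ho.act hx hx.act ho.act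
  have e4 := YetterDrinfeld.tensorMul_apply X.mul ho.act hx ho.act hx.act
  have := congrArg (LinearMap.mul' k k ∘ₗ TensorProduct.map δ δ) (X.comul_mul (x ⊗ₜ[k] x))
  simp only [h.mul, h.comul, ha, hb, zero_smul, map_zero, add_zero, TensorProduct.map_tmul,
    TensorProduct.add_tmul, TensorProduct.tmul_add, map_add, e1, e2, e3, e4, X.mul_one, X.one_mul,
    TensorProduct.zero_tmul, TensorProduct.tmul_zero, smul_zero, zero_add, map_smul,
    LinearMap.comp_apply, LinearMap.mul'_apply, h1, ω.one_left, ω.one_mid, ω.one_right,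
    Units.val_one, inv_one, _root_.one_mul, _root_.mul_one, smul_eq_mul, Pi.one_apply,
    h.isYetterDrinfeldPair.map_one] at this
  linear_combination -this

/-- With trivial braiding and associator, the coefficient of `x ⊗ x` in `Δ(x²) = Δ(x)²` is `ab = 2 +
4ab + (ab)²`. The root `ab = -1` makes `1 + b x` a group-like idempotent, which the antipode rules
out. -/
lemma mul_coeff_eq (hab : a ≠ 0 ∨ b ≠ 0) : a * b = -2 := by
  obtain ⟨δ, h0, h1⟩ := h.exists_coord
  have hg := h.degree_eq_one hab
  have hv := h.weight_eq_one hab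
  subst hg hv
  have hx := h.eigen
  have ho := X.isEigen_one
  have := congrArg (LinearMap.mul' k k ∘ₗ TensorProduct.map δ δ) (X.comul_mul (x ⊗ₜ[k] x))
  simp only [h.mul, h.comul, TensorProduct.map_tmul, TensorProduct.add_tmul,
    TensorProduct.tmul_add, ← TensorProduct.smul_tmul', TensorProduct.tmul_smul, map_add, map_smul,
    tensorMul_apply_of_eigen_one, hx, ho, X.mul_one, X.one_mul, LinearMap.comp_apply,
    LinearMap.mul'_apply, h0, h1, smul_eq_mul, _root_.mul_one, mul_zero, zero_add, add_zero] at this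
  have hq := h.antipode_eq
  have h3 : (a * b + 1) * (a * b + 2) = 0 := by linear_combination -this
  rcases mul_eq_zero.1 h3 with h4 | h4
  · exact absurd (show (1 : k) = 0 by linear_combination hq - q * h4) one_ne_zero
  · linear_combination h4

/-- From `ab = -2` and `2 ≠ 0` one gets `b ≠ 0`, and `u = 1 + b x` satisfies `u² = 1` and `Δ(u) = u
⊗ u`; it becomes the generator of `C₂`. -/
lemma isTrivial (hk : (2 : k) ≠ 0) (hab : a ≠ 0 ∨ b ≠ 0) : X.IsTrivial := by
  have hm := h.mul_coeff_eq hab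
  have hq := h.antipode_eq
  have hg := h.degree_eq_one hab
  have hv := h.weight_eq_one hab
  subst hg hv
  have hb : b ≠ 0 := by
    rintro rfl
    exact hk (by linear_combination hm)
  obtain rfl : q = 1 := by linear_combination q * hm - hq
  set β := X.basisOne h.ne_zero h.counit h.spanning with hβ
  have hβ0 : β 0 = X.one := X.basisOne_zero _ _ _
  have hβ1 : β 1 = x := X.basisOne_one _ _ _
  -- Rescaling `x` by `b` normalizes the comultiplication coefficient to `1` and the product to `y²
  -- = -2y`.
  have hu : X.IsPresentation (b • x) 1 1 (b * a) 1 1 :=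
    { ne_zero := smul_ne_zero hb h.ne_zero
      counit := by rw [map_smul, h.counit, smul_zero]
      spanning := fun y => by
        obtain ⟨d, hd⟩ := h.spanning y
        exact ⟨d * b⁻¹, by rw [smul_smul, inv_mul_cancel_right₀ hb, ← hd]⟩
      eigen := ⟨h.eigen.act.smul b, by rw [map_smul, h.eigen.coact, TensorProduct.tmul_smul]⟩
      mul := by
        rw [TensorProduct.smul_tmul_smul, map_smul, h.mul, smul_smul, smul_smul]
        congr 1
        ring
      comul := by
        rw [map_smul, h.comul, one_smul, TensorProduct.smul_tmul_smul, smul_add, smul_add,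
          smul_smul, TensorProduct.smul_tmul', TensorProduct.tmul_smul]
      antipode := by rw [map_smul, h.antipode, one_smul, one_smul] }
  have hba : b * a = -2 := by rw [mul_comm, hm]
  rw [hba] at hu
  clear_value β
  clear hm hq
  set y := b • x with hy
  clear_value y
  clear h hβ hβ0 hβ1 β hy
  have hgl : ∀ u : B, u = X.one + y → LinearIndependent k ![X.one, u] ∧
      Submodule.span k {X.one, u} = ⊤ := by
    rintro u rfl
    refine ⟨?_, ?_⟩
    · have h3 := X.linearIndependent_one hu.ne_zero hu.counit
      rw [LinearIndependent.pair_iff] at h3 ⊢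
      intro s t hst
      have := h3 (s + t) t (by rw [← hst]; module)
      exact ⟨by simpa [this.2] using this.1, this.2⟩
    · rw [eq_top_iff]
      intro z _
      obtain ⟨d, hd⟩ := hu.spanning z
      refine Submodule.mem_span_pair.2 ⟨X.counit z - d, d, ?_⟩
      conv_rhs => rw [hd]
      module
  obtain ⟨u, hu'⟩ : ∃ u, u = X.one + y := ⟨_, rfl⟩
  obtain ⟨hl, hs⟩ := hgl u hu'
  have act_u : X.IsEigen 1 1 u := ⟨fun φ => by
    rw [hu', map_add, hu.eigen.act φ, X.isEigen_one.act φ, smul_add], by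
    rw [hu', map_add, hu.eigen.coact, X.coact_one, TensorProduct.tmul_add]⟩
  have mul_u : X.mul (u ⊗ₜ[k] u) = X.one := by
    simp only [hu', TensorProduct.tmul_add, map_add, X.mul_one, TensorProduct.add_tmul, X.one_mul,
      hu.mul]
    module
  have comul_u : X.comul u = u ⊗ₜ[k] u := by
    simp only [hu', TensorProduct.tmul_add, map_add, TensorProduct.add_tmul, hu.comul, X.comul_one,
      one_smul]
    abel
  have counit_u : X.counit u = 1 := by rw [hu', map_add, hu.counit, X.counit_one, add_zero]
  have antipode_u : X.antipode u = u := by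
    rw [hu', map_add, hu.antipode, X.antipode_map_one, one_smul]
  let β : Module.Basis (Fin 2) k B := Module.Basis.mk hl (by
    rw [Matrix.range_cons, Matrix.range_cons, Matrix.range_empty, Set.union_empty,
      Set.singleton_union, hs])
  have hβ0 : β 0 = X.one := by simp [β]
  have hβ1 : β 1 = u := by simp [β]
  -- `ZMod 2` unfolds to `Fin 2`, so the group elements themselves index this basis.
  let γ : Module.Basis (Fin 2) k (MonoidAlgebra k (Multiplicative (ZMod 2))) :=
    (MonoidAlgebra.basis (Multiplicative (ZMod 2)) k).reindex Multiplicative.toAdd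
  have hγ : ∀ i, γ i = MonoidAlgebra.single (Multiplicative.ofAdd i) 1 := fun i =>
    (Module.Basis.reindex_apply _ _ _).trans (MonoidAlgebra.basis_apply _ _)
  have he0 : β.equiv γ (Equiv.refl _) X.one = 1 := by
    rw [← hβ0, Module.Basis.equiv_apply, hγ]
    rfl
  have he1 : β.equiv γ (Equiv.refl _) u =
      MonoidAlgebra.single (Multiplicative.ofAdd (1 : ZMod 2)) 1 := by
    rw [← hβ1, Module.Basis.equiv_apply, hγ]
    rfl
  have h11 : Multiplicative.ofAdd (1 : ZMod 2) * Multiplicative.ofAdd (1 : ZMod 2) = 1 := by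
    decide
  have h1i : (Multiplicative.ofAdd (1 : ZMod 2))⁻¹ = Multiplicative.ofAdd (1 : ZMod 2) := by
    decide
  refine ⟨fun φ => ?_, ?_, β.equiv γ (Equiv.refl _), fun z w => ?_, he0, ?_, ?_, ?_⟩
  · refine eq_of_basis β ⟨by intros; simp only [map_add], by intros; simp only [map_smul]⟩
      ⟨by intros; simp only [smul_add], by intros; rw [smul_comm]⟩ (Fin.forall_fin_two.2 ⟨?_, ?_⟩)
    · rw [hβ0]
      exact X.act_one φ
    · rw [hβ1]
      exact act_u.act φ
  · refine eq_of_basis β ⟨by intros; simp only [map_add], by intros; simp only [map_smul]⟩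
      ⟨by intros; simp only [TensorProduct.tmul_add], by intros; simp only [TensorProduct.tmul_smul]⟩
      (Fin.forall_fin_two.2 ⟨?_, ?_⟩)
    · rw [hβ0, X.coact_one]
    · rw [hβ1, act_u.coact]
  · revert z
    refine eq_of_basis β
      ⟨by intros; simp only [map_add, TensorProduct.add_tmul],
        by intros; simp only [map_smul, ← TensorProduct.smul_tmul']⟩
      ⟨by intros; simp only [map_add, add_mul], by intros; simp only [map_smul, smul_mul_assoc]⟩
      (Fin.forall_fin_two.2 ⟨?_, ?_⟩)
    · rw [hβ0, X.one_mul, he0, _root_.one_mul]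
    · rw [hβ1]
      revert w
      refine eq_of_basis β
        ⟨by intros; simp only [map_add, TensorProduct.tmul_add],
          by intros; simp only [map_smul, TensorProduct.tmul_smul]⟩
        ⟨by intros; simp only [map_add, mul_add], by intros; simp only [map_smul, mul_smul_comm]⟩
        (Fin.forall_fin_two.2 ⟨?_, ?_⟩)
      · rw [hβ0, X.mul_one, he0, _root_.mul_one]
      · rw [hβ1, mul_u, he0, he1, MonoidAlgebra.single_mul_single, h11, _root_.mul_one]
        rfl
  · refine eq_of_basis β ⟨by intros; simp only [map_add], by intros; simp only [map_smul]⟩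
      ⟨by intros; simp only [map_add], by intros; simp only [map_smul]⟩
      (Fin.forall_fin_two.2 ⟨?_, ?_⟩)
    · rw [hβ0, he0, X.comul_one, TensorProduct.map_tmul, LinearEquiv.coe_coe, he0]
      simp [Algebra.TensorProduct.one_def]
    · rw [hβ1, he1, comul_u, TensorProduct.map_tmul, LinearEquiv.coe_coe, he1]
      simp
  · refine eq_of_basis β ⟨by intros; simp only [map_add], by intros; simp only [map_smul]⟩
      ⟨by intros; simp only [map_add], by intros; simp only [map_smul]⟩
      (Fin.forall_fin_two.2 ⟨?_, ?_⟩)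
    · rw [hβ0, he0, X.counit_one]
      simp
    · rw [hβ1, he1, counit_u]
      simp
  · refine eq_of_basis β ⟨by intros; simp only [map_add], by intros; simp only [map_smul]⟩
      ⟨by intros; simp only [map_add], by intros; simp only [map_smul]⟩
      (Fin.forall_fin_two.2 ⟨?_, ?_⟩)
    · rw [hβ0, X.antipode_map_one, he0]
      simp
    · rw [hβ1, antipode_u, he1]
      simp [h1i]

end IsPresentation

variable (X) in
/-- A non-trivial two-dimensional braided Hopf algebra is isomorphic to some `B_{g,v}`. -/
theorem exists_isB (hk : (2 : k) ≠ 0) (h2 : Module.finrank k B = 2) (ht : ¬ X.IsTrivial) :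
    ∃ (g : G) (v : G → k), IsYetterDrinfeldPair ω g v ∧ v g = -1 ∧
      X.IsB (Pi.evalAlgHom k (fun _ : G => k) g) v := by
  obtain ⟨x, g, v, a, b, q, h⟩ := X.exists_isPresentation h2
  have hab : a = 0 ∧ b = 0 := by
    by_contra hab
    exact ht (h.isTrivial hk (by tauto))
  obtain ⟨rfl, rfl⟩ := hab
  have hq := h.antipode_eq
  obtain rfl : q = -1 := by linear_combination hq
  refine ⟨g, v, h.isYetterDrinfeldPair, h.weight_degree_eq rfl rfl, x,
    X.linearIndependent_one h.ne_zero h.counit, X.span_eq_top h.spanning, h.eigen.act,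
    h.eigen.coact, ?_, ?_, h.counit, ?_⟩
  · rw [h.mul, zero_smul]
  · rw [h.comul, zero_smul, add_zero]
  · rw [h.antipode, neg_smul, one_smul]

end Group

end BraidedHopf

/-! ### Isomorphism classes -/

namespace BraidedHopf

section General

variable {k H B B' : Type*} [Field k] [Ring H] [Algebra k H] {Q : QuasiBialgebra k H}
  [AddCommGroup B] [Module k B] [AddCommGroup B'] [Module k B'] {X : BraidedHopf Q B}
  {X' : BraidedHopf Q B'} {σ : H →ₐ[k] k} {v : H}

lemma IsB.of_isIso (h : X.IsB σ v) {e : B ≃ₗ[k] B'} (he : X.IsIso X' e) : X'.IsB σ v := by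
  obtain ⟨x, hl, hs, ha, hc, hm, hd, hε, hS⟩ := h
  refine ⟨e x, ?_, ?_, fun φ => ?_, ?_, ?_, ?_, ?_, ?_⟩
  · have := hl.map' e.toLinearMap e.ker
    have h2 : ⇑e.toLinearMap ∘ ![X.one, x] = ![X'.one, e x] := by
      ext i
      fin_cases i
      · exact he.one
      · rfl
    rwa [h2] at this
  · have := congrArg (Submodule.map e.toLinearMap) hs
    rwa [Submodule.map_span, Set.image_pair, Submodule.map_top, LinearEquiv.range,
      LinearEquiv.coe_coe, he.one] at this
  · rw [← he.act, ha, map_smul]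
  · rw [he.coact, hc, LinearMap.lTensor_tmul, LinearEquiv.coe_coe]
  · rw [← he.mul, hm, map_zero]
  · rw [he.comul, hd, map_add, TensorProduct.map_tmul, TensorProduct.map_tmul, LinearEquiv.coe_coe,
      he.one]
  · rw [he.counit, hε]
  · rw [← he.antipode, hS, map_neg]

/-- On the basis `{1, x}` all structure constants are determined by `σ` and `v`, so the linear map
matching the two bases respects everything. -/
lemma IsB.exists_isIso (h : X.IsB σ v) (h' : X'.IsB σ v) : ∃ e : B ≃ₗ[k] B', X.IsIso X' e := by
  obtain ⟨x, hl, hs, ha, hc, hm, hd, hε, hS⟩ := h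
  obtain ⟨x', hl', hs', ha', hc', hm', hd', hε', hS'⟩ := h'
  let β : Module.Basis (Fin 2) k B := Module.Basis.mk hl (by
    rw [Matrix.range_cons, Matrix.range_cons, Matrix.range_empty, Set.union_empty,
      Set.singleton_union, hs])
  let β' : Module.Basis (Fin 2) k B' := Module.Basis.mk hl' (by
    rw [Matrix.range_cons, Matrix.range_cons, Matrix.range_empty, Set.union_empty,
      Set.singleton_union, hs'])
  have hβ0 : β 0 = X.one := by simp [β]
  have hβ1 : β 1 = x := by simp [β]
  have hβ0' : β' 0 = X'.one := by simp [β']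
  have hβ1' : β' 1 = x' := by simp [β']
  have he0 : β.equiv β' (Equiv.refl _) X.one = X'.one := by
    rw [← hβ0, Module.Basis.equiv_apply, ← hβ0', Equiv.refl_apply]
  have he1 : β.equiv β' (Equiv.refl _) x = x' := by
    rw [← hβ1, Module.Basis.equiv_apply, ← hβ1', Equiv.refl_apply]
  refine ⟨β.equiv β' (Equiv.refl _), fun φ => ?_, ?_, fun b c => ?_, he0, ?_, ?_, ?_⟩
  · refine eq_of_basis β ⟨by intros; simp only [map_add], by intros; simp only [map_smul]⟩
      ⟨by intros; simp only [map_add], by intros; simp only [map_smul]⟩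
      (Fin.forall_fin_two.2 ⟨?_, ?_⟩)
    · rw [hβ0, X.act_one, map_smul, he0, X'.act_one]
    · rw [hβ1, ha, map_smul, he1, ha']
  · refine eq_of_basis β ⟨by intros; simp only [map_add], by intros; simp only [map_smul]⟩
      ⟨by intros; simp only [map_add], by intros; simp only [map_smul]⟩
      (Fin.forall_fin_two.2 ⟨?_, ?_⟩)
    · rw [hβ0, X.coact_one, he0, X'.coact_one, LinearMap.lTensor_tmul, LinearEquiv.coe_coe, he0]
    · rw [hβ1, hc, he1, hc', LinearMap.lTensor_tmul, LinearEquiv.coe_coe, he1]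
  · revert b
    refine eq_of_basis β
      ⟨by intros; simp only [map_add, TensorProduct.add_tmul],
        by intros; simp only [map_smul, ← TensorProduct.smul_tmul']⟩
      ⟨by intros; simp only [map_add, TensorProduct.add_tmul],
        by intros; simp only [map_smul, ← TensorProduct.smul_tmul']⟩
      (Fin.forall_fin_two.2 ⟨?_, ?_⟩)
    · rw [hβ0, X.one_mul, he0, X'.one_mul]
    · rw [hβ1]
      revert c
      refine eq_of_basis β
        ⟨by intros; simp only [map_add, TensorProduct.tmul_add],
          by intros; simp only [map_smul, TensorProduct.tmul_smul]⟩
        ⟨by intros; simp only [map_add, TensorProduct.tmul_add],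
          by intros; simp only [map_smul, TensorProduct.tmul_smul]⟩
        (Fin.forall_fin_two.2 ⟨?_, ?_⟩)
      · rw [hβ0, X.mul_one, he0, X'.mul_one]
      · rw [hβ1, hm, he1, hm', map_zero]
  · refine eq_of_basis β ⟨by intros; simp only [map_add], by intros; simp only [map_smul]⟩
      ⟨by intros; simp only [map_add], by intros; simp only [map_smul]⟩
      (Fin.forall_fin_two.2 ⟨?_, ?_⟩)
    · rw [hβ0, X.comul_one, he0, X'.comul_one, TensorProduct.map_tmul, LinearEquiv.coe_coe, he0]
    · rw [hβ1, hd, he1, hd', map_add, TensorProduct.map_tmul, TensorProduct.map_tmul,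
        LinearEquiv.coe_coe, he0, he1]
  · refine eq_of_basis β ⟨by intros; simp only [map_add], by intros; simp only [map_smul]⟩
      ⟨by intros; simp only [map_add], by intros; simp only [map_smul]⟩
      (Fin.forall_fin_two.2 ⟨?_, ?_⟩)
    · rw [hβ0, he0, X.counit_one, X'.counit_one]
    · rw [hβ1, he1, hε, hε']
  · refine eq_of_basis β ⟨by intros; simp only [map_add], by intros; simp only [map_smul]⟩
      ⟨by intros; simp only [map_add], by intros; simp only [map_smul]⟩
      (Fin.forall_fin_two.2 ⟨?_, ?_⟩)
    · rw [hβ0, X.antipode_map_one, he0, X'.antipode_map_one]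
    · rw [hβ1, hS, map_neg, he1, hS']

/-- Characterizing `x` as a generator of the kernel of the counit, independently of the chosen
basis, is what makes `σ` and `v` invariants. -/
lemma IsB.exists_ker_counit (h : X.IsB σ v) : ∃ x : B, x ≠ 0 ∧ X.counit x = 0 ∧
    (∀ φ, X.act φ x = σ φ • x) ∧ X.coact x = v ⊗ₜ[k] x ∧
    ∀ y, X.counit y = 0 → ∃ d : k, y = d • x := by
  obtain ⟨x, hl, hs, ha, hc, -, -, hε, -⟩ := h
  refine ⟨x, hl.ne_zero 1, hε, ha, hc, fun y hy => ?_⟩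
  obtain ⟨c, d, rfl⟩ := Submodule.mem_span_pair.1 (show y ∈ Submodule.span k {X.one, x} by
    rw [hs]; trivial)
  rw [map_add, map_smul, map_smul, X.counit_one, hε, smul_zero, add_zero, smul_eq_mul,
    _root_.mul_one] at hy
  exact ⟨d, by rw [hy, zero_smul, zero_add]⟩

lemma IsB.act_of_counit_eq_zero (h : X.IsB σ v) (φ : H) {y : B} (hy : X.counit y = 0) :
    X.act φ y = σ φ • y := by
  obtain ⟨x, -, -, ha, -, hs⟩ := h.exists_ker_counit
  obtain ⟨d, rfl⟩ := hs y hy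
  rw [map_smul, ha, smul_comm]

lemma IsB.coact_of_counit_eq_zero (h : X.IsB σ v) {y : B} (hy : X.counit y = 0) :
    X.coact y = v ⊗ₜ[k] y := by
  obtain ⟨x, -, -, -, hc, hs⟩ := h.exists_ker_counit
  obtain ⟨d, rfl⟩ := hs y hy
  rw [map_smul, hc, TensorProduct.tmul_smul]

end General

section Group

lemma eq_of_forall_eval_eq {k : Type u} {G : Type w} [Field k] [DecidableEq G] {g g' : G} (h : ∀ φ : G → k, φ g = φ g') : g = g' := by
  have := h (Pi.single g' 1)
  by_contra hg
  rw [Pi.single_eq_same, Pi.single_eq_of_ne hg] at this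
  exact zero_ne_one this

variable {k : Type u} {G : Type w} [Field k] [CommGroup G] [Fintype G] [DecidableEq G]
  {ω : NormalizedCocycle₃ G k} {g g' : G} {v v' : G → k}

lemma IsB.degree_eq {B : Type*} [AddCommGroup B] [Module k B]
    {X : BraidedHopf (functionAlgebra ω).toQuasiBialgebra B}
    (h : X.IsB (Pi.evalAlgHom k (fun _ : G => k) g) v)
    (h' : ∀ (φ : G → k) (b : B), X.counit b = 0 → X.act φ b = φ g' • b) : g = g' := by
  obtain ⟨x, hx, hε, ha, -, -⟩ := h.exists_ker_counit
  refine eq_of_forall_eval_eq (k := k) fun φ => smul_left_injective k hx ?_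
  simpa [ha] using h' φ x hε

lemma IsB.weight_eq {B : Type*} [AddCommGroup B] [Module k B]
    {X : BraidedHopf (functionAlgebra ω).toQuasiBialgebra B}
    (h : X.IsB (Pi.evalAlgHom k (fun _ : G => k) g) v)
    (h' : X.IsB (Pi.evalAlgHom k (fun _ : G => k) g') v') : v = v' := by
  obtain ⟨x, hx, hε, -, hc, -⟩ := h.exists_ker_counit
  exact tmul_left_cancel hx (hc.symm.trans (h'.coact_of_counit_eq_zero hε))

end Group

end BraidedHopf

/-! ### Realization of the pairs `(g, v)` with `v g = -1`, and the resulting bijection -/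

section Classes

variable {k : Type u} {G : Type w} [Field k] [CommGroup G] [Fintype G] [DecidableEq G]
  {ω : NormalizedCocycle₃ G k} {g : G} {v : G → k}

lemma pairHopf_isB (h : IsYetterDrinfeldPair ω g v) (hv : v g = -1) :
    (pairHopf h hv).IsB (Pi.evalAlgHom k (fun _ : G => k) g) v := by
  have he := isEigen_diagonalYetterDrinfeld (isYetterDrinfeldPair_vecCons h) 1
  have hf : ![(pairHopf h hv).one, Pi.basisFun k (Fin 2) 1] = Pi.basisFun k (Fin 2) := by
    ext i : 1
    fin_cases i <;> rfl
  refine ⟨Pi.basisFun k (Fin 2) 1, ?_, ?_, he.act, he.coact, dualMul_basisFun 1 1, dualComul_one,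
    dualCounit_one, dualAntipode_one⟩
  · rw [hf]
    exact (Pi.basisFun k (Fin 2)).linearIndependent
  · have hr := congrArg Set.range hf
    rw [Matrix.range_cons, Matrix.range_cons, Matrix.range_empty, Set.union_empty,
      Set.singleton_union] at hr
    rw [hr]
    exact (Pi.basisFun k (Fin 2)).span_eq

/-- Every admissible pair `(g, v)` gives a non-trivial two-dimensional braided Hopf algebra. -/
lemma exists_nontrivialBraidedHopf₂ (hk : (2 : k) ≠ 0) (h : IsYetterDrinfeldPair ω g v)
    (hv : v g = -1) : ∃ B : NontrivialBraidedHopf₂ (functionAlgebra ω).toQuasiBialgebra,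
      B.str.IsB (Pi.evalAlgHom k (fun _ : G => k) g) v := by
  have hB := pairHopf_isB h hv
  refine ⟨⟨Fin 2 → k, pairHopf h hv, by simp, fun ht => ?_⟩, hB⟩
  obtain ⟨x, hx, -, -, hc, -⟩ := hB.exists_ker_counit
  -- A trivial coaction means `v = 1`, against `v g = -1` and `2 ≠ 0`.
  have := tmul_left_cancel hx (hc.symm.trans (ht.2.1 x))
  rw [this, Pi.one_apply] at hv
  exact hk (by linear_combination hv)

/-- A parametrization of the pairs `(g, v)` parametrizes the isomorphism classes of the non-trivial
two-dimensional braided Hopf algebras. -/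
theorem exists_equiv_of_parametrization (hk : (2 : k) ≠ 0) {I : Type*} (p : I → G × (G → k))
    (hp : Function.Injective p)
    (hr : ∀ q : G × (G → k), q ∈ Set.range p ↔ IsYetterDrinfeldPair ω q.1 q.2 ∧ q.2 q.1 = -1) :
    ∃ Θ : Quotient (NontrivialBraidedHopf₂.setoid (functionAlgebra ω).toQuasiBialgebra) ≃ I,
      ∀ B : NontrivialBraidedHopf₂ (functionAlgebra ω).toQuasiBialgebra,
        B.str.IsB (Pi.evalAlgHom k (fun _ : G => k) (p (Θ (Quotient.mk _ B))).1)
          (p (Θ (Quotient.mk _ B))).2 := by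
  have key : ∀ c : Quotient (NontrivialBraidedHopf₂.setoid (functionAlgebra ω).toQuasiBialgebra),
      ∃ i : I, c.out.str.IsB (Pi.evalAlgHom k (fun _ : G => k) (p i).1) (p i).2 := fun c => by
    obtain ⟨g, v, h1, h2, h3⟩ := c.out.str.exists_isB hk c.out.finrank_eq c.out.not_trivial
    obtain ⟨i, hi⟩ := (hr (g, v)).2 ⟨h1, h2⟩
    exact ⟨i, by rwa [hi]⟩
  choose F hF using key
  -- `F` was chosen on representatives of classes; the property carries over to every `B` along an
  -- isomorphism.
  have hF' : ∀ B : NontrivialBraidedHopf₂ (functionAlgebra ω).toQuasiBialgebra,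
      B.str.IsB (Pi.evalAlgHom k (fun _ : G => k) (p (F (Quotient.mk _ B))).1)
        (p (F (Quotient.mk _ B))).2 := fun B => by
    obtain ⟨e, he⟩ : ∃ e : _ ≃ₗ[k] B.carrier, BraidedHopf.IsIso _ B.str e :=
      Quotient.mk_out (s := NontrivialBraidedHopf₂.setoid _) B
    exact (hF _).of_isIso he
  refine ⟨Equiv.ofBijective F ⟨fun c c' h => ?_, fun i => ?_⟩, hF'⟩
  · rw [← Quotient.out_eq c, ← Quotient.out_eq c']
    refine Quotient.sound ((hF c).exists_isIso ?_)
    rw [h]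
    exact hF c'
  · obtain ⟨h1, h2⟩ := (hr (p i)).1 ⟨i, rfl⟩
    obtain ⟨B, hB⟩ := exists_nontrivialBraidedHopf₂ hk h1 h2
    refine ⟨Quotient.mk _ B, hp (Prod.ext ?_ ?_)⟩
    · exact (hF' B).degree_eq fun φ b hb => hB.act_of_counit_eq_zero φ hb
    · exact (hF' B).weight_eq hB

end Classes

/-! ### The Yetter-Drinfeld pairs over `k^G_ω` for the cocycles `ω_a` -/

/-- The generator `g_j`. -/
def gen {n : ℕ} {m : Fin n → ℕ} (j : Fin n) : FinAb m := Pi.mulSingle j (Multiplicative.ofAdd 1)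

/-- The remainder matters only when `m j = 1`: then the generator is trivial and its exponent is
`0`. -/
lemma expo_gen_self {n : ℕ} {m : Fin n → ℕ} (j : Fin n) : expo (gen j : FinAb m) j = 1 % m j := by
  rw [expo, gen, Pi.mulSingle_eq_same, toAdd_ofAdd, ZMod.val_one_eq_one_mod]

lemma expo_gen_of_ne {n : ℕ} {m : Fin n → ℕ} {i j : Fin n} (h : i ≠ j) :
    expo (gen j : FinAb m) i = 0 := by
  rw [expo, gen, Pi.mulSingle_eq_of_ne h, toAdd_one, ZMod.val_zero]

lemma gen_pow {n : ℕ} {m : Fin n → ℕ} (j : Fin n) : (gen j : FinAb m) ^ m j = 1 := by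
  rw [gen, ← Pi.mulSingle_pow, ← ofAdd_nsmul]
  simp

/-! ### The matrix `A'` and divisibility by `M` and `N` -/

section Arithmetic

variable {n : ℕ}

/-- The entry in the row `u` and the column `(r, s)` of `A'`. -/
def matEntry (F : Fin n → Fin n → Fin n → ℤ) (u r s : Fin n) : ℤ :=
  if u < r then F u r s else if u = r then 0 else if u < s then -F r u s else if u = s then 0
  else F r s u

lemma matEntry_eq (F : Fin n → Fin n → Fin n → ℤ) (u : Fin n) {r s : Fin n} (h : r < s) :
    matEntry F u r s = (if u < r then F u r s else 0) - (if r < u ∧ u < s then F r u s else 0) +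
      if s < u then F r s u else 0 := by
  unfold matEntry
  split_ifs <;> try omega

lemma sum_pairs (g : Fin n → Fin n → ℤ) :
    ∑ p ∈ pairs n, g p.1 p.2 = ∑ r, ∑ s, if r < s then g r s else 0 := by
  rw [pairs, Finset.sum_filter, Fintype.sum_prod_type]

lemma sum_triples (g : Fin n → Fin n → Fin n → ℤ) :
    ∑ p ∈ triples n, g p.1 p.2.1 p.2.2 =
      ∑ r, ∑ s, ∑ t, if r < s ∧ s < t then g r s t else 0 := by
  rw [triples, Finset.sum_filter, Fintype.sum_prod_type]
  simp only [Fintype.sum_prod_type]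

/-- Sort the three terms by the position of `f`: last, first or middle. Collecting the coefficients
of `z_r y_s` for fixed `r < s` gives the column `(r, s)` of `A'`, the minus sign belonging to the
middle position. The proof is an exchange of summations. -/
lemma sum_triples_eq_sum_pairs (F : Fin n → Fin n → Fin n → ℤ) (f y z : Fin n → ℤ) :
    ∑ p ∈ triples n, F p.1 p.2.1 p.2.2 *
        (z p.1 * y p.2.1 * f p.2.2 + f p.1 * z p.2.1 * y p.2.2 - z p.1 * f p.2.1 * y p.2.2) =
      ∑ p ∈ pairs n, z p.1 * y p.2 * ∑ u, f u * matEntry F u p.1 p.2 := by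
  rw [sum_pairs (fun r s => z r * y s * ∑ u, f u * matEntry F u r s),
    sum_triples (fun r s t => F r s t * (z r * y s * f t + f r * z s * y t - z r * f s * y t))]
  have h1 : ∀ r s : Fin n, (if r < s then z r * y s * ∑ u, f u * matEntry F u r s else 0) =
      ∑ u, ((if u < r ∧ r < s then F u r s * (f u * z r * y s) else 0) -
        (if r < u ∧ u < s then F r u s * (z r * f u * y s) else 0) +
        (if r < s ∧ s < u then F r s u * (z r * y s * f u) else 0)) := by
    intro r s
    split_ifs with h
    · rw [Finset.mul_sum]
      refine Finset.sum_congr rfl fun u _ => ?_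
      rw [matEntry_eq F u h]
      split_ifs <;> first | omega | ring
    · refine (Finset.sum_eq_zero fun u _ => ?_).symm
      rw [if_neg (by omega), if_neg (by omega), if_neg (by omega)]
      simp
  simp only [h1, Finset.sum_add_distrib, Finset.sum_sub_distrib]
  have h2 : ∀ r s t : Fin n, (if r < s ∧ s < t then
      F r s t * (z r * y s * f t + f r * z s * y t - z r * f s * y t) else 0) =
      (if r < s ∧ s < t then F r s t * (f r * z s * y t) else 0) -
        (if r < s ∧ s < t then F r s t * (z r * f s * y t) else 0) +
        (if r < s ∧ s < t then F r s t * (z r * y s * f t) else 0) := by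
    intro r s t
    split_ifs <;> ring
  simp only [h2, Finset.sum_add_distrib, Finset.sum_sub_distrib]
  congr 2
  · exact ((Finset.sum_congr rfl fun r _ => Finset.sum_comm).trans Finset.sum_comm).symm
  · refine Finset.sum_congr rfl fun r _ => Finset.sum_comm

variable (m : Fin n → ℕ)

lemma gcd₃_dvd_lcmM {r s t : Fin n} (hr : r < s) (hs : s < t) : gcd₃ m (r, s, t) ∣ lcmM m :=
  Finset.dvd_lcm (f := gcd₃ m) (by simp [triples, hr, hs])

lemma gcd₃_dvd_left (p : Fin n × Fin n × Fin n) : gcd₃ m p ∣ m p.1 := Nat.gcd_dvd_left _ _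

lemma gcd₃_dvd_mid (p : Fin n × Fin n × Fin n) : gcd₃ m p ∣ m p.2.1 :=
  (Nat.gcd_dvd_right _ _).trans (Nat.gcd_dvd_left _ _)

lemma gcd₃_dvd_right (p : Fin n × Fin n × Fin n) : gcd₃ m p ∣ m p.2.2 :=
  (Nat.gcd_dvd_right _ _).trans (Nat.gcd_dvd_right _ _)

lemma lcmM_dvd_lcmN : lcmM m ∣ lcmN m :=
  Finset.lcm_dvd fun p _ => (gcd₃_dvd_left m p).trans (dvd_lcmN m _)

lemma sq_dvd_lcmN (j : Fin n) : m j ^ 2 ∣ lcmN m :=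
  (Finset.dvd_lcm (f := fun j => m j ^ 2) (Finset.mem_univ j)).trans (Nat.dvd_lcm_left _ _)

lemma mul_dvd_lcmN {p : Fin n × Fin n} (hp : p ∈ pairs n) : m p.1 * m p.2 ∣ lcmN m :=
  (Finset.dvd_lcm (f := fun p : Fin n × Fin n => m p.1 * m p.2) hp).trans (Nat.dvd_lcm_right _ _)

/-- This crude multiple of `N` yields both its positivity and an even `m_j` when `N` is even. -/
lemma lcmN_dvd_prod_sq : lcmN m ∣ (∏ j, m j) ^ 2 := by
  have h : ∀ j, m j ∣ ∏ j, m j := fun j => Finset.dvd_prod_of_mem m (Finset.mem_univ j)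
  refine Nat.lcm_dvd (Finset.lcm_dvd fun j _ => pow_dvd_pow_of_dvd (h j) 2)
    (Finset.lcm_dvd fun p _ => ?_)
  rw [sq]
  exact mul_dvd_mul (h _) (h _)

lemma exists_even_of_even_lcmN (h : Even (lcmN m)) : ∃ j, Even (m j) := by
  have h2 : 2 ∣ ∏ j, m j :=
    Nat.prime_two.dvd_of_dvd_pow (h.two_dvd.trans (lcmN_dvd_prod_sq m))
  obtain ⟨j, -, hj⟩ := (Nat.prime_two.prime.dvd_finsetProd_iff _).1 h2
  exact ⟨j, even_iff_two_dvd.2 hj⟩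

variable [∀ j, NeZero (m j)]

lemma lcmN_pos : 0 < lcmN m :=
  Nat.pos_of_dvd_of_pos (lcmN_dvd_prod_sq m)
    (pow_pos (Finset.prod_pos fun j _ => Nat.pos_of_ne_zero (NeZero.ne (m j))) 2)

lemma lcmM_pos : 0 < lcmM m := Nat.pos_of_dvd_of_pos (lcmM_dvd_lcmN m) (lcmN_pos m)

lemma dvd_mul_Mc (c : CocycleDatum n) {r s t : Fin n} (hr : r < s) (hs : s < t) (a : ℕ)
    (ha : gcd₃ m (r, s, t) ∣ a) : (lcmM m : ℤ) ∣ a * Mc m c r s t := by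
  obtain ⟨b, rfl⟩ := ha
  obtain ⟨q, hq⟩ := gcd₃_dvd_lcmM m hr hs
  have hpos : 0 < gcd₃ m (r, s, t) :=
    Nat.pos_of_dvd_of_pos (gcd₃_dvd_lcmM m hr hs) (lcmM_pos m)
  refine ⟨b * c.c₃ r s t, ?_⟩
  rw [Mc, Nat.div_eq_of_eq_mul_right hpos hq]
  conv_rhs => rw [hq]
  push_cast
  ring

/-- Each nonzero entry is `± M^c` at a triple consisting of `u`, `r`, `s`, and `M^c` times the gcd
of that triple is a multiple of `M`. The case `a = m u` makes the congruence depend on `f` only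
modulo the `m_u`; the other two make a column vanish modulo `M` when one of its factors is trivial.
-/
lemma dvd_mul_matEntry (c : CocycleDatum n) {r s : Fin n} (hr : r < s) (u : Fin n) {a : ℕ}
    (ha : a = m u ∨ a = m r ∨ a = m s) : (lcmM m : ℤ) ∣ a * matEntry (Mc m c) u r s := by
  unfold matEntry
  split_ifs with h1 h2 h3 h4
  · refine dvd_mul_Mc m c h1 hr a ?_
    rcases ha with rfl | rfl | rfl
    exacts [gcd₃_dvd_left m (u, r, s), gcd₃_dvd_mid m (u, r, s), gcd₃_dvd_right m (u, r, s)]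
  · simp
  · rw [mul_neg, dvd_neg]
    refine dvd_mul_Mc m c (lt_of_le_of_ne (not_lt.1 h1) (Ne.symm h2)) h3 a ?_
    rcases ha with rfl | rfl | rfl
    exacts [gcd₃_dvd_mid m (r, u, s), gcd₃_dvd_left m (r, u, s), gcd₃_dvd_right m (r, u, s)]
  · simp
  · refine dvd_mul_Mc m c hr (lt_of_le_of_ne (not_lt.1 h3) (Ne.symm h4)) a ?_
    rcases ha with rfl | rfl | rfl
    exacts [gcd₃_dvd_right m (r, s, u), gcd₃_dvd_left m (r, s, u), gcd₃_dvd_mid m (r, s, u)]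

/-- The condition `f A' ≡ 0` modulo `M`. -/
def KillsModM (c : CocycleDatum n) (f : Fin n → ℤ) : Prop :=
  ∀ p ∈ pairs n, (lcmM m : ℤ) ∣ ∑ u, f u * matEntry (Mc m c) u p.1 p.2

variable {m}

lemma KillsModM.congr {c : CocycleDatum n} {f f' : Fin n → ℤ} (h : KillsModM m c f)
    (hf : ∀ j, (m j : ℤ) ∣ f' j - f j) : KillsModM m c f' := by
  intro p hp
  have hp' : p.1 < p.2 := by simpa [pairs] using hp
  rw [← dvd_sub_left (h p hp), ← Finset.sum_sub_distrib]
  refine Finset.dvd_sum fun u _ => ?_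
  obtain ⟨q, hq⟩ := hf u
  rw [← sub_mul, hq, mul_right_comm]
  exact (dvd_mul_matEntry m c hp' u (Or.inl rfl)).mul_right q

lemma prod_gen_pow (x : FinAb m) : ∏ j, gen j ^ expo x j = x := by
  conv_rhs => rw [← Finset.univ_prod_mulSingle x]
  refine Finset.prod_congr rfl fun j _ => ?_
  rw [gen, ← Pi.mulSingle_pow, ← ofAdd_nsmul, expo]
  simp

lemma expo_monomialElt (f : Fin n → ℤ) (j : Fin n) :
    (expo (monomialElt m f) j : ℤ) = f j % m j := by
  rw [expo, monomialElt, toAdd_ofAdd, ZMod.val_intCast]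

lemma dvd_expo_monomialElt_sub (f : Fin n → ℤ) (j : Fin n) :
    (m j : ℤ) ∣ expo (monomialElt m f) j - f j := by
  rw [expo_monomialElt]
  exact (Int.mod_modEq _ _).symm.dvd

lemma monomialElt_expo (x : FinAb m) : monomialElt m (fun j => (expo x j : ℤ)) = x := by
  funext j
  simp [monomialElt, expo]

lemma expo_monomialElt_of_lt {f : Fin n → ℤ} (hf : ∀ j, 0 ≤ f j ∧ f j < m j) :
    (fun j => (expo (monomialElt m f) j : ℤ)) = f := by
  funext j
  rw [expo_monomialElt, Int.emod_eq_of_lt (hf j).1 (hf j).2]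

end Arithmetic

lemma div_eq_div_mul_div {a b N : ℕ} (hN : 0 < N) (hab : a ∣ b) (hb : b ∣ N) :
    N / a = N / b * (b / a) := by
  obtain ⟨x, rfl⟩ := hb
  obtain ⟨y, rfl⟩ := hab
  have hay : 0 < a * y := Nat.pos_of_ne_zero fun h => by simp [h] at hN
  have ha : 0 < a := Nat.pos_of_ne_zero fun h => by simp [h] at hay
  rw [Nat.mul_div_cancel_left _ hay, Nat.mul_div_cancel_left _ ha, mul_assoc,
    Nat.mul_div_cancel_left _ ha, mul_comm]

lemma zpow_sum {A ι : Type*} [CommGroup A] (a : A) (s : Finset ι) (g : ι → ℤ) :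
    a ^ (∑ i ∈ s, g i) = ∏ i ∈ s, a ^ g i := by
  classical
  induction s using Finset.induction_on with
  | empty => simp
  | insert i s hi ih => rw [Finset.sum_insert hi, Finset.prod_insert hi, zpow_add, ih]

/-- The exponent of the bicharacter that the `c_{rst}` contribute to the `2`-cocycle of `g`. -/
def bichar {n : ℕ} (m : Fin n → ℕ) (c : CocycleDatum n) (f : Fin n → ℤ) (y z : FinAb m) : ℤ :=
  ∑ p ∈ pairs n, (expo z p.1 : ℤ) * expo y p.2 * ∑ u, f u * matEntry (Mc m c) u p.1 p.2

lemma KillsModM.dvd_bichar {n : ℕ} {m : Fin n → ℕ} {c : CocycleDatum n} {f : Fin n → ℤ} (h : KillsModM m c f) (y z : FinAb m) :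
    (lcmM m : ℤ) ∣ bichar m c f y z :=
  Finset.dvd_sum fun p hp => (h p hp).mul_left _

/-! ### The `2`-cochain attached to a group element and its trivializations -/

section Root

variable {k : Type u} [Field k] {n : ℕ} (m : Fin n → ℕ) (c : CocycleDatum n) (ζ : kˣ)

/-- The part of `ω_a` coming from the `c_l` and the `c_{st}`. -/
def cupPart (f : Fin n → ℤ) (y z : FinAb m) : kˣ :=
  (∏ l : Fin n, (ζ ^ (lcmN m / m l)) ^
      (c.c₁ l * f l * (((expo y l + expo z l) / m l : ℕ) : ℤ))) *
    ∏ p ∈ pairs n, (ζ ^ (lcmN m / m p.2)) ^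
      (c.c₂ p.1 p.2 * f p.2 * (((expo y p.1 + expo z p.1) / m p.1 : ℕ) : ℤ))

/-- The part of `ω_a` coming from the `c_{rst}`. -/
def triplePart (x y z : FinAb m) : kˣ :=
  ∏ p ∈ triples n, (ζ ^ (lcmN m / gcd₃ m p)) ^
    (-(c.c₃ p.1 p.2.1 p.2.2 * (expo z p.1 : ℤ) * (expo y p.2.1 : ℤ) * (expo x p.2.2 : ℤ)))

/-- The value of `ρ_{f,λ}` as a unit. -/
def rhoUnit (f l : Fin n → ℤ) (x : FinAb m) : kˣ :=
  (∏ j : Fin n, (ζ ^ (lcmN m / m j)) ^ (l j * (expo x j : ℤ))) *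
    (∏ j : Fin n, (ζ ^ (lcmN m / m j ^ 2)) ^ (c.c₁ j * f j * (expo x j : ℤ))) *
    ∏ p ∈ pairs n, (ζ ^ (lcmN m / (m p.1 * m p.2))) ^
      (c.c₂ p.1 p.2 * f p.2 * (expo x p.1 : ℤ))

lemma omegaFun_eq (x y z : FinAb m) :
    omegaFun m c ζ x y z =
      cupPart m c ζ (fun j => (expo x j : ℤ)) y z * triplePart m c ζ x y z := rfl

lemma rho_eq (f l : Fin n → ℤ) (x : FinAb m) : rho m c ζ f l x = rhoUnit m c ζ f l x := rfl

/-- This symmetry cancels the cup parts of `ω(y, z, g)` and `ω(y, g, z)`, and leaves only the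
`c_{rst}` as an obstruction to symmetry. -/
lemma cupPart_comm (f : Fin n → ℤ) (y z : FinAb m) :
    cupPart m c ζ f y z = cupPart m c ζ f z y := by
  simp only [cupPart, add_comm (expo y _)]

/-- Every `(m_r, m_s, m_t)` divides `M`, so all factors are powers of the single root of unity
`ζ^{N/M}`; this is why the entries of `A'` are rescaled to `M^c`. -/
lemma triplePart_eq [∀ j, NeZero (m j)] (x y z : FinAb m) :
    triplePart m c ζ x y z = ζ ^ (-(((lcmN m / lcmM m : ℕ) : ℤ) * ∑ p ∈ triples n,
      Mc m c p.1 p.2.1 p.2.2 * ((expo z p.1 : ℤ) * expo y p.2.1 * expo x p.2.2))) := by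
  rw [Finset.mul_sum, ← Finset.sum_neg_distrib, triplePart]
  rw [zpow_sum]
  refine Finset.prod_congr rfl fun p hp => ?_
  obtain ⟨hr, hs⟩ : p.1 < p.2.1 ∧ p.2.1 < p.2.2 := by simpa [triples] using hp
  rw [← zpow_natCast, ← zpow_mul]
  congr 1
  have hd : lcmN m / gcd₃ m p = lcmN m / lcmM m * (lcmM m / gcd₃ m p) :=
    div_eq_div_mul_div (lcmN_pos m) (gcd₃_dvd_lcmM m hr hs) (lcmM_dvd_lcmN m)
  rw [hd, Mc]
  push_cast
  ring

lemma triplePart_mul [∀ j, NeZero (m j)] (x y z : FinAb m) :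
    triplePart m c ζ x y z * triplePart m c ζ y z x = triplePart m c ζ y x z *
      ζ ^ (-(((lcmN m / lcmM m : ℕ) : ℤ) * ∑ p ∈ pairs n, (expo z p.1 : ℤ) * expo y p.2 *
        ∑ u, (expo x u : ℤ) * matEntry (Mc m c) u p.1 p.2)) := by
  rw [triplePart_eq, triplePart_eq, triplePart_eq, ← zpow_add, ← zpow_add,
    ← sum_triples_eq_sum_pairs (Mc m c) (fun j => (expo x j : ℤ)) (fun j => (expo y j : ℤ))
      (fun j => (expo z j : ℤ))]
  congr 1
  simp only [mul_add, mul_sub, Finset.sum_add_distrib, Finset.sum_sub_distrib]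
  ring

variable {m ζ}

lemma zpow_mul_zpow_expo [∀ j, NeZero (m j)] {η : kˣ} {j : Fin n} (h : η ^ m j = 1) (a : ℤ)
    (y z : FinAb m) :
    η ^ (a * (expo y j : ℤ)) * η ^ (a * (expo z j : ℤ)) = η ^ (a * (expo (y * z) j : ℤ)) := by
  rw [← zpow_add]
  refine zpow_congr_of_dvd h ⟨a * ((expo y j + expo z j) / m j : ℕ), ?_⟩
  have := expo_mul y z j
  zify at this ⊢
  linear_combination a * this

/-- Here `η` need not be an `m_j`-th root of unity, so the carry survives as a power of `η ^ m j`.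
For `η = ξ_{m_j²}` and `ξ_{m_s m_t}` this is the root of unity occurring in `ω_a`. -/
lemma zpow_mul_zpow_expo_carry [∀ j, NeZero (m j)] (η : kˣ) (j : Fin n) (a : ℤ) (y z : FinAb m) :
    η ^ (a * (expo y j : ℤ)) * η ^ (a * (expo z j : ℤ)) =
      (η ^ m j) ^ (a * (((expo y j + expo z j) / m j : ℕ) : ℤ)) *
        η ^ (a * (expo (y * z) j : ℤ)) := by
  rw [← zpow_natCast η, ← zpow_mul, ← zpow_add, ← zpow_add]
  congr 1
  have := expo_mul y z j
  zify at this ⊢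
  linear_combination a * this

/-- The `λ`-part is a character, and the carries of the other two parts reproduce the `c_l`- and
`c_{st}`-factors of `cupPart`. -/
lemma rhoUnit_mul [∀ j, NeZero (m j)] (hζ : ζ ^ lcmN m = 1) (f l : Fin n → ℤ) (y z : FinAb m) :
    rhoUnit m c ζ f l y * rhoUnit m c ζ f l z =
      cupPart m c ζ f y z * rhoUnit m c ζ f l (y * z) := by
  have e1 : ∀ a b d a' b' d' a'' b'' d'' p q : kˣ,
      a * a' = a'' → b * b' = p * b'' → d * d' = q * d'' →
      (a * b * d) * (a' * b' * d') = (p * q) * (a'' * b'' * d'') := by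
    intro a b d a' b' d' a'' b'' d'' p q h1 h2 h3
    calc _ = (a * a') * (b * b') * (d * d') := by simp only [mul_comm, mul_left_comm]
      _ = a'' * (p * b'') * (q * d'') := by rw [h1, h2, h3]
      _ = _ := by simp only [mul_comm, mul_left_comm]
  unfold rhoUnit cupPart
  apply e1
  · rw [← Finset.prod_mul_distrib]
    exact Finset.prod_congr rfl fun j _ =>
      zpow_mul_zpow_expo (root_pow hζ (dvd_lcmN m j)) _ y z
  · rw [← Finset.prod_mul_distrib, ← Finset.prod_mul_distrib]
    refine Finset.prod_congr rfl fun j _ => ?_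
    rw [zpow_mul_zpow_expo_carry, ← pow_mul,
      div_eq_div_mul_div (lcmN_pos m) (dvd_pow_self (m j) two_ne_zero) (sq_dvd_lcmN m j), sq,
      Nat.mul_div_cancel_left _ (Nat.pos_of_ne_zero (NeZero.ne (m j)))]
  · rw [← Finset.prod_mul_distrib, ← Finset.prod_mul_distrib]
    refine Finset.prod_congr rfl fun p hp => ?_
    rw [zpow_mul_zpow_expo_carry, ← pow_mul,
      div_eq_div_mul_div (lcmN_pos m) (dvd_mul_left (m p.2) (m p.1)) (mul_dvd_lcmN m hp),
      Nat.mul_div_cancel _ (Nat.pos_of_ne_zero (NeZero.ne (m p.2)))]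

lemma rhoUnit_one [∀ j, NeZero (m j)] (f l : Fin n → ℤ) : rhoUnit m c ζ f l 1 = 1 := by
  simp [rhoUnit, expo_one]

variable [∀ j, NeZero (m j)] (hζ : IsPrimitiveRoot ζ (lcmN m))

include hζ in
-- The value of `χ` at `g_j` is an `m_j`-th root of unity, hence a power of the primitive one
-- `ξ_{m_j}`.
lemma exists_eq_prod_zpow (χ : FinAb m →* kˣ) :
    ∃ l : Fin n → ℤ, (∀ j, 0 ≤ l j ∧ l j < m j) ∧
      ∀ x, χ x = ∏ j, (ζ ^ (lcmN m / m j)) ^ (l j * (expo x j : ℤ)) := by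
  have h : ∀ j, ∃ i : ℕ, i < m j ∧ (ζ ^ (lcmN m / m j)) ^ i = χ (gen j) := by
    intro j
    have hp : IsPrimitiveRoot (ζ ^ (lcmN m / m j)) (m j) :=
      hζ.pow (lcmN_pos m) (Nat.div_mul_cancel (dvd_lcmN m j)).symm
    have := NeZero.ne (m j)
    obtain ⟨i, hi, h⟩ := (IsPrimitiveRoot.coe_units_iff.2 hp).eq_pow_of_pow_eq_one
      (ξ := (χ (gen j) : k)) (by
        rw [← Units.val_pow_eq_pow_val, ← map_pow, gen_pow, map_one, Units.val_one])
    exact ⟨i, hi, Units.ext (by rw [Units.val_pow_eq_pow_val, h])⟩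
  choose i hi hχ using h
  refine ⟨fun j => i j, fun j => ⟨by positivity, Int.ofNat_lt.2 (hi j)⟩, fun x => ?_⟩
  conv_lhs => rw [← prod_gen_pow x]
  rw [map_prod]
  refine Finset.prod_congr rfl fun j _ => ?_
  rw [map_pow, ← hχ, ← pow_mul, ← zpow_natCast]
  push_cast
  rfl

include hζ in
lemma rhoUnit_injective {f l l' : Fin n → ℤ} (hl : ∀ j, 0 ≤ l j ∧ l j < m j)
    (hl' : ∀ j, 0 ≤ l' j ∧ l' j < m j)
    (h : ∀ x, rhoUnit m c ζ f l x = rhoUnit m c ζ f l' x) : l = l' := by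
  funext j
  have hj := h (gen j)
  simp only [rhoUnit] at hj
  rw [mul_left_inj, mul_left_inj, Finset.prod_eq_single j
    (fun i _ hi => by rw [expo_gen_of_ne hi]; simp) (by simp), Finset.prod_eq_single j
    (fun i _ hi => by rw [expo_gen_of_ne hi]; simp) (by simp), expo_gen_self] at hj
  have hp : IsPrimitiveRoot (ζ ^ (lcmN m / m j)) (m j) :=
    hζ.pow (lcmN_pos m) (Nat.div_mul_cancel (dvd_lcmN m j)).symm
  -- The exponent of `g_j` is `1 % m j`, congruent to `1` modulo `m j` even when `m j = 1`.
  have h1 : (m j : ℤ) ∣ l j - l' j := by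
    have : Nat.cast (1 % m j) = (1 : ℤ) % m j := by norm_cast
    rw [← mul_inv_eq_one, ← zpow_neg, ← zpow_add, hp.zpow_eq_one_iff_dvd, ← sub_eq_add_neg,
      ← sub_mul, this] at hj
    refine (Int.modEq_zero_iff_dvd.1 (Int.ModEq.trans ?_ (Int.modEq_zero_iff_dvd.2 hj)))
    conv_lhs => rw [← mul_one (l j - l' j)]
    exact (Int.ModEq.refl _).mul (Int.mod_modEq _ _).symm
  have h2 := hl j
  have h3 := hl' j
  have := Int.eq_zero_of_abs_lt_dvd h1 (by rw [abs_lt]; omega)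
  omega

lemma omegaFun_mul (g y z : FinAb m) :
    omegaFun m c ζ g y z * omegaFun m c ζ y z g = omegaFun m c ζ y g z *
      (cupPart m c ζ (fun j => (expo g j : ℤ)) y z *
        ζ ^ (-(((lcmN m / lcmM m : ℕ) : ℤ) * bichar m c (fun j => (expo g j : ℤ)) y z))) := by
  have h := triplePart_mul m c ζ g y z
  have h2 := cupPart_comm m c ζ (fun j => (expo y j : ℤ)) z g
  rw [omegaFun_eq, omegaFun_eq, omegaFun_eq, h2, bichar]
  rw [mul_mul_mul_comm, h, mul_comm (cupPart m c ζ (fun j => (expo g j : ℤ)) y z),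
    mul_mul_mul_comm]

variable {c}

/-- Dividing the Yetter-Drinfeld relation by `ω(y, g, z)` shows that `v` is a `1`-cochain whose
coboundary is the `2`-cochain of `g`. -/
lemma isYetterDrinfeldPair_omega_iff {g : FinAb m} {v : FinAb m → kˣ} :
    IsYetterDrinfeldPair (omega m c ζ hζ) g (fun x => (v x : k)) ↔ v 1 = 1 ∧ ∀ y z,
      v y * v z = cupPart m c ζ (fun j => (expo g j : ℤ)) y z *
        ζ ^ (-(((lcmN m / lcmM m : ℕ) : ℤ) * bichar m c (fun j => (expo g j : ℤ)) y z)) *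
        v (y * z) := by
  have key : ∀ y z, (((omega m c ζ hζ).toFun y g z : k) * v y * v z =
      (omega m c ζ hζ).toFun g y z * v (y * z) * (omega m c ζ hζ).toFun y z g) ↔
      v y * v z = cupPart m c ζ (fun j => (expo g j : ℤ)) y z *
        ζ ^ (-(((lcmN m / lcmM m : ℕ) : ℤ) * bichar m c (fun j => (expo g j : ℤ)) y z)) *
        v (y * z) := by
    intro y z
    have h := omegaFun_mul c (ζ := ζ) g y z
    change ((omegaFun m c ζ y g z : k) * v y * v z =
      omegaFun m c ζ g y z * v (y * z) * omegaFun m c ζ y z g) ↔ _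
    rw [mul_right_comm (omegaFun m c ζ g y z : k)]
    norm_cast
    rw [h, mul_assoc, mul_assoc, mul_right_inj]
  constructor
  · rintro ⟨h1, h2⟩
    exact ⟨Units.ext h1, fun y z => (key y z).1 (h2 y z)⟩
  · rintro ⟨h1, h2⟩
    exact ⟨by rw [h1, Units.val_one], fun y z => (key y z).2 (h2 y z)⟩

include hζ in
lemma zpow_eq_one_iff_lcmM_dvd (a : ℤ) :
    ζ ^ (((lcmN m / lcmM m : ℕ) : ℤ) * a) = 1 ↔ (lcmM m : ℤ) ∣ a := by
  have hp : IsPrimitiveRoot (ζ ^ (lcmN m / lcmM m)) (lcmM m) :=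
    hζ.pow (lcmN_pos m) (Nat.div_mul_cancel (lcmM_dvd_lcmN m)).symm
  rw [zpow_mul, zpow_natCast, hp.zpow_eq_one_iff_dvd]

/-- On the generators `g_s`, `g_r` with `r < s` only the summand `(r, s)` of `bichar` survives, and
after exchanging the arguments none does. -/
lemma killsModM_of_dvd_bichar {f : Fin n → ℤ}
    (h : ∀ y z, (lcmM m : ℤ) ∣ bichar m c f y z - bichar m c f z y) : KillsModM m c f := by
  rintro ⟨r, s⟩ hp
  have hrs : r < s := by simpa [pairs] using hp
  have h1 : bichar m c f (gen s) (gen r) = ((1 % m r : ℕ) : ℤ) * (1 % m s : ℕ) *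
      ∑ u, f u * matEntry (Mc m c) u r s := by
    rw [bichar, Finset.sum_eq_single (r, s)]
    · rw [expo_gen_self, expo_gen_self]
    · rintro ⟨r', s'⟩ - hne
      by_cases hr : r' = r
      · rw [expo_gen_of_ne (i := s') (j := s) (by rintro rfl; exact hne (by rw [hr]))]
        simp
      · rw [expo_gen_of_ne hr]
        simp
    · exact fun h => absurd hp h
  have h2 : bichar m c f (gen r) (gen s) = 0 := by
    refine Finset.sum_eq_zero ?_
    rintro ⟨r', s'⟩ hp'
    have hrs' : r' < s' := by simpa [pairs] using hp'
    by_cases hr : r' = s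
    · rw [expo_gen_of_ne (i := s') (j := r) (by rintro rfl; subst hr; exact lt_asymm hrs hrs')]
      simp
    · rw [expo_gen_of_ne hr]
      simp
  have h3 := h (gen s) (gen r)
  rw [h1, h2, sub_zero] at h3
  -- A trivial factor has a trivial generator, which yields no information; then the congruence for
  -- the column holds automatically.
  have h4 : ∀ a : ℕ, (a = m r ∨ a = m s) → a = 1 →
      (lcmM m : ℤ) ∣ ∑ u, f u * matEntry (Mc m c) u r s := fun a ha ha1 =>
    Finset.dvd_sum fun u _ => Dvd.dvd.mul_left (by
      simpa [ha1] using dvd_mul_matEntry m c hrs u (a := a) (Or.inr ha)) _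
  by_cases hr : m r = 1
  · exact h4 _ (Or.inl rfl) hr
  by_cases hs : m s = 1
  · exact h4 _ (Or.inr rfl) hs
  have hr0 := NeZero.ne (m r)
  have hs0 := NeZero.ne (m s)
  rwa [Nat.mod_eq_of_lt (by omega), Nat.mod_eq_of_lt (by omega), Nat.cast_one, one_mul,
    one_mul] at h3

lemma isYetterDrinfeldPair_rho {g : FinAb m} (hK : KillsModM m c (fun j => (expo g j : ℤ)))
    (l : Fin n → ℤ) :
    IsYetterDrinfeldPair (omega m c ζ hζ) g (rho m c ζ (fun j => (expo g j : ℤ)) l) := by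
  refine (isYetterDrinfeldPair_omega_iff hζ).2 ⟨rhoUnit_one c _ _, fun y z => ?_⟩
  rw [zpow_neg, (zpow_eq_one_iff_lcmM_dvd hζ _).2 (hK.dvd_bichar y z), inv_one, mul_one]
  exact rhoUnit_mul c hζ.pow_eq_one _ _ y z

/-- The degrees and coactions of the one-dimensional Yetter-Drinfeld modules over `k^G_ω`. -/
theorem isYetterDrinfeldPair_iff {g : FinAb m} {v : FinAb m → k} :
    IsYetterDrinfeldPair (omega m c ζ hζ) g v ↔ KillsModM m c (fun j => (expo g j : ℤ)) ∧
      ∃ l : Fin n → ℤ, (∀ j, 0 ≤ l j ∧ l j < m j) ∧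
        v = rho m c ζ (fun j => (expo g j : ℤ)) l := by
  constructor
  · intro h
    lift v to FinAb m → kˣ using fun x => (h.ne_zero x).isUnit
    obtain ⟨h1, h2⟩ := (isYetterDrinfeldPair_omega_iff hζ).1 h
    have hK : KillsModM m c (fun j => (expo g j : ℤ)) := by
      -- `v y * v z` and `v (y * z)` are symmetric in `y` and `z`, as is the cup part; hence so is
      -- the bicharacter modulo `M`.
      refine killsModM_of_dvd_bichar fun y z => ?_
      have h3 := h2 y z
      rw [mul_comm (v y), h2 z y, mul_comm z y, mul_left_inj, cupPart_comm, mul_right_inj] at h3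
      rw [← zpow_eq_one_iff_lcmM_dvd hζ, mul_sub, sub_eq_add_neg, zpow_add, h3, ← zpow_add,
        add_neg_cancel, zpow_zero]
    have h4 : ∀ y z, v y * v z =
        cupPart m c ζ (fun j => (expo g j : ℤ)) y z * v (y * z) := by
      intro y z
      rw [h2, zpow_neg, (zpow_eq_one_iff_lcmM_dvd hζ _).2 (hK.dvd_bichar y z), inv_one, mul_one]
    -- `v` and `ρ_{f,0}` have the same coboundary, so their quotient is a character; its exponents
    -- are `λ`.
    obtain ⟨l, hl, hχ⟩ := exists_eq_prod_zpow hζ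
      ({ toFun := fun x => v x * (rhoUnit m c ζ (fun j => (expo g j : ℤ)) 0 x)⁻¹
         map_one' := by rw [h1, rhoUnit_one, inv_one, mul_one]
         map_mul' := fun y z => by
          rw [mul_mul_mul_comm, h4, ← mul_inv, rhoUnit_mul c hζ.pow_eq_one, mul_inv,
            mul_mul_mul_comm, mul_inv_cancel, one_mul] } : FinAb m →* kˣ)
    refine ⟨hK, l, hl, ?_⟩
    funext x
    rw [rho_eq]
    congr 1
    have h5 := hχ x
    simp only [MonoidHom.coe_mk, OneHom.coe_mk] at h5
    rw [mul_inv_eq_iff_eq_mul] at h5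
    rw [h5]
    simp [rhoUnit, mul_assoc]
  · rintro ⟨hK, l, -, rfl⟩
    exact isYetterDrinfeldPair_rho hζ hK l

end Root

/-! ### Solutions of the linear congruence and the quadratic condition -/

section Smith

variable {n b : ℕ} {A : Matrix (Fin n) (Fin b) ℤ} (S : SmithForm A) {M : ℕ}

lemma dvd_vecMul {p q : ℕ} {a : ℤ} {w : Fin p → ℤ} (h : ∀ j, a ∣ w j)
    (V : Matrix (Fin p) (Fin q) ℤ) (j : Fin q) : a ∣ Matrix.vecMul w V j :=
  show a ∣ ∑ i, w i * V i j from Finset.dvd_sum fun i _ => (h i).mul_right _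

lemma SmithForm.vecMul_diag (Y : Fin n → ℤ) (j : Fin b) :
    Matrix.vecMul Y (S.U * A * S.V) j =
      if h : (j : ℕ) < S.r then Y ⟨j, h.trans_le S.r_le_left⟩ * S.d ⟨j, h⟩ else 0 := by
  rw [S.eq_diag, Matrix.vecMul, dotProduct]
  simp only [Matrix.of_apply]
  split_ifs with h
  · rw [Finset.sum_eq_single (⟨j, h.trans_le S.r_le_left⟩ : Fin n)]
    · simp [h]
    · intro i _ hi
      have : (i : ℕ) ≠ j := fun h => hi (Fin.ext h)
      simp [this]
    · simp
  · refine Finset.sum_eq_zero fun i _ => ?_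
    split_ifs with h1 h2
    · exact absurd (h2 ▸ h1) h
    · simp
    · simp

/-- As `V` is unimodular, multiplying by it neither creates nor destroys divisibility, and `U A V`
is diagonal. -/
lemma SmithForm.dvd_vecMul_iff (Y : Fin n → ℤ) :
    (∀ j, (M : ℤ) ∣ Matrix.vecMul (Matrix.vecMul Y S.U) A j) ↔
      ∀ (i : Fin n) (h : (i : ℕ) < S.r), (M : ℤ) ∣ Y i * S.d ⟨i, h⟩ := by
  have h1 : Matrix.vecMul (Matrix.vecMul (Matrix.vecMul Y S.U) A) S.V =
      Matrix.vecMul Y (S.U * A * S.V) := by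
    simp only [Matrix.vecMul_vecMul]
  constructor
  · intro h i hi
    have h2 := dvd_vecMul h S.V ⟨i, hi.trans_le S.r_le_right⟩
    rw [h1, S.vecMul_diag] at h2
    simpa [hi] using h2
  · intro h
    have h2 : ∀ j, (M : ℤ) ∣ Matrix.vecMul Y (S.U * A * S.V) j := fun j => by
      rw [S.vecMul_diag]
      split_ifs with hj
      · exact h _ hj
      · exact dvd_zero _
    have h3 := dvd_vecMul h2 S.V⁻¹
    rwa [← h1, Matrix.vecMul_vecMul _ S.V, Matrix.mul_nonsing_inv _ S.isUnit_det_V,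
      Matrix.vecMul_one] at h3

/-- After division by `(d, M)` the two quotients are coprime. -/
lemma dvd_mul_iff_div_gcd_dvd (hM : 0 < M) (d x : ℤ) :
    (M : ℤ) ∣ x * d ↔ ((M / Int.gcd d (M : ℤ) : ℕ) : ℤ) ∣ x := by
  have hg : 0 < Int.gcd d (M : ℤ) := Int.gcd_pos_of_ne_zero_right _ (by omega)
  have h1 : (Int.gcd d (M : ℤ) : ℤ) ∣ M := Int.gcd_dvd_right ..
  rw [Int.natCast_div]
  constructor
  · intro h
    have h2 := Int.isCoprime_iff_gcd_eq_one.2 (Int.gcd_div_gcd_div_gcd hg)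
    refine h2.symm.dvd_of_dvd_mul_right ?_
    rw [← Int.mul_ediv_assoc _ (Int.gcd_dvd_left ..)]
    exact Int.ediv_dvd_ediv h1 h
  · intro h
    obtain ⟨q, rfl⟩ := h
    obtain ⟨e, he⟩ := Int.gcd_dvd_left d (M : ℤ)
    refine ⟨q * e, ?_⟩
    rw [← mul_assoc]
    conv_rhs => rw [← Int.ediv_mul_cancel h1]
    linear_combination ((M : ℤ) / (Int.gcd d (M : ℤ) : ℤ) * q) * he

variable (M) in
/-- The vectors `f(y)` are the solutions of `f A ≡ 0` modulo `M`. -/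
lemma dvd_vecMul_iff_exists_vecF (hM : 0 < M) (f : Fin n → ℤ) :
    (∀ j, (M : ℤ) ∣ Matrix.vecMul f A j) ↔ ∃ y, vecF S M y = f := by
  have hU := S.isUnit_det_U
  constructor
  · intro h
    have hf : f = Matrix.vecMul (Matrix.vecMul f S.U⁻¹) S.U := by
      rw [Matrix.vecMul_vecMul, Matrix.nonsing_inv_mul _ hU, Matrix.vecMul_one]
    generalize Matrix.vecMul f S.U⁻¹ = Y at hf
    subst hf
    rw [S.dvd_vecMul_iff] at h
    simp only [dvd_mul_iff_div_gcd_dvd hM] at h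
    choose q hq using h
    -- The sign of `q` undoes the one built into `vecY`.
    refine ⟨fun j => if h : (j : ℕ) < S.r then -q j h else Y j, ?_⟩
    rw [vecF]
    congr 1
    funext j
    unfold vecY
    beta_reduce
    split_ifs with hj
    · rw [neg_mul, neg_neg, mul_comm]
      exact (hq j hj).symm
    · rfl
  · rintro ⟨y, rfl⟩
    rw [vecF, S.dvd_vecMul_iff]
    intro i hi
    rw [dvd_mul_iff_div_gcd_dvd hM]
    simp [vecY, hi]

variable (M) in
-- `U` is invertible and the multipliers `M / (d'_i, M)` are nonzero because `M` is positive.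
lemma vecF_injective (hM : 0 < M) : Function.Injective (vecF S M) := by
  intro y y' h
  have hU := S.isUnit_det_U
  have h1 : vecY S M y = vecY S M y' := by
    have := congrArg (fun f => Matrix.vecMul f S.U⁻¹) h
    simpa only [vecF, Matrix.vecMul_vecMul, Matrix.mul_nonsing_inv _ hU, Matrix.vecMul_one]
      using this
  funext j
  have h2 := congrFun h1 j
  unfold vecY at h2
  split_ifs at h2 with hj
  · have h3 : M / Int.gcd (S.d ⟨j, hj⟩) (M : ℤ) ≠ 0 := by
      have h4 : Int.gcd (S.d ⟨j, hj⟩) (M : ℤ) ∣ M := Int.natCast_dvd_natCast.1 (Int.gcd_dvd_right ..)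
      exact (Nat.div_pos (Nat.le_of_dvd hM h4) (Nat.pos_of_dvd_of_pos h4 hM)).ne'
    exact mul_right_cancel₀ (by exact_mod_cast h3) (neg_injective h2)
  · exact h2

lemma killsModM_iff_exists_vecF (m : Fin n → ℕ) [∀ j, NeZero (m j)] (c : CocycleDatum n)
    (e : Fin (n.choose 2) ≃ pairs n) (S : SmithForm (matA m c e)) (f : Fin n → ℤ) :
    KillsModM m c f ↔ ∃ y, vecF S (lcmM m) y = f := by
  rw [← dvd_vecMul_iff_exists_vecF S (lcmM m) (lcmM_pos m)]
  refine ⟨fun h j => h _ (e j).2, fun h p hp => ?_⟩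
  have := h (e.symm ⟨p, hp⟩)
  have h2 : ∀ j, Matrix.vecMul f (matA m c e) j =
    ∑ u, f u * matEntry (Mc m c) u (e j).1.1 (e j).1.2 := fun _ => rfl
  rwa [h2, Equiv.apply_symm_apply] at this

end Smith

/-! ### Admissibility as a condition on a quadratic form -/

section Quadratic

variable {n : ℕ} (m : Fin n → ℕ) (c : CocycleDatum n)

/-- The rational number `∑ λ_j f_j / m_j + ∑ c_j f_j² / m_j² + ∑ c_{st} f_s f_t / (m_s m_t)`. -/
def quadForm (f l : Fin n → ℤ) : ℚ :=
  (∑ j, (l j : ℚ) * f j / m j) + (∑ j, (c.c₁ j : ℚ) * f j * f j / (m j : ℚ) ^ 2) +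
    ∑ p ∈ pairs n, (c.c₂ p.1 p.2 : ℚ) * f p.2 * f p.1 / ((m p.1 : ℚ) * m p.2)

lemma sum_sum_eq_sum_diag_add_sum_pairs (g : Fin n → Fin n → ℚ) :
    ∑ s, ∑ t, g s t = (∑ s, g s s) + ∑ p ∈ pairs n, (g p.1 p.2 + g p.2 p.1) := by
  have h1 : ∀ s t, g s t = (if s = t then g s t else 0) + (if s < t then g s t else 0) +
      (if t < s then g s t else 0) := by
    intro s t
    rcases lt_trichotomy s t with h | rfl | h
    · simp [h, h.ne, h.not_gt]
    · simp
    · simp [h, h.ne', h.not_gt]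
  rw [pairs, Finset.sum_filter, Fintype.sum_prod_type]
  simp_rw [ite_add_zero]
  conv_lhs => enter [2, s, 2, t]; rw [h1]
  simp only [Finset.sum_add_distrib, Finset.sum_ite_eq, Finset.mem_univ, if_true, add_assoc]
  congr 2
  exact Finset.sum_comm

/-- The entries at `(s, t)` and `(t, s)` contribute equally, which cancels the `2` in the
denominators of `C`. -/
lemma dotProduct_matC_mulVec (f : Fin n → ℚ) :
    f ⬝ᵥ Matrix.mulVec (matC m c) f = (∑ j, (c.c₁ j : ℚ) * f j * f j / (m j : ℚ) ^ 2) +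
      ∑ p ∈ pairs n, (c.c₂ p.1 p.2 : ℚ) * f p.2 * f p.1 / ((m p.1 : ℚ) * m p.2) := by
  have h1 : f ⬝ᵥ Matrix.mulVec (matC m c) f = ∑ s, ∑ t, f s * (matC m c s t * f t) := by
    simp only [dotProduct, Matrix.mulVec, Finset.mul_sum]
  rw [h1, sum_sum_eq_sum_diag_add_sum_pairs]
  congr 1
  · refine Finset.sum_congr rfl fun j _ => ?_
    simp only [matC, Matrix.of_apply, if_true]
    ring
  · refine Finset.sum_congr rfl fun p hp => ?_
    have hp' : p.1 < p.2 := by simpa [pairs] using hp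
    simp only [matC, Matrix.of_apply, hp'.ne, hp'.ne', hp', hp'.not_gt, if_true, if_false]
    have h2 : ∀ a x y : ℚ, a / (2 * x * y) = a / (x * y) / 2 := fun a x y => by
      rw [div_div, mul_comm (x * y), mul_assoc]
    rw [h2]
    ring

/-- Substituting `f = Y U'` absorbs both transposes of `U'`, so only `f` and the original `C`
remain. -/
lemma admissible_iff {b : ℕ} {A : Matrix (Fin n) (Fin b) ℤ} (S : SmithForm A) (y l : Fin n → ℤ) :
    Admissible m c S y l ↔ ∃ z : ℤ, quadForm m c (vecF S (lcmM m) y) l - 1 / 2 = z := by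
  have hf : Matrix.vecMul (fun j => (vecY S (lcmM m) y j : ℚ)) (S.U.map fun a : ℤ => (a : ℚ)) =
      fun j => (vecF S (lcmM m) y j : ℚ) := by
    funext j
    simp [vecF, Matrix.vecMul, dotProduct]
  have h1 : Matrix.vecMul (fun j => (l j : ℚ) / (m j : ℚ))
      (S.U.map fun a : ℤ => (a : ℚ)).transpose ⬝ᵥ (fun j => (vecY S (lcmM m) y j : ℚ)) =
      ∑ j, (l j : ℚ) * vecF S (lcmM m) y j / m j := by
    rw [Matrix.vecMul_transpose, dotProduct_comm, Matrix.dotProduct_mulVec, hf, dotProduct]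
    exact Finset.sum_congr rfl fun j _ => by ring
  have h2 : (fun j => (vecY S (lcmM m) y j : ℚ)) ⬝ᵥ Matrix.mulVec
      ((S.U.map fun a : ℤ => (a : ℚ)) * matC m c * (S.U.map fun a : ℤ => (a : ℚ)).transpose)
      (fun j => (vecY S (lcmM m) y j : ℚ)) =
      (fun j => (vecF S (lcmM m) y j : ℚ)) ⬝ᵥ Matrix.mulVec (matC m c)
        (fun j => (vecF S (lcmM m) y j : ℚ)) := by
    rw [Matrix.mul_assoc, ← Matrix.mulVec_mulVec, Matrix.dotProduct_mulVec, hf,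
      ← Matrix.mulVec_mulVec, Matrix.mulVec_transpose, hf]
  unfold Admissible
  simp only [h1, h2, dotProduct_matC_mulVec, quadForm, add_assoc]

/-- The rational numbers `∑ w_j f_j / m_j + z` with integers `w_j`, `z`. -/
def linearValues (f : Fin n → ℤ) : AddSubgroup ℚ where
  carrier := {r | ∃ (w : Fin n → ℤ) (z : ℤ), r = (∑ j, (w j : ℚ) * f j / m j) + z}
  zero_mem' := ⟨0, 0, by simp⟩
  add_mem' := by
    rintro _ _ ⟨w, z, rfl⟩ ⟨w', z', rfl⟩
    refine ⟨w + w', z + z', ?_⟩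
    simp only [Pi.add_apply, Int.cast_add, add_mul, add_div, Finset.sum_add_distrib]
    ring
  neg_mem' := by
    rintro _ ⟨w, z, rfl⟩
    refine ⟨-w, -z, ?_⟩
    simp only [Pi.neg_apply, Int.cast_neg, neg_mul, neg_div, Finset.sum_neg_distrib]
    ring

lemma intCast_mem_linearValues (f : Fin n → ℤ) (z : ℤ) : (z : ℚ) ∈ linearValues m f :=
  ⟨0, z, by simp⟩

lemma mul_div_mem_linearValues (f : Fin n → ℤ) (a : ℤ) (j : Fin n) :
    (a : ℚ) * f j / m j ∈ linearValues m f :=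
  ⟨Pi.single j a, 0, by
    rw [Finset.sum_eq_single j (fun i _ hi => by simp [hi]) (by simp)]
    simp⟩

variable [∀ j, NeZero (m j)]

/-- Changing `f` modulo the `m_j` amounts to changing `λ`. -/
lemma exists_quadForm_sub_eq {f f' : Fin n → ℤ} (h : ∀ j, (m j : ℤ) ∣ f' j - f j)
    (l : Fin n → ℤ) : ∃ (l' : Fin n → ℤ) (z : ℤ),
      quadForm m c f l' = quadForm m c f' l + z := by
  choose q hq using h
  obtain rfl : f' = fun j => f j + m j * q j := by
    funext j
    linarith [hq j]
  have hm : ∀ j, (m j : ℚ) ≠ 0 := fun j => by exact_mod_cast NeZero.ne (m j)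
  -- Expanding the squares and products, every extra term is an integer or an integer multiple of
  -- some `f_j / m_j`. The latter can be absorbed into `λ`.
  have hmem : quadForm m c (fun j => f j + m j * q j) l - quadForm m c f 0 ∈ linearValues m f := by
    have h1 : quadForm m c (fun j => f j + m j * q j) l - quadForm m c f 0 =
        (∑ j, ((l j : ℚ) * f j / m j + ((l j * q j : ℤ) : ℚ))) +
        (∑ j, (((2 * c.c₁ j * q j : ℤ) : ℚ) * f j / m j + ((c.c₁ j * q j * q j : ℤ) : ℚ))) +
        ∑ p ∈ pairs n, (((c.c₂ p.1 p.2 * q p.1 : ℤ) : ℚ) * f p.2 / m p.2 +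
          ((c.c₂ p.1 p.2 * q p.2 : ℤ) : ℚ) * f p.1 / m p.1 +
          ((c.c₂ p.1 p.2 * q p.1 * q p.2 : ℤ) : ℚ)) := by
      have e1 : ∀ a b d a' b' d' : ℚ, (a + b + d) - (a' + b' + d') =
        (a - a') + (b - b') + (d - d') := by intros; ring
      rw [quadForm, quadForm, e1]
      simp only [← Finset.sum_sub_distrib]
      congr 1
      · congr 1
        · refine Finset.sum_congr rfl fun j _ => ?_
          have := hm j
          push_cast
          simp only [Pi.zero_apply, Int.cast_zero]
          field_simp
          ring
        · refine Finset.sum_congr rfl fun j _ => ?_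
          have := hm j
          push_cast
          field_simp
          ring
      · refine Finset.sum_congr rfl fun p _ => ?_
        have := hm p.1
        have := hm p.2
        push_cast
        field_simp
        ring
    rw [h1]
    refine add_mem (add_mem (sum_mem fun j _ => add_mem ?_ ?_) (sum_mem fun j _ => add_mem ?_ ?_))
      (sum_mem fun p _ => add_mem (add_mem ?_ ?_) ?_)
    all_goals first | exact intCast_mem_linearValues m f _ | exact mul_div_mem_linearValues m f _ _
  obtain ⟨w, z, hw⟩ := hmem
  refine ⟨w, -z, ?_⟩
  have h2 : quadForm m c f w = quadForm m c f 0 + ∑ j, (w j : ℚ) * f j / m j := by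
    simp only [quadForm, Pi.zero_apply, Int.cast_zero, zero_mul, zero_div, Finset.sum_const_zero]
    ring
  rw [h2]
  push_cast
  linear_combination -hw

end Quadratic

/-! ### The value of `ρ` at `g` as a power of `ζ` -/

section Weight

variable {k : Type u} [Field k] {n : ℕ} {m : Fin n → ℕ} [∀ j, NeZero (m j)] (c : CocycleDatum n)
  {ζ : kˣ} (hζ : IsPrimitiveRoot ζ (lcmN m))

lemma exists_rhoUnit_self_eq_zpow (ζ : kˣ) (g : FinAb m) (l : Fin n → ℤ) :
    ∃ E : ℤ, rhoUnit m c ζ (fun j => (expo g j : ℤ)) l g = ζ ^ E ∧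
      (E : ℚ) = lcmN m * quadForm m c (fun j => (expo g j : ℤ)) l := by
  have hm : ∀ j, (m j : ℚ) ≠ 0 := fun j => by exact_mod_cast NeZero.ne (m j)
  refine ⟨(∑ j, ((lcmN m / m j : ℕ) : ℤ) * (l j * (expo g j : ℤ))) +
    (∑ j, ((lcmN m / m j ^ 2 : ℕ) : ℤ) * (c.c₁ j * (expo g j : ℤ) * (expo g j : ℤ))) +
    ∑ p ∈ pairs n, ((lcmN m / (m p.1 * m p.2) : ℕ) : ℤ) *
      (c.c₂ p.1 p.2 * (expo g p.2 : ℤ) * (expo g p.1 : ℤ)), ?_, ?_⟩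
  · simp only [rhoUnit, zpow_add, zpow_sum, zpow_mul, zpow_natCast]
  · simp only [Int.cast_add, Int.cast_sum, Int.cast_mul, Int.cast_natCast]
    rw [quadForm, mul_add, mul_add, Finset.mul_sum, Finset.mul_sum, Finset.mul_sum]
    congr 1
    · congr 1
      · refine Finset.sum_congr rfl fun j _ => ?_
        rw [Nat.cast_div (dvd_lcmN m j) (hm j)]
        push_cast
        ring
      · refine Finset.sum_congr rfl fun j _ => ?_
        rw [Nat.cast_div (sq_dvd_lcmN m j) (by push_cast; exact pow_ne_zero 2 (hm j))]
        push_cast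
        ring
    · refine Finset.sum_congr rfl fun p hp => ?_
      rw [Nat.cast_div (mul_dvd_lcmN m hp) (by push_cast; exact mul_ne_zero (hm _) (hm _))]
      push_cast
      ring

include hζ in
-- The value at `g` is a power of `ζ`, so `(-1)^N = 1`, which fails for odd `N` when `2 ≠ 0`.
lemma even_lcmN_of_rho_eq_neg_one (hk : (2 : k) ≠ 0) {g : FinAb m} {l : Fin n → ℤ}
    (h : rho m c ζ (fun j => (expo g j : ℤ)) l g = -1) : Even (lcmN m) := by
  obtain ⟨E, hE, -⟩ := exists_rhoUnit_self_eq_zpow c ζ g l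
  rw [rho_eq, hE] at h
  have h1 : (-1 : k) ^ lcmN m = 1 := by
    rw [← h, ← Units.val_pow_eq_pow_val, ← zpow_natCast, zpow_comm, zpow_natCast, hζ.pow_eq_one,
      one_zpow, Units.val_one]
  by_contra hodd
  rw [(Nat.not_even_iff_odd.1 hodd).neg_one_pow] at h1
  exact hk (by linear_combination -h1)

include hζ in
-- For even `N` one has `-1 = ζ^{N/2}`, so the exponent must be `N/2` modulo `N`; dividing by `N`
-- gives the half-integer condition.
lemma rho_eq_neg_one_iff (hN : Even (lcmN m)) (g : FinAb m) (l : Fin n → ℤ) :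
    rho m c ζ (fun j => (expo g j : ℤ)) l g = -1 ↔
      ∃ z : ℤ, quadForm m c (fun j => (expo g j : ℤ)) l - 1 / 2 = z := by
  obtain ⟨E, hE, hEq⟩ := exists_rhoUnit_self_eq_zpow c ζ g l
  obtain ⟨N', hN'⟩ := hN
  have hpos : (lcmN m : ℚ) ≠ 0 := by exact_mod_cast (lcmN_pos m).ne'
  have hneg : ζ ^ N' = -1 := by
    have h1 : IsPrimitiveRoot (ζ ^ N') 2 := hζ.pow (lcmN_pos m) (by omega)
    have := (IsPrimitiveRoot.coe_units_iff.2 h1).eq_neg_one_of_two_right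
    exact Units.ext (by rw [this, Units.val_neg, Units.val_one])
  have h2 : rho m c ζ (fun j => (expo g j : ℤ)) l g = -1 ↔ (lcmN m : ℤ) ∣ E - N' := by
    rw [rho_eq, hE, ← hζ.zpow_eq_one_iff_dvd, zpow_sub, zpow_natCast, mul_inv_eq_one, hneg,
      ← Units.val_inj, Units.val_neg, Units.val_one]
  have hNq : (lcmN m : ℚ) = N' + N' := by exact_mod_cast hN'
  rw [h2]
  constructor
  · rintro ⟨z, hz⟩
    refine ⟨z, mul_left_cancel₀ hpos ?_⟩
    have hz' : (E : ℚ) - N' = lcmN m * z := by exact_mod_cast hz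
    linear_combination hz' - hEq - hNq / 2
  · rintro ⟨z, hz⟩
    refine ⟨z, ?_⟩
    have : (E : ℚ) - N' = lcmN m * z := by
      linear_combination (lcmN m : ℚ) * hz + hEq + hNq / 2
    exact_mod_cast this

end Weight

end QuasiHopf

theorem mainTheorem8 {k : Type*} [Field k] (hk : (2 : k) ≠ 0)
    {n : ℕ} (m : Fin n → ℕ) [∀ j, NeZero (m j)] (c : CocycleDatum n)
    (ζ : kˣ) (hζ : IsPrimitiveRoot ζ (lcmN m))
    (e : Fin (n.choose 2) ≃ pairs n) (S : SmithForm (matA m c e)) :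
    (Nonempty (NontrivialBraidedHopf₂ (kGomega m c ζ hζ)) →
      Even (lcmN m) ∧ ∃ j, Even (m j)) ∧
    (Even (lcmN m) →
      (∀ y : Fin n → ℤ,
        (∃ l : Fin n → ℤ, Admissible m c S y l) ↔
        ∃ B : NontrivialBraidedHopf₂ (kGomega m c ζ hζ),
          ∀ (φ : FinAb m → k) (b : B.carrier), B.str.counit b = 0 →
            B.str.act φ b = φ (monomialElt m (vecF S (lcmM m) y)) • b) ∧
      ∃ Θ : Quotient (NontrivialBraidedHopf₂.setoid (kGomega m c ζ hζ)) ≃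
          {p : (Fin n → ℤ) × (Fin n → ℤ) //
            (∀ j, 0 ≤ vecF S (lcmM m) p.1 j ∧ vecF S (lcmM m) p.1 j < m j) ∧
            (∀ j, 0 ≤ p.2 j ∧ p.2 j < m j) ∧
            Admissible m c S p.1 p.2},
        ∀ B : NontrivialBraidedHopf₂ (kGomega m c ζ hζ),
          B.str.IsB
            (Pi.evalAlgHom k (fun _ : FinAb m => k)
              (monomialElt m (vecF S (lcmM m) (Θ (Quotient.mk _ B)).1.1)))
            (rho m c ζ (vecF S (lcmM m) (Θ (Quotient.mk _ B)).1.1)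
              (Θ (Quotient.mk _ B)).1.2)) := by
  refine ⟨?_, fun hN => ⟨fun y => ⟨?_, ?_⟩, ?_⟩⟩
  · rintro ⟨B⟩
    obtain ⟨g, v, hv, hg, -⟩ := B.str.exists_isB hk B.finrank_eq B.not_trivial
    obtain ⟨-, l, -, rfl⟩ := (isYetterDrinfeldPair_iff hζ).1 hv
    have hN := even_lcmN_of_rho_eq_neg_one c hζ hk hg
    exact ⟨hN, exists_even_of_even_lcmN m hN⟩
  · rintro ⟨l, hl⟩
    obtain ⟨z, hz⟩ := (admissible_iff m c S y l).1 hl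
    have hK := (killsModM_iff_exists_vecF m c e S _).2 ⟨y, rfl⟩
    set f := vecF S (lcmM m) y
    -- `f` need not lie in the box `0 ≤ f_j < m_j`, whereas the classification uses the reduced
    -- exponents of the group element; `l'` compensates for the reduction.
    obtain ⟨l', z', hl'⟩ := exists_quadForm_sub_eq m c
      (f := fun j => (expo (monomialElt m f) j : ℤ)) (f' := f)
      (fun j => (dvd_sub_comm).1 (dvd_expo_monomialElt_sub f j)) l
    have hw := (rho_eq_neg_one_iff c hζ hN (monomialElt m f) l').2 ⟨z + z', by
      push_cast; linear_combination hz + hl'⟩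
    have hY : IsYetterDrinfeldPair (omega m c ζ hζ) (monomialElt m f)
        (rho m c ζ (fun j => (expo (monomialElt m f) j : ℤ)) l') :=
      isYetterDrinfeldPair_rho hζ (hK.congr (dvd_expo_monomialElt_sub f)) l'
    obtain ⟨B, hB⟩ := exists_nontrivialBraidedHopf₂ hk hY hw
    exact ⟨B, fun φ b hb => hB.act_of_counit_eq_zero φ hb⟩
  · rintro ⟨B, hB⟩
    obtain ⟨g, v, hv, hg, hIsB⟩ := B.str.exists_isB hk B.finrank_eq B.not_trivial
    obtain ⟨-, l, -, rfl⟩ := (isYetterDrinfeldPair_iff hζ).1 hv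
    obtain rfl := hIsB.degree_eq hB
    obtain ⟨z, hz⟩ := (rho_eq_neg_one_iff c hζ hN _ l).1 hg
    obtain ⟨l', z', hl'⟩ := exists_quadForm_sub_eq m c (dvd_expo_monomialElt_sub (m := m)
      (vecF S (lcmM m) y)) l
    exact ⟨l', (admissible_iff m c S y l').2 ⟨z + z', by push_cast; linear_combination hz + hl'⟩⟩
  · let p : {p : (Fin n → ℤ) × (Fin n → ℤ) //
        (∀ j, 0 ≤ vecF S (lcmM m) p.1 j ∧ vecF S (lcmM m) p.1 j < m j) ∧
        (∀ j, 0 ≤ p.2 j ∧ p.2 j < m j) ∧ Admissible m c S p.1 p.2} → FinAb m × (FinAb m → k) :=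
      fun p => (monomialElt m (vecF S (lcmM m) p.1.1), rho m c ζ (vecF S (lcmM m) p.1.1) p.1.2)
    refine exists_equiv_of_parametrization (ω := omega m c ζ hζ) hk p ?_ ?_
    -- Inside the box `f` is recovered from the group element, `y` from `f`, and `λ` from `ρ` once
    -- `f` is known.
    · rintro ⟨⟨y, l⟩, hf, hl, ha⟩ ⟨⟨y', l'⟩, hf', hl', ha'⟩ h
      rw [Prod.mk.injEq] at h
      obtain ⟨h1, h2⟩ := h
      have h3 : vecF S (lcmM m) y = vecF S (lcmM m) y' := by
        rw [← expo_monomialElt_of_lt hf, ← expo_monomialElt_of_lt hf']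
        dsimp only at h1
        rw [h1]
      obtain rfl := vecF_injective S (lcmM m) (lcmM_pos m) h3
      obtain rfl := rhoUnit_injective c hζ hl hl' fun x => Units.ext (congrFun h2 x)
      rfl
    · rintro ⟨g, v⟩
      rw [isYetterDrinfeldPair_iff hζ]
      constructor
      · rintro ⟨⟨⟨y, l⟩, hf, hl, ha⟩, h⟩
        rw [Prod.mk.injEq] at h
        obtain ⟨rfl, rfl⟩ := h
        dsimp only at hf hl ha ⊢
        have hK := (killsModM_iff_exists_vecF m c e S _).2 ⟨y, rfl⟩
        rw [expo_monomialElt_of_lt hf]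
        refine ⟨⟨hK, l, hl, rfl⟩, ?_⟩
        have := rho_eq_neg_one_iff c hζ hN (monomialElt m (vecF S (lcmM m) y)) l
        rw [expo_monomialElt_of_lt hf] at this
        exact this.2 ((admissible_iff m c S y l).1 ha)
      · rintro ⟨⟨hK, l, hl, hv⟩, hg⟩
        dsimp only at hK hv hg
        subst hv
        -- The reduced exponents of `g` solve the congruence, so they equal `f(y)` exactly, not only
        -- modulo the `m_j`.
        obtain ⟨y, hy⟩ := (killsModM_iff_exists_vecF m c e S _).1 hK
        have hq := (rho_eq_neg_one_iff c hζ hN g l).1 hg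
        refine ⟨⟨(y, l), ?_, hl, (admissible_iff m c S y l).2 ?_⟩, ?_⟩
        · dsimp only
          rw [hy]
          exact fun j => ⟨by positivity, Int.ofNat_lt.2 (expo_lt g j)⟩
        · rwa [hy]
        · simp only [p, hy, monomialElt_expo]
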